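/- Let $\mathcal L=\mathbb Z\times\mathbb Z$. For a compact convex set $C\subset\mathbb R^2$ let the discrete hull $C^0$ be the convex hull of $C\cap\mathcal L$, let $|C^0|$ be its number of vertices, and let $\delta(C)$ be the Euclidean diameter of $C$. The model of computation is the real RAM with unit-cost arithmetic $+,-,\times,/$, comparisons, integer constants, indirect addressing and the floor function, in which $C$ is accessible only through line queries: for a given line $\ell$, one unit-time query tells whether $C\cap\ell$ is empty and, if not, returns the two end points of the segment $C\cap\ell$. Output is written to a write-only output list that does not count as space; space is the number of distinct memory cells accessed. **Theorem.** There is a single algorithm in this model and there are absolute constants $K,S$ such that, for every compact convex set $C\subset\mathbb R^2$ (no condition such as lattice-connectivity is imposed on $C\cap\mathcal L$, which may be empty) and every point $p\in C$, the algorithm, given the coordinates of $p$ and line queries to $C$, halts and outputs the vertices of $C^0$, each exactly once and in counterclockwise order, in time at most $$K\,\bigl(\log^2(2+\delta(C))+|C^0|\,\log(2+\delta(C))\bigr)$$ and using at most $S$ memory cells. That is, $C^0$ is computed in $O(\log^2\delta(C)+|C^0|\log\delta(C))$ time and $O(1)$ space. -/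

import Mathlib

namespace DiscreteHull

/-- The Euclidean plane. -/
abbrev Plane : Type := EuclideanSpace ℝ (Fin 2)

/-- The integer lattice `ℤ × ℤ` in the plane. -/
def lattice : Set Plane := {z | ∃ m n : ℤ, z = !₂[(m : ℝ), (n : ℝ)]}

/-- The discrete hull of `C`: the convex hull of the lattice points of `C`. -/
def discreteHull (C : Set Plane) : Set Plane := convexHull ℝ (C ∩ lattice)

/-- The vertices of a convex set. -/
def vertices (H : Set Plane) : Set Plane := Set.extremePoints ℝ H

/-- Twice the signed area of the triangle `P Q R`; it is positive exactly when `P`, `Q`, `R` make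
a strict left (counterclockwise) turn. -/
def orientation (P Q R : Plane) : ℝ :=
  (Q 0 - P 0) * (R 1 - P 1) - (Q 1 - P 1) * (R 0 - P 0)

/-- `l` lists every vertex of the convex set `H` exactly once, in counterclockwise order along the
boundary of `H` (starting from an arbitrary vertex). -/
structure IsVertexListCCW (l : List Plane) (H : Set Plane) : Prop where
  nodup : l.Nodup
  mem_iff : ∀ z : Plane, z ∈ l ↔ z ∈ vertices H
  ccw : ∀ i j k : Fin l.length, i < j → j < k → 0 < orientation (l.get i) (l.get j) (l.get k)

/-- The line `a x + b y = c`. -/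
def line (a b c : ℝ) : Set Plane := {z | a * z 0 + b * z 1 = c}

/-- A procedure that answers line queries: the line `a x + b y = c` is given by `a`, `b`, `c`. -/
abbrev Oracle : Type := ℝ → ℝ → ℝ → Option (Plane × Plane)

/-- The oracle computes the intersection of `C` with any line: it says whether the intersection is
empty and, if not, returns the two end points (in either order, possibly equal) of the segment in
which the line meets `C`. Nothing is known about the answer to a degenerate query `a = b = 0`. -/
def IsLineOracle (C : Set Plane) (O : Oracle) : Prop :=
  ∀ a b c : ℝ, (a ≠ 0 ∨ b ≠ 0) →
    (O a b c = none → C ∩ line a b c = ∅) ∧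
    (∀ P Q : Plane, O a b c = some (P, Q) → C ∩ line a b c = segment ℝ P Q)

/-! ### The real RAM with floor function and line queries -/

/-- The state of the machine: memory cells, each holding a real number, and a write-only output. -/
structure State where
  mem : ℕ → ℝ
  out : List Plane

/-- Write the value `x` into the cell `d`. -/
noncomputable def State.set (σ : State) (d : ℕ) (x : ℝ) : State :=
  { σ with mem := Function.update σ.mem d x }

/-- The elementary instructions. The arguments are addresses of memory cells, except for the integer
constant `n` of `const`; `d` is the destination. -/
inductive Instr : Type where
  | nop : Instr
  | const (d : ℕ) (n : ℤ) : Instr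
  | copy (d a : ℕ) : Instr
  | add (d a b : ℕ) : Instr
  | sub (d a b : ℕ) : Instr
  | mul (d a b : ℕ) : Instr
  | div (d a b : ℕ) : Instr
  | floor (d a : ℕ) : Instr
  /-- indirect addressing: copy into `d` the cell whose address is the content of `a` -/
  | load (d a : ℕ) : Instr
  /-- indirect addressing: copy `a` into the cell whose address is the content of `d` -/
  | store (d a : ℕ) : Instr
  /-- query the line whose coefficients are in `a`, `b`, `c`: the flag `f` becomes `0` if the line
  misses the body; otherwise it becomes `1` and `(px, py)`, `(qx, qy)` receive the end points -/
  | query (a b c f px py qx qy : ℕ) : Instr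
  /-- append the point with coordinates in `x`, `y` to the output -/
  | emit (x y : ℕ) : Instr

/-- The effect of an elementary instruction (division by zero returns zero). -/
noncomputable def Instr.exec (O : Oracle) : Instr → State → State
  | .nop, σ => σ
  | .const d n, σ => σ.set d (n : ℝ)
  | .copy d a, σ => σ.set d (σ.mem a)
  | .add d a b, σ => σ.set d (σ.mem a + σ.mem b)
  | .sub d a b, σ => σ.set d (σ.mem a - σ.mem b)
  | .mul d a b, σ => σ.set d (σ.mem a * σ.mem b)
  | .div d a b, σ => σ.set d (σ.mem a / σ.mem b)
  | .floor d a, σ => σ.set d (⌊σ.mem a⌋ : ℝ)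
  | .load d a, σ => σ.set d (σ.mem ⌊σ.mem a⌋₊)
  | .store d a, σ => σ.set ⌊σ.mem d⌋₊ (σ.mem a)
  | .query a b c f px py qx qy, σ =>
      match O (σ.mem a) (σ.mem b) (σ.mem c) with
      | none => σ.set f 0
      | some (P, Q) =>
          ((((σ.set f 1).set px (P 0)).set py (P 1)).set qx (Q 0)).set qy (Q 1)
  | .emit x y, σ => { σ with out := σ.out ++ [!₂[σ.mem x, σ.mem y]] }

/-- The memory cells that an elementary instruction accesses (reads or writes). -/
noncomputable def Instr.cells : Instr → State → Finset ℕ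
  | .nop, _ => ∅
  | .const d _, _ => {d}
  | .copy d a, _ => {d, a}
  | .add d a b, _ => {d, a, b}
  | .sub d a b, _ => {d, a, b}
  | .mul d a b, _ => {d, a, b}
  | .div d a b, _ => {d, a, b}
  | .floor d a, _ => {d, a}
  | .load d a, σ => {d, a, ⌊σ.mem a⌋₊}
  | .store d a, σ => {d, a, ⌊σ.mem d⌋₊}
  | .query a b c f px py qx qy, _ => {a, b, c, f, px, py, qx, qy}
  | .emit x y, _ => {x, y}

/-- Programs. The test of `branch a b` and of `loop a b` is whether the content of the cell `a` is
less than the content of the cell `b`. -/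
inductive Program : Type where
  | instr (i : Instr) : Program
  | seq (P Q : Program) : Program
  | branch (a b : ℕ) (P Q : Program) : Program
  | loop (a b : ℕ) (P : Program) : Program

/-- `Run O P σ σ' t s`: started in the state `σ`, the program `P` halts in the state `σ'` after `t`
steps, where each elementary instruction (line queries included) and each test is one step, and
`s` is the set of the memory cells accessed during the run. The program and `σ` determine `σ'`, `t`
and `s`; there are no such `σ'`, `t`, `s` if the program does not halt. -/
inductive Run (O : Oracle) : Program → State → State → ℕ → Finset ℕ → Prop where
  | instr (i : Instr) (σ : State) : Run O (.instr i) σ (i.exec O σ) 1 (i.cells σ)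
  | seq {P Q : Program} {σ₁ σ₂ σ₃ : State} {t₁ t₂ : ℕ} {s₁ s₂ : Finset ℕ}
      (h₁ : Run O P σ₁ σ₂ t₁ s₁) (h₂ : Run O Q σ₂ σ₃ t₂ s₂) :
      Run O (.seq P Q) σ₁ σ₃ (t₁ + t₂) (s₁ ∪ s₂)
  | branch_true {a b : ℕ} {P Q : Program} {σ₁ σ₂ : State} {t : ℕ} {s : Finset ℕ}
      (h : σ₁.mem a < σ₁.mem b) (h₁ : Run O P σ₁ σ₂ t s) :
      Run O (.branch a b P Q) σ₁ σ₂ (1 + t) ({a, b} ∪ s)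
  | branch_false {a b : ℕ} {P Q : Program} {σ₁ σ₂ : State} {t : ℕ} {s : Finset ℕ}
      (h : ¬ σ₁.mem a < σ₁.mem b) (h₁ : Run O Q σ₁ σ₂ t s) :
      Run O (.branch a b P Q) σ₁ σ₂ (1 + t) ({a, b} ∪ s)
  | loop_true {a b : ℕ} {P : Program} {σ₁ σ₂ σ₃ : State} {t₁ t₂ : ℕ} {s₁ s₂ : Finset ℕ}
      (h : σ₁.mem a < σ₁.mem b) (h₁ : Run O P σ₁ σ₂ t₁ s₁)
      (h₂ : Run O (.loop a b P) σ₂ σ₃ t₂ s₂) :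
      Run O (.loop a b P) σ₁ σ₃ (1 + t₁ + t₂) ({a, b} ∪ s₁ ∪ s₂)
  | loop_false {a b : ℕ} {P : Program} {σ : State}
      (h : ¬ σ.mem a < σ.mem b) : Run O (.loop a b P) σ σ 1 {a, b}

/-- The initial state: the coordinates of `p` in the cells `0` and `1`, zero in every other cell,
and an empty output. -/
noncomputable def initialState (p : Plane) : State where
  mem := fun n => if n = 0 then p 0 else if n = 1 then p 1 else 0
  out := []

end DiscreteHull

/-! Let `L` be the least natural number with `2 + diam C ≤ 2 ^ L`, and `N` the number of hull
vertices. Everything is done in lattice bases: if `cr a b = 1`, a vector `z` has the coordinates `x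
= cr z b`, `y = cr a z`, and one line query returns the interval of all `t` for which `a + t b` lies
in the body.

Finding a lattice point (`wp_locate`). Doubling and then halving a step gives points `Q₁`, `Q₂` of
`C` within height 1 of its bottom and top. A basis `a`, `b` is kept such that `C` lies in the rows
`cr a z = const` between those of `Q₁` and `Q₂`, up to a margin of 16. Either a middle row contains
a lattice point, or its chord is shorter than one lattice step. In the second case convexity keeps
`C` close to the segment from `Q₁` to `Q₂` (`abs_deviation_le`), so a shear of the basis at least
halves the row distance `n` and keeps the same margin (`Spread.step`). After at most `L` rounds `n ≤
16`, and at most 50 rows remain to be inspected.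

Finding an edge (`wp_next`). From a lattice point `v`, the first lattice direction of the body
counterclockwise from `d` is sought in a unimodular cone, as in Euclid's algorithm. If `z` in the
body has coordinates `x ≥ 1`, `y ≥ 0`, then `a + (y / x) b` is in the body by convexity, so the
queried interval confines all slopes `y / x`. Rounding an end of it to an integer gives a narrower
unimodular cone and possibly a better candidate. A step on the line `a + t b` followed by one on `b
+ t a` halves a bound on `x + y` (`ConeInv.sideBound`, `ConeInv.sumBound`); as `x + y ≤ 8 * 4 ^ L`
at the start, `O(L)` queries suffice.

Reaching the hull (`wp_descend`). Repeated edge searches from the leftmost lattice point of the row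
`c` follow the hull of the lattice points of height at most `c` downwards. Its corners need not be
vertices of the full hull, but each step starts at such a vertex or doubles the depth below row `c`
(`vertex_or_double`); only the initial step, from row `c` itself, can escape this dichotomy. Hence
`O(N + L)` steps lead to the lowest row.

Walking around (`wp_walk`). From the rightmost lattice point of the lowest row each search yields a
hull edge. Seen from the first vertex, the later ones form a strictly counterclockwise fan
(`IsWalk.cr_fan`); the fan triangles cover all lattice points (`IsWalk.cover`), so the closed walk
lists exactly the vertices.

In total `O((L + 1) (N + L + 1))` steps are made, with `L + 1` of order `log (2 + diam C)`. No
indirect addressing is used, so the cells accessed are among those named in the program. -/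

namespace DiscreteHull

/-! ### Static bounds on space and time -/

/-- The cells mentioned by an elementary instruction. -/
def Instr.support : Instr → Finset ℕ
  | .nop => ∅
  | .const d _ => {d}
  | .copy d a => {d, a}
  | .add d a b => {d, a, b}
  | .sub d a b => {d, a, b}
  | .mul d a b => {d, a, b}
  | .div d a b => {d, a, b}
  | .floor d a => {d, a}
  | .load d a => {d, a}
  | .store d a => {d, a}
  | .query a b c f px py qx qy => {a, b, c, f, px, py, qx, qy}
  | .emit x y => {x, y}

/-- The instruction does not use indirect addressing. -/
def Instr.direct : Instr → Bool
  | .load _ _ => false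
  | .store _ _ => false
  | _ => true

def Program.support : Program → Finset ℕ
  | .instr i => i.support
  | .seq P Q => P.support ∪ Q.support
  | .branch a b P Q => {a, b} ∪ (P.support ∪ Q.support)
  | .loop a b P => {a, b} ∪ P.support

def Program.direct : Program → Bool
  | .instr i => i.direct
  | .seq P Q => P.direct && Q.direct
  | .branch _ _ P Q => P.direct && Q.direct
  | .loop _ _ P => P.direct

def Program.loopFree : Program → Bool
  | .instr _ => true
  | .seq P Q => P.loopFree && Q.loopFree
  | .branch _ _ P Q => P.loopFree && Q.loopFree
  | .loop _ _ _ => false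

/-- The maximal running time of a loop-free program. -/
def Program.cost : Program → ℕ
  | .instr _ => 1
  | .seq P Q => P.cost + Q.cost
  | .branch _ _ P Q => 1 + (P.cost + Q.cost)
  | .loop _ _ _ => 0

/-- Without `load` and `store` every accessed cell is named in the program text, however often loops
repeat. This gives the constant space bound. -/
theorem Run.cells_subset {O : Oracle} {P : Program} {σ σ' : State} {t : ℕ} {s : Finset ℕ}
    (h : Run O P σ σ' t s) : P.direct = true → s ⊆ P.support := by
  induction h with
  | instr i σ =>
    intro hd
    cases i <;> first | exact Finset.Subset.refl _ | (simp [Program.direct, Instr.direct] at hd)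
  | seq h₁ h₂ ih₁ ih₂ =>
    intro hd
    simp only [Program.direct, Bool.and_eq_true] at hd
    exact Finset.union_subset_union (ih₁ hd.1) (ih₂ hd.2)
  | branch_true h h₁ ih =>
    intro hd
    simp only [Program.direct, Bool.and_eq_true] at hd
    exact Finset.union_subset_union_right ((ih hd.1).trans Finset.subset_union_left)
  | branch_false h h₁ ih =>
    intro hd
    simp only [Program.direct, Bool.and_eq_true] at hd
    exact Finset.union_subset_union_right ((ih hd.2).trans Finset.subset_union_right)
  | loop_true h h₁ h₂ ih₁ ih₂ =>
    intro hd
    exact Finset.union_subset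
      (Finset.union_subset_union_right (ih₁ (by simpa [Program.direct] using hd))) (ih₂ hd)
  | loop_false h =>
    intro hd
    exact Finset.subset_union_left

/-- Loop-free pieces cost a constant depending only on their text, so the time analysis reduces to
counting rounds of loops. -/
theorem Run.time_le_cost {O : Oracle} {P : Program} {σ σ' : State} {t : ℕ} {s : Finset ℕ}
    (h : Run O P σ σ' t s) : P.loopFree = true → t ≤ P.cost := by
  induction h with
  | instr i σ => intro _; exact le_rfl
  | seq h₁ h₂ ih₁ ih₂ =>
    intro hd
    simp only [Program.loopFree, Bool.and_eq_true] at hd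
    exact add_le_add (ih₁ hd.1) (ih₂ hd.2)
  | branch_true h h₁ ih =>
    intro hd
    simp only [Program.loopFree, Bool.and_eq_true] at hd
    have := ih hd.1
    simp only [Program.cost]; omega
  | branch_false h h₁ ih =>
    intro hd
    simp only [Program.loopFree, Bool.and_eq_true] at hd
    have := ih hd.2
    simp only [Program.cost]; omega
  | loop_true h h₁ h₂ ih₁ ih₂ => intro hd; simp [Program.loopFree] at hd
  | loop_false h => intro hd; simp [Program.loopFree] at hd

/-! ### Named variables and expressions -/

/-- The variables of the algorithm; `p0`, `p1` are the input cells. -/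
inductive Var : Type where
  | p0 | p1 | v0 | v1 | d0 | d1 | e0 | e1 | a0 | a1 | b0 | b1 | u0 | u1 | w0 | w1
  | k | m | go | lo | hi | zero | half | s | g | cc | q10 | q11 | q20 | q21 | n | bound
  | ce | found | s0 | s1 | run
  deriving DecidableEq

/-- The cell that holds a variable. -/
def Var.addr (x : Var) : ℕ := x.ctorIdx

theorem Var.addr_injective : Function.Injective Var.addr := by
  intro x y h
  have h' : x.ctorIdx = y.ctorIdx := h
  rw [← Var.ofNat_ctorIdx x, ← Var.ofNat_ctorIdx y, h']

theorem Var.addr_lt (x : Var) : x.addr < 64 := by cases x <;> decide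

/-- Arithmetic expressions. -/
inductive Ex : Type where
  | var (x : Var) : Ex
  | const (n : ℤ) : Ex
  | add (e f : Ex) : Ex
  | sub (e f : Ex) : Ex
  | mul (e f : Ex) : Ex
  | div (e f : Ex) : Ex
  | floor (e : Ex) : Ex

noncomputable def Ex.eval (ρ : Var → ℝ) : Ex → ℝ
  | .var x => ρ x
  | .const n => (n : ℝ)
  | .add e f => e.eval ρ + f.eval ρ
  | .sub e f => e.eval ρ - f.eval ρ
  | .mul e f => e.eval ρ * f.eval ρ
  | .div e f => e.eval ρ / f.eval ρ
  | .floor e => (⌊e.eval ρ⌋ : ℝ)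

/-- Code that evaluates an expression into the cell `r`, using only cells from `r` on. -/
def Ex.code (r : ℕ) : Ex → Program
  | .var x => .instr (.copy r x.addr)
  | .const n => .instr (.const r n)
  | .add e f => .seq (e.code r) (.seq (f.code (r + 1)) (.instr (.add r r (r + 1))))
  | .sub e f => .seq (e.code r) (.seq (f.code (r + 1)) (.instr (.sub r r (r + 1))))
  | .mul e f => .seq (e.code r) (.seq (f.code (r + 1)) (.instr (.mul r r (r + 1))))
  | .div e f => .seq (e.code r) (.seq (f.code (r + 1)) (.instr (.div r r (r + 1))))
  | .floor e => .seq (e.code r) (.instr (.floor r r))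

@[simp] theorem State.set_mem (σ : State) (d : ℕ) (x : ℝ) (n : ℕ) :
    (σ.set d x).mem n = if n = d then x else σ.mem n := by
  simp [State.set, Function.update_apply]

@[simp] theorem State.set_out (σ : State) (d : ℕ) (x : ℝ) : (σ.set d x).out = σ.out := rfl

theorem Ex.eval_congr {ρ ρ' : Var → ℝ} (h : ∀ x, ρ x = ρ' x) (e : Ex) : e.eval ρ = e.eval ρ' := by
  rw [funext h]

/-- Variables occupy cells below 64 and scratch cells start at `r ≥ 64`. The second operand is
evaluated from `r + 1` on, so neither the first operand nor any variable is disturbed. -/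
theorem Ex.run_code (O : Oracle) (e : Ex) : ∀ (r : ℕ), 64 ≤ r → ∀ σ : State,
    ∃ σ' t s, Run O (e.code r) σ σ' t s ∧ σ'.mem r = e.eval (fun x => σ.mem x.addr) ∧
      σ'.out = σ.out ∧ ∀ n < r, σ'.mem n = σ.mem n := by
  have bin : ∀ (e f : Ex) (i : ℕ → Instr) (op : ℝ → ℝ → ℝ),
      (∀ r σ, (i r).exec O σ = σ.set r (op (σ.mem r) (σ.mem (r + 1)))) →
      (∀ (r : ℕ), 64 ≤ r → ∀ σ : State,
        ∃ σ' t s, Run O (e.code r) σ σ' t s ∧ σ'.mem r = e.eval (fun x => σ.mem x.addr) ∧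
          σ'.out = σ.out ∧ ∀ n < r, σ'.mem n = σ.mem n) →
      (∀ (r : ℕ), 64 ≤ r → ∀ σ : State,
        ∃ σ' t s, Run O (f.code r) σ σ' t s ∧ σ'.mem r = f.eval (fun x => σ.mem x.addr) ∧
          σ'.out = σ.out ∧ ∀ n < r, σ'.mem n = σ.mem n) →
      ∀ (r : ℕ), 64 ≤ r → ∀ σ : State,
        ∃ σ' t s, Run O (.seq (e.code r) (.seq (f.code (r + 1)) (.instr (i r)))) σ σ' t s ∧
          σ'.mem r = op (e.eval (fun x => σ.mem x.addr)) (f.eval (fun x => σ.mem x.addr)) ∧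
          σ'.out = σ.out ∧ ∀ n < r, σ'.mem n = σ.mem n := by
    intro e f i op hi he hf r hr σ
    obtain ⟨σ₁, t₁, s₁, h₁, hm₁, ho₁, hn₁⟩ := he r hr σ
    obtain ⟨σ₂, t₂, s₂, h₂, hm₂, ho₂, hn₂⟩ := hf (r + 1) (by omega) σ₁
    refine ⟨_, _, _, .seq h₁ (.seq h₂ (.instr _ _)), ?_, ?_, ?_⟩
    · rw [hi, State.set_mem, if_pos rfl, hm₂, hn₂ r (by omega), hm₁]
      congr 1
      exact Ex.eval_congr (fun x => hn₁ _ (by have := x.addr_lt; omega)) f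
    · rw [hi, State.set_out, ho₂, ho₁]
    · intro n hn
      rw [hi, State.set_mem, if_neg (by omega), hn₂ n (by omega), hn₁ n hn]
  induction e with
  | var x =>
    intro r hr σ
    refine ⟨_, _, _, .instr _ _, ?_, ?_, ?_⟩
    · simp [Instr.exec, Ex.eval]
    · simp [Instr.exec]
    · intro n hn; simp [Instr.exec, hn.ne]
  | const c =>
    intro r hr σ
    refine ⟨_, _, _, .instr _ _, ?_, ?_, ?_⟩
    · simp [Instr.exec, Ex.eval]
    · simp [Instr.exec]
    · intro n hn; simp [Instr.exec, hn.ne]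
  | add e f he hf => exact bin e f _ (· + ·) (fun _ _ => rfl) he hf
  | sub e f he hf => exact bin e f _ (· - ·) (fun _ _ => rfl) he hf
  | mul e f he hf => exact bin e f _ (· * ·) (fun _ _ => rfl) he hf
  | div e f he hf => exact bin e f _ (· / ·) (fun _ _ => rfl) he hf
  | floor e he =>
    intro r hr σ
    obtain ⟨σ₁, t₁, s₁, h₁, hm₁, ho₁, hn₁⟩ := he r hr σ
    refine ⟨_, _, _, .seq h₁ (.instr _ _), ?_, ?_, ?_⟩
    · simp [Instr.exec, Ex.eval, hm₁]
    · simp [Instr.exec, ho₁]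
    · intro n hn; simp [Instr.exec, hn.ne, hn₁ n hn]

/-! ### Environments and weakest preconditions -/

/-- The values of the variables, and the output. -/
structure Env where
  val : Var → ℝ
  out : List Plane

noncomputable def Env.upd (ρ : Env) (x : Var) (r : ℝ) : Env :=
  { ρ with val := Function.update ρ.val x r }

@[simp] theorem Env.upd_val (ρ : Env) (x : Var) (r : ℝ) (y : Var) :
    (ρ.upd x r).val y = if y = x then r else ρ.val y := by
  simp [Env.upd, Function.update_apply]

@[simp] theorem Env.upd_out (ρ : Env) (x : Var) (r : ℝ) : (ρ.upd x r).out = ρ.out := rfl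

def Agrees (σ : State) (ρ : Env) : Prop :=
  σ.out = ρ.out ∧ ∀ x : Var, σ.mem x.addr = ρ.val x

/-- Started in `ρ`, the program halts within `T` steps in an environment satisfying `Q`. -/
def Wp (O : Oracle) (P : Program) (ρ : Env) (T : ℕ) (Q : Env → Prop) : Prop :=
  ∀ σ, Agrees σ ρ → ∃ σ' t s ρ', Run O P σ σ' t s ∧ Agrees σ' ρ' ∧ t ≤ T ∧ Q ρ'

/-- Started in `ρ`, the program halts in an environment satisfying `Q`. -/
def Ev (O : Oracle) (P : Program) (ρ : Env) (Q : Env → Prop) : Prop :=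
  ∀ σ, Agrees σ ρ → ∃ σ' t s ρ', Run O P σ σ' t s ∧ Agrees σ' ρ' ∧ Q ρ'

section
variable {O : Oracle} {P R : Program} {ρ : Env} {Q Q' : Env → Prop} {T T' : ℕ}

theorem Wp.mono (h : Wp O P ρ T Q) (hT : T ≤ T') (hQ : ∀ ρ', Q ρ' → Q' ρ') : Wp O P ρ T' Q' := by
  intro σ hσ
  obtain ⟨σ', t, s, ρ', h1, h2, h3, h4⟩ := h σ hσ
  exact ⟨σ', t, s, ρ', h1, h2, h3.trans hT, hQ _ h4⟩

theorem Ev.mono (h : Ev O P ρ Q) (hQ : ∀ ρ', Q ρ' → Q' ρ') : Ev O P ρ Q' := by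
  intro σ hσ
  obtain ⟨σ', t, s, ρ', h1, h2, h4⟩ := h σ hσ
  exact ⟨σ', t, s, ρ', h1, h2, hQ _ h4⟩

theorem Ev.wp (h : Ev O P ρ Q) (hP : P.loopFree = true) : Wp O P ρ P.cost Q := by
  intro σ hσ
  obtain ⟨σ', t, s, ρ', h1, h2, h4⟩ := h σ hσ
  exact ⟨σ', t, s, ρ', h1, h2, h1.time_le_cost hP, h4⟩

theorem Ev.seq (h : Ev O P ρ (fun ρ' => Ev O R ρ' Q)) : Ev O (.seq P R) ρ Q := by
  intro σ hσ
  obtain ⟨σ', t, s, ρ', h1, h2, h4⟩ := h σ hσ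
  obtain ⟨σ'', t', s', ρ'', h1', h2', h4'⟩ := h4 σ' h2
  exact ⟨σ'', _, _, ρ'', .seq h1 h1', h2', h4'⟩

theorem Wp.seq (h : Wp O P ρ T (fun ρ' => Wp O R ρ' T' Q)) : Wp O (.seq P R) ρ (T + T') Q := by
  intro σ hσ
  obtain ⟨σ', t, s, ρ', h1, h2, h3, h4⟩ := h σ hσ
  obtain ⟨σ'', t', s', ρ'', h1', h2', h3', h4'⟩ := h4 σ' h2
  exact ⟨σ'', _, _, ρ'', .seq h1 h1', h2', add_le_add h3 h3', h4'⟩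

/-- A loop-free prefix. -/
theorem Ev.wp_seq (hP : P.loopFree = true) (h : Ev O P ρ (fun ρ' => Wp O R ρ' T Q)) :
    Wp O (.seq P R) ρ (P.cost + T) Q := (h.wp hP).seq

/-- The index `n` of the invariant is a variant that strictly decreases, hence bounds the number of
rounds; the last `+ 1` pays for the failing test. -/
theorem Wp.loop {x y : Var} (I : ℕ → Env → Prop)
    (h : ∀ n ρ, I n ρ → ρ.val x < ρ.val y → Wp O P ρ T (fun ρ' => ∃ n' < n, I n' ρ')) :
    ∀ n ρ, I n ρ → Wp O (.loop x.addr y.addr P) ρ (n * (T + 1) + 1)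
      (fun ρ' => (∃ n', I n' ρ') ∧ ¬ ρ'.val x < ρ'.val y) := by
  intro n
  induction n using Nat.strong_induction_on with
  | _ n ih =>
    intro ρ hI σ hσ
    by_cases hc : ρ.val x < ρ.val y
    · obtain ⟨σ', t, s, ρ', h1, h2, h3, n', hn', h4⟩ := h n ρ hI hc σ hσ
      obtain ⟨σ'', t', s', ρ'', h1', h2', h3', h4'⟩ := ih n' hn' ρ' h4 σ' h2
      refine ⟨σ'', _, _, ρ'', .loop_true (by rw [hσ.2, hσ.2]; exact hc) h1 h1', h2', ?_, h4'⟩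
      have : (n' + 1) * (T + 1) ≤ n * (T + 1) := Nat.mul_le_mul_right _ hn'
      rw [add_mul] at this
      omega
    · exact ⟨σ, _, _, ρ, .loop_false (by rw [hσ.2, hσ.2]; exact hc), hσ, by omega, ⟨n, hI⟩, hc⟩

/-- Assignment of the value of an expression to a variable. -/
def assign (x : Var) (e : Ex) : Program := .seq (e.code 64) (.instr (.copy x.addr 64))

theorem Ev.assign {x : Var} {e : Ex} (h : Q (ρ.upd x (e.eval ρ.val))) :
    Ev O (assign x e) ρ Q := by
  intro σ hσ
  obtain ⟨σ₁, t₁, s₁, h₁, hm₁, ho₁, hn₁⟩ := e.run_code O 64 le_rfl σ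
  refine ⟨_, _, _, _, .seq h₁ (.instr _ _), ⟨?_, ?_⟩, h⟩
  · simp [Instr.exec, ho₁, hσ.1]
  · intro y
    simp only [Instr.exec, State.set_mem, Env.upd_val, Var.addr_injective.eq_iff]
    split_ifs
    · rw [hm₁]; exact Ex.eval_congr hσ.2 e
    · rw [hn₁ _ y.addr_lt, hσ.2]

/-- The conditional `if e < f then P else R`. -/
def ite (e f : Ex) (P R : Program) : Program :=
  .seq (e.code 64) (.seq (f.code 65) (.branch 64 65 P R))

theorem Ev.ite {e f : Ex} (h₁ : e.eval ρ.val < f.eval ρ.val → Ev O P ρ Q)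
    (h₂ : f.eval ρ.val ≤ e.eval ρ.val → Ev O R ρ Q) : Ev O (ite e f P R) ρ Q := by
  intro σ hσ
  obtain ⟨σ₁, t₁, s₁, r₁, hm₁, ho₁, hn₁⟩ := e.run_code O 64 le_rfl σ
  obtain ⟨σ₂, t₂, s₂, r₂, hm₂, ho₂, hn₂⟩ := f.run_code O 65 (by omega) σ₁
  have hag : Agrees σ₂ ρ := ⟨by rw [ho₂, ho₁, hσ.1], fun y => by
    have := y.addr_lt
    rw [hn₂ _ (by omega), hn₁ _ this, hσ.2]⟩
  have he : σ₂.mem 64 = e.eval ρ.val := by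
    rw [hn₂ _ (by omega), hm₁]; exact Ex.eval_congr hσ.2 e
  have hf : σ₂.mem 65 = f.eval ρ.val := by
    rw [hm₂]; exact Ex.eval_congr (fun y => by rw [hn₁ _ y.addr_lt, hσ.2]) f
  by_cases hc : e.eval ρ.val < f.eval ρ.val
  · obtain ⟨σ', t, s, ρ', g1, g2, g4⟩ := h₁ hc σ₂ hag
    exact ⟨σ', _, _, ρ', .seq r₁ (.seq r₂ (.branch_true (by rw [he, hf]; exact hc) g1)), g2, g4⟩
  · obtain ⟨σ', t, s, ρ', g1, g2, g4⟩ := h₂ (not_lt.1 hc) σ₂ hag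
    exact ⟨σ', _, _, ρ', .seq r₁ (.seq r₂ (.branch_false (by rw [he, hf]; exact hc) g1)), g2, g4⟩

/-- Conditional whose branches may contain loops. -/
theorem Wp.ite {e f : Ex} (h₁ : e.eval ρ.val < f.eval ρ.val → Wp O P ρ T Q)
    (h₂ : f.eval ρ.val ≤ e.eval ρ.val → Wp O R ρ T Q)
    (he' : (e.code 64).loopFree = true) (hf' : (f.code 65).loopFree = true) :
    Wp O (ite e f P R) ρ ((e.code 64).cost + ((f.code 65).cost + (1 + T))) Q := by
  intro σ hσ
  obtain ⟨σ₁, t₁, s₁, r₁, hm₁, ho₁, hn₁⟩ := e.run_code O 64 le_rfl σ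
  obtain ⟨σ₂, t₂, s₂, r₂, hm₂, ho₂, hn₂⟩ := f.run_code O 65 (by omega) σ₁
  have hag : Agrees σ₂ ρ := ⟨by rw [ho₂, ho₁, hσ.1], fun y => by
    have := y.addr_lt
    rw [hn₂ _ (by omega), hn₁ _ this, hσ.2]⟩
  have he : σ₂.mem 64 = e.eval ρ.val := by
    rw [hn₂ _ (by omega), hm₁]; exact Ex.eval_congr hσ.2 e
  have hf : σ₂.mem 65 = f.eval ρ.val := by
    rw [hm₂]; exact Ex.eval_congr (fun y => by rw [hn₁ _ y.addr_lt, hσ.2]) f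
  have c₁ := r₁.time_le_cost he'
  have c₂ := r₂.time_le_cost hf'
  by_cases hc : e.eval ρ.val < f.eval ρ.val
  · obtain ⟨σ', t, s, ρ', g1, g2, g3, g4⟩ := h₁ hc σ₂ hag
    exact ⟨σ', _, _, ρ', .seq r₁ (.seq r₂ (.branch_true (by rw [he, hf]; exact hc) g1)), g2,
      by omega, g4⟩
  · obtain ⟨σ', t, s, ρ', g1, g2, g3, g4⟩ := h₂ (not_lt.1 hc) σ₂ hag
    exact ⟨σ', _, _, ρ', .seq r₁ (.seq r₂ (.branch_false (by rw [he, hf]; exact hc) g1)), g2,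
      by omega, g4⟩

theorem Ev.nop (h : Q ρ) : Ev O (.instr .nop) ρ Q :=
  fun σ hσ => ⟨σ, _, _, ρ, .instr _ _, hσ, h⟩

theorem Ev.emit {x y : Var}
    (h : Q { ρ with out := ρ.out ++ [!₂[ρ.val x, ρ.val y]] }) :
    Ev O (.instr (.emit x.addr y.addr)) ρ Q := by
  intro σ hσ
  refine ⟨_, _, _, _, .instr _ _, ⟨?_, ?_⟩, h⟩
  · simp [Instr.exec, hσ.1, hσ.2]
  · intro z; exact hσ.2 z

/-! ### Line queries in parametric form -/

/-- A sequence of elementary instructions. -/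
def block : List Instr → Program
  | [] => .instr .nop
  | i :: l => .seq (.instr i) (block l)

theorem run_block (O : Oracle) (l : List Instr) : ∀ σ : State,
    ∃ t s, Run O (block l) σ (l.foldl (fun τ i => i.exec O τ) σ) t s := by
  induction l with
  | nil => intro σ; exact ⟨_, _, .instr _ _⟩
  | cons i l ih =>
    intro σ
    obtain ⟨t, s, h⟩ := ih (i.exec O σ)
    exact ⟨_, _, .seq (.instr _ _) h⟩

/-- The set of coordinate pairs of the points of `C`. -/
def coords (C : Set Plane) : Set (ℝ × ℝ) := {z | !₂[z.1, z.2] ∈ C}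

/-- Find the parameters `t`, from `lo` to `hi`, for which the point `(x + t u, y + t w)` lies in
the body; if there are none, the result is `lo = 0`, `hi = -1`. -/
def chord (x y u w : Ex) : Program :=
  .seq (x.code 64) <| .seq (y.code 65) <| .seq (u.code 66) <| .seq (w.code 67) <|
  .seq (block [.const 68 0, .sub 68 68 66, .mul 69 64 67, .mul 70 65 66, .sub 69 69 70, .const 70 0,
    .const 71 0, .query 67 68 69 71 72 73 74 75]) <|
  .branch 70 71
    (.seq (block [.sub 72 72 64, .mul 72 72 66, .sub 73 73 65, .mul 73 73 67, .add 72 72 73,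
        .sub 74 74 64, .mul 74 74 66, .sub 75 75 65, .mul 75 75 67, .add 74 74 75,
        .mul 76 66 66, .mul 77 67 67, .add 76 76 77, .div 72 72 76, .div 74 74 76])
      (.branch 72 74 (block [.copy Var.lo.addr 72, .copy Var.hi.addr 74])
        (block [.copy Var.lo.addr 74, .copy Var.hi.addr 72])))
    (block [.const Var.lo.addr 0, .const Var.hi.addr (-1)])

theorem mem_segment_param {x y u w s t r : ℝ} (hr : u ≠ 0 ∨ w ≠ 0) :
    (!₂[x + r * u, y + r * w] : Plane) ∈
      segment ℝ (!₂[x + s * u, y + s * w] : Plane) !₂[x + t * u, y + t * w] ↔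
    min s t ≤ r ∧ r ≤ max s t := by
  rw [show (min s t ≤ r ∧ r ≤ max s t) ↔ r ∈ segment ℝ s t by rw [segment_eq_uIcc]; rfl]
  constructor
  · rintro ⟨α, β, hα, hβ, hab, h⟩
    refine ⟨α, β, hα, hβ, hab, ?_⟩
    have h0 := congrArg (fun z : Plane => z 0) h
    have h1 := congrArg (fun z : Plane => z 1) h
    simp at h0 h1
    simp only [smul_eq_mul]
    rcases hr with hr | hr
    · apply mul_right_cancel₀ hr
      linear_combination h0 - x * hab
    · apply mul_right_cancel₀ hr
      linear_combination h1 - y * hab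
  · rintro ⟨α, β, hα, hβ, hab, h⟩
    refine ⟨α, β, hα, hβ, hab, ?_⟩
    simp only [smul_eq_mul] at h
    ext i
    fin_cases i
    · simp; rw [← h]; linear_combination x * hab
    · simp; rw [← h]; linear_combination y * hab

theorem exists_param {x y u w : ℝ} (hr : u ≠ 0 ∨ w ≠ 0) {P : Plane}
    (h : P ∈ line w (-u) (x * w - y * u)) :
    P = !₂[x + ((P 0 - x) * u + (P 1 - y) * w) / (u * u + w * w) * u,
      y + ((P 0 - x) * u + (P 1 - y) * w) / (u * u + w * w) * w] := by
  have hpos : u * u + w * w ≠ 0 := by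
    rcases hr with hr | hr
    · have := mul_self_pos.2 hr; have := mul_self_nonneg w; positivity
    · have := mul_self_pos.2 hr; have := mul_self_nonneg u; positivity
  have h' : w * P 0 + -u * P 1 = x * w - y * u := h
  ext i
  fin_cases i
  · simp only [Fin.zero_eta, Matrix.cons_val_zero]
    rw [div_mul_eq_mul_div, ← sub_eq_iff_eq_add', eq_div_iff hpos]
    linear_combination w * h'
  · simp only [Fin.mk_one, Matrix.cons_val_one, Matrix.cons_val_fin_one]
    rw [div_mul_eq_mul_div, ← sub_eq_iff_eq_add', eq_div_iff hpos]
    linear_combination (-u) * h'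

/-- The queried line is `w X - u Y = w x - u y`; projecting the end points on `(u, w)` recovers
their parameters. Since a missed line is encoded as `lo = 0`, `hi = -1`, the single test `hi < 0`
also catches the empty chord. -/
theorem Ev.chord {C : Set Plane} (hO : IsLineOracle C O) {x y u w : Ex}
    (hr : u.eval ρ.val ≠ 0 ∨ w.eval ρ.val ≠ 0)
    (h : ∀ l h : ℝ, (∀ t : ℝ, (x.eval ρ.val + t * u.eval ρ.val, y.eval ρ.val + t * w.eval ρ.val)
      ∈ coords C ↔ l ≤ t ∧ t ≤ h) → (h < l → h < 0) → Q ((ρ.upd .lo l).upd .hi h)) :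
    Ev O (chord x y u w) ρ Q := by
  intro σ hσ
  obtain ⟨σ₁, t₁, s₁, r₁, hm₁, ho₁, hn₁⟩ := x.run_code O 64 le_rfl σ
  obtain ⟨σ₂, t₂, s₂, r₂, hm₂, ho₂, hn₂⟩ := y.run_code O 65 (by omega) σ₁
  obtain ⟨σ₃, t₃, s₃, r₃, hm₃, ho₃, hn₃⟩ := u.run_code O 66 (by omega) σ₂
  obtain ⟨σ₄, t₄, s₄, r₄, hm₄, ho₄, hn₄⟩ := w.run_code O 67 (by omega) σ₃
  have a1 : ∀ z : Var, σ₁.mem z.addr = ρ.val z := fun z => by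
    have := z.addr_lt; rw [hn₁ _ (by omega), hσ.2]
  have a2 : ∀ z : Var, σ₂.mem z.addr = ρ.val z := fun z => by
    have := z.addr_lt; rw [hn₂ _ (by omega), a1]
  have a3 : ∀ z : Var, σ₃.mem z.addr = ρ.val z := fun z => by
    have := z.addr_lt; rw [hn₃ _ (by omega), a2]
  have a4 : ∀ z : Var, σ₄.mem z.addr = ρ.val z := fun z => by
    have := z.addr_lt; rw [hn₄ _ (by omega), a3]
  have o4 : σ₄.out = ρ.out := by rw [ho₄, ho₃, ho₂, ho₁, hσ.1]
  have m64 : σ₄.mem 64 = x.eval ρ.val := by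
    rw [hn₄ _ (by omega), hn₃ _ (by omega), hn₂ _ (by omega), hm₁]; exact Ex.eval_congr hσ.2 _
  have m65 : σ₄.mem 65 = y.eval ρ.val := by
    rw [hn₄ _ (by omega), hn₃ _ (by omega), hm₂]; exact Ex.eval_congr a1 _
  have m66 : σ₄.mem 66 = u.eval ρ.val := by
    rw [hn₄ _ (by omega), hm₃]; exact Ex.eval_congr a2 _
  have m67 : σ₄.mem 67 = w.eval ρ.val := by
    rw [hm₄]; exact Ex.eval_congr a3 _
  obtain ⟨t₅, s₅, r₅⟩ := run_block O [.const 68 0, .sub 68 68 66, .mul 69 64 67, .mul 70 65 66,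
    .sub 69 69 70, .const 70 0, .const 71 0, .query 67 68 69 71 72 73 74 75] σ₄
  generalize hX : x.eval ρ.val = X at *
  generalize hY : y.eval ρ.val = Y at *
  generalize hU : u.eval ρ.val = U at *
  generalize hW : w.eval ρ.val = W at *
  have hline : ∀ t : ℝ, (!₂[X + t * U, Y + t * W] : Plane) ∈ line W (-U) (X * W - Y * U) := by
    intro t; simp [line]; ring
  have hq := hO W (-U) (X * W - Y * U) (by rcases hr with h | h; exacts [.inr (neg_ne_zero.2 h), .inl h])
  simp only [List.foldl, Instr.exec, State.set_mem, m64, m65, m66, m67] at r₅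
  norm_num at r₅
  have hvar : ∀ (z : Var) (n : ℕ), 64 ≤ n → z.addr ≠ n := fun z n hn => by
    have := z.addr_lt; omega
  rcases hcase : O W (-U) (X * W - Y * U) with _ | ⟨A, B⟩
  · rw [hcase] at r₅
    simp only at r₅
    generalize hσ₅ : State.set _ 71 0 = σ₅ at r₅
    have a5 : ∀ z : Var, σ₅.mem z.addr = ρ.val z := fun z => by
      rw [← hσ₅]; simp [hvar z, a4]
    have o5 : σ₅.out = ρ.out := by rw [← hσ₅]; simp [o4]
    have hc : ¬ σ₅.mem 70 < σ₅.mem 71 := by rw [← hσ₅]; simp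
    obtain ⟨t₆, s₆, r₆⟩ := run_block O [.const Var.lo.addr 0, .const Var.hi.addr (-1)] σ₅
    refine ⟨_, _, _, _, .seq r₁ (.seq r₂ (.seq r₃ (.seq r₄ (.seq r₅ (.branch_false hc r₆))))),
      ⟨?_, ?_⟩, h 0 (-1) ?_ ?_⟩
    · simp [Instr.exec, o5]
    · intro z
      simp [Instr.exec, Var.addr_injective.eq_iff, a5]
    · intro t
      constructor
      · intro ht
        have := hq.1 hcase
        exact absurd (show (!₂[X + t * U, Y + t * W] : Plane) ∈ C ∩ line W (-U) (X * W - Y * U) from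
          ⟨ht, hline t⟩) (by rw [this]; exact Set.notMem_empty _)
      · rintro ⟨h1, h2⟩; linarith
    · intro _; norm_num
  · rw [hcase] at r₅
    simp only at r₅
    generalize hσ₅ : State.set _ 75 (B.ofLp 1) = σ₅ at r₅
    have a5 : ∀ z : Var, σ₅.mem z.addr = ρ.val z := fun z => by
      rw [← hσ₅]; simp [hvar z, a4]
    have o5 : σ₅.out = ρ.out := by rw [← hσ₅]; simp [o4]
    have hc : σ₅.mem 70 < σ₅.mem 71 := by rw [← hσ₅]; simp
    have m64 : σ₅.mem 64 = X := by rw [← hσ₅]; simp [m64]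
    have m65 : σ₅.mem 65 = Y := by rw [← hσ₅]; simp [m65]
    have m66 : σ₅.mem 66 = U := by rw [← hσ₅]; simp [m66]
    have m67 : σ₅.mem 67 = W := by rw [← hσ₅]; simp [m67]
    have m72 : σ₅.mem 72 = A 0 := by rw [← hσ₅]; simp
    have m73 : σ₅.mem 73 = A 1 := by rw [← hσ₅]; simp
    have m74 : σ₅.mem 74 = B 0 := by rw [← hσ₅]; simp
    have m75 : σ₅.mem 75 = B 1 := by rw [← hσ₅]; simp
    obtain ⟨t₆, s₆, r₆⟩ := run_block O [.sub 72 72 64, .mul 72 72 66, .sub 73 73 65, .mul 73 73 67,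
        .add 72 72 73, .sub 74 74 64, .mul 74 74 66, .sub 75 75 65, .mul 75 75 67, .add 74 74 75,
        .mul 76 66 66, .mul 77 67 67, .add 76 76 77, .div 72 72 76, .div 74 74 76] σ₅
    generalize hσ₆ : List.foldl _ σ₅ _ = σ₆ at r₆
    have a6 : ∀ z : Var, σ₆.mem z.addr = ρ.val z := fun z => by
      rw [← hσ₆]; simp [Instr.exec, hvar z, a5]
    have o6 : σ₆.out = ρ.out := by rw [← hσ₆]; simp [Instr.exec, o5]
    have n72 : σ₆.mem 72 = ((A 0 - X) * U + (A 1 - Y) * W) / (U * U + W * W) := by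
      rw [← hσ₆]; simp [Instr.exec, m64, m65, m66, m67, m72, m73]
    have n74 : σ₆.mem 74 = ((B 0 - X) * U + (B 1 - Y) * W) / (U * U + W * W) := by
      rw [← hσ₆]; simp [Instr.exec, m64, m65, m66, m67, m74, m75]
    have hseg := hq.2 A B hcase
    have hA := exists_param hr (show A ∈ line W (-U) (X * W - Y * U) from
      (hseg ▸ left_mem_segment ℝ A B : A ∈ C ∩ _).2)
    have hB := exists_param hr (show B ∈ line W (-U) (X * W - Y * U) from
      (hseg ▸ right_mem_segment ℝ A B : B ∈ C ∩ _).2)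
    rw [← n72] at hA
    rw [← n74] at hB
    have key : ∀ t : ℝ, (X + t * U, Y + t * W) ∈ coords C ↔
        min (σ₆.mem 72) (σ₆.mem 74) ≤ t ∧ t ≤ max (σ₆.mem 72) (σ₆.mem 74) := by
      intro t
      rw [← mem_segment_param hr, ← hA, ← hB, ← hseg]
      exact ⟨fun ht => ⟨ht, hline t⟩, fun ht => ht.1⟩
    by_cases hlt : σ₆.mem 72 < σ₆.mem 74
    · obtain ⟨t₇, s₇, r₇⟩ := run_block O [.copy Var.lo.addr 72, .copy Var.hi.addr 74] σ₆
      refine ⟨_, _, _, _, .seq r₁ (.seq r₂ (.seq r₃ (.seq r₄ (.seq r₅ (.branch_true hc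
        (.seq r₆ (.branch_true hlt r₇))))))), ⟨?_, ?_⟩, h (σ₆.mem 72) (σ₆.mem 74) ?_ ?_⟩
      · simp [Instr.exec, o6]
      · intro z
        simp [Instr.exec, Var.addr_injective.eq_iff, a6, (hvar _ _ _).symm]
      · simpa only [min_eq_left hlt.le, max_eq_right hlt.le] using key
      · intro h'; linarith
    · have hge := not_lt.1 hlt
      obtain ⟨t₇, s₇, r₇⟩ := run_block O [.copy Var.lo.addr 74, .copy Var.hi.addr 72] σ₆
      refine ⟨_, _, _, _, .seq r₁ (.seq r₂ (.seq r₃ (.seq r₄ (.seq r₅ (.branch_true hc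
        (.seq r₆ (.branch_false hlt r₇))))))), ⟨?_, ?_⟩, h (σ₆.mem 74) (σ₆.mem 72) ?_ ?_⟩
      · simp [Instr.exec, o6]
      · intro z
        simp [Instr.exec, Var.addr_injective.eq_iff, a6, (hvar _ _ _).symm]
      · simpa only [min_eq_right hge, max_eq_left hge] using key
      · intro h'; linarith

end

/-! ### The cross product -/

/-- The cross product of two planar vectors. -/
def cr {R : Type*} [CommRing R] (a b : R × R) : R := a.1 * b.2 - a.2 * b.1

section
variable {R : Type*} [CommRing R] (a b c d : R × R) (r : R)

theorem cr_add_left : cr (a + b) c = cr a c + cr b c := by simp [cr]; ring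
theorem cr_add_right : cr a (b + c) = cr a b + cr a c := by simp [cr]; ring
theorem cr_smul_left : cr (r • a) b = r * cr a b := by simp [cr]; ring
theorem cr_smul_right : cr a (r • b) = r * cr a b := by simp [cr]; ring
theorem cr_neg_left : cr (-a) b = - cr a b := by simp [cr]; ring
theorem cr_neg_right : cr a (-b) = - cr a b := by simp [cr]; ring
theorem cr_sub_left : cr (a - b) c = cr a c - cr b c := by simp [cr]; ring
theorem cr_sub_right : cr a (b - c) = cr a b - cr a c := by simp [cr]; ring
theorem cr_self : cr a a = 0 := by simp [cr]; ring
theorem cr_swap : cr a b = - cr b a := by simp [cr]; ring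

/-- The Plücker relation. It replaces comparisons of angles: transitivity of "to the left of" within
a half-plane is read off from signs. -/
theorem cr_plucker : cr a c * cr b d = cr a b * cr c d + cr a d * cr b c := by simp only [cr]; ring

variable {a b}

/-- Cramer's rule for a basis of determinant one. -/
theorem cr_decomp (h : cr a b = 1) : c = cr c b • a + cr a c • b := by
  simp only [cr] at h ⊢
  ext
  · simp; linear_combination (-c.1) * h
  · simp; linear_combination (-c.2) * h

end

/-- A lattice vector as a real vector. -/
def toR (z : ℤ × ℤ) : ℝ × ℝ := ((z.1 : ℝ), (z.2 : ℝ))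

theorem cr_toR (a b : ℤ × ℤ) : cr (toR a) (toR b) = ((cr a b : ℤ) : ℝ) := by simp [cr, toR]

theorem toR_add (a b : ℤ × ℤ) : toR (a + b) = toR a + toR b := by simp [toR]
theorem toR_neg (a : ℤ × ℤ) : toR (-a) = - toR a := by simp [toR]
theorem toR_smul (m : ℤ) (a : ℤ × ℤ) : toR (m • a) = (m : ℝ) • toR a := by simp [toR]
theorem toR_zero : toR 0 = 0 := by simp [toR]

/-- The quotient of two coordinates of a point far out in a convex set containing the origin is
the parameter of a point of the set. -/
theorem mem_of_one_le {D : Set (ℝ × ℝ)} (hD : Convex ℝ D) (h0 : (0 : ℝ × ℝ) ∈ D)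
    {A B z : ℝ × ℝ} (hab : cr A B = 1) (hz : z ∈ D) (hx : 1 ≤ cr z B) :
    A + (cr A z / cr z B) • B ∈ D := by
  have hpos : 0 < cr z B := by linarith
  have := hD.smul_mem_of_zero_mem h0 hz (t := 1 / cr z B)
    ⟨by positivity, (div_le_one hpos).2 hx⟩
  have hz' : (1 / cr z B) • z = (1 / cr z B) • (cr z B • A + cr A z • B) := by
    rw [← cr_decomp z hab]
  rwa [hz', smul_add, smul_smul, smul_smul, one_div_mul_cancel hpos.ne', one_smul,
    one_div_mul_eq_div] at this

/-! ### Searching for the first lattice direction -/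

/-- The state of the search for the first lattice direction of `D`, counterclockwise from `d`:
the candidate is `u`, and all better directions lie in the cone spanned by `a` and `b`. -/
structure ConeInv (D : Set (ℝ × ℝ)) (d a b u w : ℤ × ℤ) : Prop where
  det : cr a b = 1
  notMem : toR a ∉ D
  da : 1 ≤ cr d a
  db : 1 ≤ cr d b ∨ b = -d
  au : 0 ≤ cr a u
  bu : 0 ≤ cr b u
  wu : cr w u = 1
  hu : (toR u ∈ D ∧ 1 ≤ cr d u) ∨ u = -d
  cover : ∀ z, toR z ∈ D → 1 ≤ cr d z → 0 ≤ cr u z ∨ (1 ≤ cr z b ∧ 0 ≤ cr a z)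

/-- All lattice directions of `D` strictly to the left of `d` are weakly to the left of `u`. -/
def IsFirst (D : Set (ℝ × ℝ)) (d u : ℤ × ℤ) : Prop :=
  ∀ z, toR z ∈ D → 1 ≤ cr d z → 0 ≤ cr u z

/-- With `x = cr z b`, `y = cr a z` this bounds `x + y` over the part `x ≥ 1`, `y ≥ 0` of the cone.
It is the potential that limits the number of rounds. -/
def SumBound (D : Set (ℝ × ℝ)) (a b : ℤ × ℤ) (N : ℝ) : Prop :=
  ∀ z ∈ D, 1 ≤ cr z (toR b) → 0 ≤ cr (toR a) z → cr z (toR b) + cr (toR a) z ≤ N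

/-- The weaker bound on `y` alone, which holds between the two half-rounds. -/
def SideBound (D : Set (ℝ × ℝ)) (a b : ℤ × ℤ) (N : ℝ) : Prop :=
  ∀ z ∈ D, 1 ≤ cr z (toR b) → 0 ≤ cr (toR a) z → cr (toR a) z ≤ N

section Cone
variable {D : Set (ℝ × ℝ)} {d e a b u w : ℤ × ℤ} {l h N : ℝ}

theorem ConeInv.db_nonneg (hI : ConeInv D d a b u w) : 0 ≤ cr d b := by
  rcases hI.db with h | rfl
  · omega
  · rw [cr_neg_right, cr_self]; rfl

/-- Used when the candidate `u` is replaced by some `b'` between `d` and `u`: directions already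
dismissed as left of `u` are left of `b'` as well. The sign comes from the Plücker relation for `d`,
`b'`, `u`, `z`. -/
theorem ConeInv.improve (hI : ConeInv D d a b u w) {b' z : ℤ × ℤ} (hdb : 0 ≤ cr d b')
    (hbu : 0 ≤ cr b' u) (hdz : 1 ≤ cr d z) (huz : 0 ≤ cr u z) : 0 ≤ cr b' z := by
  rcases hI.hu with ⟨-, hdu⟩ | rfl
  · have := cr_plucker d b' u z
    have h2 : 0 ≤ cr d u * cr b' z := by rw [this]; positivity
    exact nonneg_of_mul_nonneg_right h2 (by omega)
  · rw [cr_neg_left] at huz; omega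

/-- Scaling `z` by `1 / x` moves it to `a + (y / x) b`, which stays in `D` because `0 ∈ D`. So the
chord bounds the slope of every point of the cone, not only of those on the queried line. -/
theorem ConeInv.ratio_first (hD : Convex ℝ D) (h0 : (0 : ℝ × ℝ) ∈ D) (hab : cr a b = 1)
    (hc : ∀ t : ℝ, toR a + t • toR b ∈ D ↔ l ≤ t ∧ t ≤ h) {z : ℝ × ℝ} (hz : z ∈ D)
    (hx : 1 ≤ cr z (toR b)) :
    l * cr z (toR b) ≤ cr (toR a) z ∧ cr (toR a) z ≤ h * cr z (toR b) := by
  have := (hc _).1 (mem_of_one_le hD h0 (by rw [cr_toR, hab]; simp) hz hx)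
  have hpos : 0 < cr z (toR b) := by linarith
  rwa [le_div_iff₀ hpos, div_le_iff₀ hpos] at this

/-- The same scaling for the basis `b`, `-a`, which also has determinant one. -/
theorem ConeInv.ratio_second (hD : Convex ℝ D) (h0 : (0 : ℝ × ℝ) ∈ D) (hab : cr a b = 1)
    (hc : ∀ t : ℝ, toR b + t • toR a ∈ D ↔ l ≤ t ∧ t ≤ h) {z : ℝ × ℝ} (hz : z ∈ D)
    (hy : 1 ≤ cr (toR a) z) :
    l * cr (toR a) z ≤ cr z (toR b) ∧ cr z (toR b) ≤ h * cr (toR a) z := by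
  have e1 : cr z (toR (-a)) = cr (toR a) z := by rw [toR_neg, cr_neg_right, cr_swap]; ring
  have := mem_of_one_le hD h0 (A := toR b) (B := toR (-a)) (z := z)
    (by rw [cr_toR, cr_neg_right, cr_swap, hab]; simp) hz (by rw [e1]; exact hy)
  rw [e1, toR_neg, smul_neg, ← neg_smul, ← neg_div, ← cr_swap, hc] at this
  have hpos : 0 < cr (toR a) z := by linarith
  rwa [le_div_iff₀ hpos, div_le_iff₀ hpos] at this

theorem ConeInv.exit_first (hI : ConeInv D d a b u w) (hD : Convex ℝ D) (h0 : (0 : ℝ × ℝ) ∈ D)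
    (hc : ∀ t : ℝ, toR a + t • toR b ∈ D ↔ l ≤ t ∧ t ≤ h) (hh : h < 0) : IsFirst D d u := by
  intro z hz hdz
  rcases hI.cover z hz hdz with h1 | ⟨h1, h2⟩
  · exact h1
  · have h1' : (1 : ℝ) ≤ cr (toR z) (toR b) := by rw [cr_toR]; exact_mod_cast h1
    have h2' : (0 : ℝ) ≤ cr (toR a) (toR z) := by rw [cr_toR]; exact_mod_cast h2
    have := (ConeInv.ratio_first hD h0 hI.det hc hz h1').2
    nlinarith

/-- A lattice point with `y = 0` would be a positive multiple of `a` and would force `a ∈ D`. Thus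
`y ≥ 1`, so division by `y` is allowed in the second half-round. -/
theorem ConeInv.one_le (hI : ConeInv D d a b u w) (hD : Convex ℝ D) (h0 : (0 : ℝ × ℝ) ∈ D)
    {z : ℤ × ℤ} (hz : toR z ∈ D) (h1 : 1 ≤ cr z b) (h2 : 0 ≤ cr a z) : 1 ≤ cr a z := by
  rcases h2.lt_or_eq with h | h
  · exact h
  · exfalso
    apply hI.notMem
    have h1' : (1 : ℝ) ≤ cr (toR z) (toR b) := by rw [cr_toR]; exact_mod_cast h1
    have := mem_of_one_le hD h0 (by rw [cr_toR, hI.det]; simp) hz h1'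
    rwa [cr_toR, ← h, Int.cast_zero, zero_div, zero_smul, add_zero] at this

theorem ConeInv.exit_second (hI : ConeInv D d a b u w) (hD : Convex ℝ D) (h0 : (0 : ℝ × ℝ) ∈ D)
    (hc : ∀ t : ℝ, toR b + t • toR a ∈ D ↔ l ≤ t ∧ t ≤ h) (hh : h < 0) : IsFirst D d u := by
  intro z hz hdz
  rcases hI.cover z hz hdz with h1 | ⟨h1, h2⟩
  · exact h1
  · have h3 := hI.one_le hD h0 hz h1 h2
    have h1' : (1 : ℝ) ≤ cr (toR z) (toR b) := by rw [cr_toR]; exact_mod_cast h1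
    have h3' : (1 : ℝ) ≤ cr (toR a) (toR z) := by rw [cr_toR]; exact_mod_cast h3
    have := (ConeInv.ratio_second hD h0 hI.det hc hz h3').2
    nlinarith

section First
variable (hI : ConeInv D d a b u w) (hD : Convex ℝ D) (h0 : (0 : ℝ × ℝ) ∈ D)
  (hc : ∀ t : ℝ, toR a + t • toR b ∈ D ↔ l ≤ t ∧ t ≤ h) (hh : 0 ≤ h)
include hI hc hh

/-- As `a ∉ D`, the parameter `0` is outside `[l, h]`; since `h ≥ 0`, it must lie below `l`. -/
theorem ConeInv.one_le_ceil : 1 ≤ ⌈l⌉ := by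
  by_contra hcon
  have hl : l ≤ 0 := by
    have := Int.le_ceil l
    have h2 : (⌈l⌉ : ℝ) ≤ 0 := by exact_mod_cast (by omega : ⌈l⌉ ≤ 0)
    linarith
  apply hI.notMem
  have := (hc 0).2 ⟨hl, hh⟩
  simpa using this

omit hI hh in
theorem ConeInv.notMem_first : toR (a + (⌈l⌉ - 1) • b) ∉ D := by
  rw [toR_add, toR_smul, hc]
  intro hcon
  have := Int.ceil_lt_add_one l
  push_cast at hcon
  linarith [hcon.1]

include hD h0 in
-- Here no integer lies in `[l, h]`. Every slope is strictly between `⌈l⌉ - 1` and `⌈l⌉`, so the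
-- cone shrinks and the candidate stays.
theorem ConeInv.step_first (hm : h < ⌈l⌉) :
    ConeInv D d (a + (⌈l⌉ - 1) • b) (a + (⌈l⌉ - 1) • b + b) u w := by
  have h1 := hI.one_le_ceil hc hh
  have h2 := ConeInv.notMem_first hc
  set m := ⌈l⌉
  have i4' := hI.db_nonneg
  obtain ⟨i1, i2, i3, i4, i5, i6, i7, i8, i9⟩ := hI
  have hmm : (0 : ℤ) ≤ m - 1 := by omega
  refine ⟨?_, h2, ?_, ?_, ?_, ?_, i7, i8, ?_⟩
  · simp only [cr_add_left, cr_add_right, cr_smul_left, cr_self, i1]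
    try rw [cr_swap b a, i1]
    ring
  · simp only [cr_add_right, cr_smul_right]; nlinarith
  · left; simp only [cr_add_right, cr_smul_right]; nlinarith
  · simp only [cr_add_left, cr_smul_left]; nlinarith
  · simp only [cr_add_left, cr_smul_left]; nlinarith
  · intro z hz hdz
    rcases i9 z hz hdz with hz1 | ⟨hz1, hz2⟩
    · exact .inl hz1
    · right
      have hz1' : (1 : ℝ) ≤ cr (toR z) (toR b) := by rw [cr_toR]; exact_mod_cast hz1
      have hr := ConeInv.ratio_first hD h0 i1 hc hz hz1'
      rw [cr_toR, cr_toR] at hr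
      have hl : ((m : ℝ) - 1) < l := by have := Int.ceil_lt_add_one l; simp only [m]; linarith
      have hx : (1 : ℝ) ≤ cr z b := by exact_mod_cast hz1
      have g1 : (m - 1) * cr z b < cr a z := by
        have : ((m : ℝ) - 1) * (cr z b : ℤ) < (cr a z : ℤ) := by nlinarith
        exact_mod_cast this
      have g2 : cr a z < m * cr z b := by
        have : ((cr a z : ℤ) : ℝ) < m * (cr z b : ℤ) := by nlinarith
        exact_mod_cast this
      constructor
      · simp only [cr_add_right, cr_smul_right]
        rw [cr_swap z a]; linarith
      · simp only [cr_add_left, cr_smul_left]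
        rw [cr_swap b z]; linarith

include hD h0 in
-- Now `a + ⌈l⌉ b` belongs to `D` and becomes the candidate. Slopes at least `⌈l⌉` are left of it;
-- smaller ones still exceed `⌈l⌉ - 1` and remain in the new cone.
theorem ConeInv.step_first_found (hm : ⌈l⌉ ≤ h) :
    ConeInv D d (a + (⌈l⌉ - 1) • b) (a + (⌈l⌉ - 1) • b + b) (a + (⌈l⌉ - 1) • b + b)
      (a + (⌈l⌉ - 1) • b) := by
  have h1 := hI.one_le_ceil hc hh
  have h2 := ConeInv.notMem_first hc
  have himp := fun {b' z : ℤ × ℤ} => hI.improve (b' := b') (z := z)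
  have hlm := Int.le_ceil l
  set m := ⌈l⌉
  have i4' := hI.db_nonneg
  obtain ⟨i1, i2, i3, i4, i5, i6, i7, i8, i9⟩ := hI
  have hmm : (0 : ℤ) ≤ m - 1 := by omega
  have hdet : cr (a + (m - 1) • b) (a + (m - 1) • b + b) = 1 := by
    simp only [cr_add_left, cr_add_right, cr_smul_left, cr_self, i1]
    try rw [cr_swap b a, i1]
    ring
  have hda : 1 ≤ cr d (a + (m - 1) • b) := by
    simp only [cr_add_right, cr_smul_right]; nlinarith
  have hdb : 1 ≤ cr d (a + (m - 1) • b + b) := by rw [cr_add_right]; linarith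
  have hmem : toR (a + (m - 1) • b + b) ∈ D := by
    have := (hc m).2 ⟨hlm, hm⟩
    convert this using 1
    rw [toR_add, toR_add, toR_smul]; push_cast; module
  refine ⟨hdet, h2, hda, .inl hdb, by rw [hdet]; norm_num, by rw [cr_self], hdet,
    .inl ⟨hmem, hdb⟩, ?_⟩
  intro z hz hdz
  rcases i9 z hz hdz with hz1 | ⟨hz1, hz2⟩
  · left
    apply himp (by omega) _ hdz hz1
    simp only [cr_add_left, cr_smul_left]; nlinarith
  · have hz1' : (1 : ℝ) ≤ cr (toR z) (toR b) := by rw [cr_toR]; exact_mod_cast hz1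
    have hr := ConeInv.ratio_first hD h0 i1 hc hz hz1'
    rw [cr_toR, cr_toR] at hr
    have hl : ((m : ℝ) - 1) < l := by have := Int.ceil_lt_add_one l; simp only [m]; linarith
    have hx : (1 : ℝ) ≤ cr z b := by exact_mod_cast hz1
    have g1 : (m - 1) * cr z b < cr a z := by
      have : ((m : ℝ) - 1) * (cr z b : ℤ) < (cr a z : ℤ) := by nlinarith
      exact_mod_cast this
    rcases lt_or_ge (cr a z) (m * cr z b) with g2 | g2
    · right
      constructor
      · simp only [cr_add_right, cr_smul_right]
        rw [cr_swap z a]; linarith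
      · simp only [cr_add_left, cr_smul_left]
        rw [cr_swap b z]; linarith
    · left
      simp only [cr_add_left, cr_smul_left]
      rw [cr_swap b z]; linarith

/-- In the new coordinates `x = x' + y'` and `y = y' + (m - 1) x`. Hence `x` and `y` are both at
least `y'`, and `2 y' ≤ x + y`. -/
theorem ConeInv.sideBound (hN : SumBound D a b N) :
    SideBound D (a + (⌈l⌉ - 1) • b) (a + (⌈l⌉ - 1) • b + b) (N / 2) := by
  have h1 := hI.one_le_ceil hc hh
  set m := ⌈l⌉
  have hm : (1 : ℝ) ≤ m := by exact_mod_cast h1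
  intro z hz hx hy
  have := hN z hz
  simp only [toR_add, toR_smul, cr_add_left, cr_add_right, cr_smul_left, cr_smul_right] at hx hy ⊢
  push_cast at hx hy ⊢
  rw [cr_swap z (toR a)] at hx
  rw [cr_swap (toR b) z] at hy ⊢
  have h3 : 1 ≤ cr z (toR b) := by nlinarith
  have h4 : 0 ≤ cr (toR a) z := by nlinarith
  have h5 := this h3 h4
  nlinarith

end First

section Second
variable (hI : ConeInv D d a b u w) (hD : Convex ℝ D) (h0 : (0 : ℝ × ℝ) ∈ D)
  (hc : ∀ t : ℝ, toR b + t • toR a ∈ D ↔ l ≤ t ∧ t ≤ h)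
include hI hc

omit hI in
theorem ConeInv.notMem_second : toR (b + ⌊h⌋ • a + a) ∉ D := by
  have : toR (b + ⌊h⌋ • a + a) = toR b + ((⌊h⌋ : ℝ) + 1) • toR a := by
    rw [toR_add, toR_add, toR_smul]; module
  rw [this, hc]
  intro hcon
  have := Int.lt_floor_add_one h
  linarith [hcon.2]

include hD h0 in
theorem ConeInv.step_second (hh : 0 ≤ h) (hm : ⌊h⌋ < l) :
    ConeInv D d (b + ⌊h⌋ • a + a) (b + ⌊h⌋ • a) u w := by
  have h2 := ConeInv.notMem_second hc
  have hone := fun {z : ℤ × ℤ} => hI.one_le hD h0 (z := z)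
  have hlt := Int.lt_floor_add_one h
  have hk : 0 ≤ ⌊h⌋ := Int.floor_nonneg.2 hh
  set k := ⌊h⌋
  have i4' := hI.db_nonneg
  obtain ⟨i1, i2, i3, i4, i5, i6, i7, i8, i9⟩ := hI
  refine ⟨?_, h2, ?_, ?_, ?_, ?_, i7, i8, ?_⟩
  · simp only [cr_add_left, cr_add_right, cr_smul_left, cr_smul_right, cr_self, i1]
    try rw [cr_swap b a, i1]
    ring
  · simp only [cr_add_right, cr_smul_right]; nlinarith
  -- For `k = 0` the vector `b` is unchanged and may still be `-d`, which is not strictly left of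
  -- `d`.
  · rcases hk.eq_or_lt with hk0 | hk0
    · rw [← hk0, zero_smul, add_zero]; exact i4
    · left; simp only [cr_add_right, cr_smul_right]; nlinarith
  · simp only [cr_add_left, cr_smul_left]; nlinarith
  · simp only [cr_add_left, cr_smul_left]; nlinarith
  · intro z hz hdz
    rcases i9 z hz hdz with hz1 | ⟨hz1, hz2⟩
    · exact .inl hz1
    · right
      have hy := hone hz hz1 hz2
      have hy' : (1 : ℝ) ≤ cr (toR a) (toR z) := by rw [cr_toR]; exact_mod_cast hy
      have hr := ConeInv.ratio_second hD h0 i1 hc hz hy'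
      rw [cr_toR, cr_toR] at hr
      have hx : (1 : ℝ) ≤ cr a z := by exact_mod_cast hy
      have g1 : k * cr a z < cr z b := by
        have : (k : ℝ) * (cr a z : ℤ) < (cr z b : ℤ) := by nlinarith
        exact_mod_cast this
      have g2 : cr z b < (k + 1) * cr a z := by
        have : ((cr z b : ℤ) : ℝ) < (k + 1) * (cr a z : ℤ) := by nlinarith
        exact_mod_cast this
      constructor
      · simp only [cr_add_right, cr_smul_right]
        rw [cr_swap z a]; linarith
      · simp only [cr_add_left, cr_smul_left]
        rw [cr_swap b z]; linarith

include hD h0 in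
-- The inverse slope `x / y` is at most `h < k + 1`. Points with `x / y ≤ k` are left of the new
-- candidate `b + k a`; the others stay in the new cone.
theorem ConeInv.step_second_found (hh : 0 ≤ h) (hm : l ≤ ⌊h⌋) :
    ConeInv D d (b + ⌊h⌋ • a + a) (b + ⌊h⌋ • a) (b + ⌊h⌋ • a) (b + ⌊h⌋ • a + a) := by
  have h2 := ConeInv.notMem_second hc
  have hone := fun {z : ℤ × ℤ} => hI.one_le hD h0 (z := z)
  have himp := fun {b' z : ℤ × ℤ} => hI.improve (b' := b') (z := z)
  have hlt := Int.lt_floor_add_one h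
  have hle := Int.floor_le h
  have hk : 0 ≤ ⌊h⌋ := Int.floor_nonneg.2 hh
  set k := ⌊h⌋
  have hmem : toR (b + k • a) ∈ D := by
    rw [toR_add, toR_smul]; exact (hc k).2 ⟨hm, hle⟩
  have i4' := hI.db_nonneg
  obtain ⟨i1, i2, i3, i4, i5, i6, i7, i8, i9⟩ := hI
  have hdet : cr (b + k • a + a) (b + k • a) = 1 := by
    simp only [cr_add_left, cr_add_right, cr_smul_left, cr_smul_right, cr_self, i1]
    try rw [cr_swap b a, i1]
    ring
  have hdb : 0 ≤ cr d (b + k • a) := by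
    simp only [cr_add_right, cr_smul_right]; nlinarith
  have hda : 1 ≤ cr d (b + k • a + a) := by rw [cr_add_right]; linarith
  refine ⟨hdet, h2, hda, ?_, by rw [hdet]; norm_num, by rw [cr_self], hdet, ?_, ?_⟩
  · rcases hk.eq_or_lt with hk0 | hk0
    · rw [← hk0, zero_smul, add_zero]; exact i4
    · left; simp only [cr_add_right, cr_smul_right]; nlinarith
  · rcases hk.eq_or_lt with hk0 | hk0
    · rw [← hk0, zero_smul, add_zero] at hmem ⊢
      rcases i4 with i4 | i4
      · exact .inl ⟨hmem, i4⟩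
      · exact .inr i4
    · left; refine ⟨hmem, ?_⟩; simp only [cr_add_right, cr_smul_right]; nlinarith
  intro z hz hdz
  rcases i9 z hz hdz with hz1 | ⟨hz1, hz2⟩
  · left
    apply himp hdb _ hdz hz1
    simp only [cr_add_left, cr_smul_left]; nlinarith
  · have hy := hone hz hz1 hz2
    have hy' : (1 : ℝ) ≤ cr (toR a) (toR z) := by rw [cr_toR]; exact_mod_cast hy
    have hr := ConeInv.ratio_second hD h0 i1 hc hz hy'
    rw [cr_toR, cr_toR] at hr
    have hx : (1 : ℝ) ≤ cr a z := by exact_mod_cast hy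
    have g2 : cr z b < (k + 1) * cr a z := by
      have : ((cr z b : ℤ) : ℝ) < (k + 1) * (cr a z : ℤ) := by nlinarith
      exact_mod_cast this
    rcases lt_or_ge (k * cr a z) (cr z b) with g1 | g1
    · right
      constructor
      · simp only [cr_add_right, cr_smul_right]
        rw [cr_swap z a]; linarith
      · simp only [cr_add_left, cr_smul_left]
        rw [cr_swap b z]; linarith
    · left
      simp only [cr_add_left, cr_smul_left]
      rw [cr_swap b z]; linarith

omit hI hc in
-- The new coordinates satisfy `x' + y' = y`, so a bound on `y` becomes one on the sum.
theorem ConeInv.sumBound (hh : 0 ≤ h) (hN : SideBound D a b N) :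
    SumBound D (b + ⌊h⌋ • a + a) (b + ⌊h⌋ • a) N := by
  have hk : 0 ≤ ⌊h⌋ := Int.floor_nonneg.2 hh
  set k := ⌊h⌋
  have hk' : (0 : ℝ) ≤ k := by exact_mod_cast hk
  intro z hz hx hy
  have := hN z hz
  simp only [toR_add, toR_smul, cr_add_left, cr_add_right, cr_smul_left, cr_smul_right] at hx hy ⊢
  rw [cr_swap z (toR a)] at hx ⊢
  rw [cr_swap (toR b) z] at hy ⊢
  have h3 : 0 ≤ cr (toR a) z := by nlinarith
  have h4 : 1 ≤ cr z (toR b) := by nlinarith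
  have h5 := this h4 h3
  nlinarith

end Second

end Cone

/-! ### Notation for programs -/

instance : Coe Var Ex := ⟨Ex.var⟩
instance : Add Ex := ⟨Ex.add⟩
instance : Sub Ex := ⟨Ex.sub⟩
instance : Mul Ex := ⟨Ex.mul⟩
instance : Div Ex := ⟨Ex.div⟩
instance : Neg Ex := ⟨fun e => Ex.sub (Ex.const 0) e⟩
instance (n : ℕ) : OfNat Ex n := ⟨Ex.const n⟩

section
variable (ρ : Var → ℝ) (e f : Ex)
@[simp] theorem Ex.eval_var (x : Var) : (Ex.var x).eval ρ = ρ x := rfl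
@[simp] theorem Ex.eval_add : (e + f).eval ρ = e.eval ρ + f.eval ρ := rfl
@[simp] theorem Ex.eval_sub : (e - f).eval ρ = e.eval ρ - f.eval ρ := rfl
@[simp] theorem Ex.eval_mul : (e * f).eval ρ = e.eval ρ * f.eval ρ := rfl
@[simp] theorem Ex.eval_div : (e / f).eval ρ = e.eval ρ / f.eval ρ := rfl
@[simp] theorem Ex.eval_floor : (Ex.floor e).eval ρ = (⌊e.eval ρ⌋ : ℝ) := rfl
@[simp] theorem Ex.eval_neg : (-e).eval ρ = - e.eval ρ := by
  change ((0 : ℤ) : ℝ) - e.eval ρ = _; simp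
@[simp] theorem Ex.eval_zero : (0 : Ex).eval ρ = 0 := Int.cast_zero
@[simp] theorem Ex.eval_one : (1 : Ex).eval ρ = 1 := Int.cast_one
end

infixr:60 " ;; " => Program.seq

/-- The smallest integer that is at least `e`. -/
def Ex.ceil (e : Ex) : Ex := -Ex.floor (-e)

@[simp] theorem Ex.eval_ceil (ρ : Var → ℝ) (e : Ex) : (Ex.ceil e).eval ρ = (⌈e.eval ρ⌉ : ℝ) := by
  simp [Ex.ceil, Int.floor_neg]

/-- Two variables hold the coordinates of a lattice vector. -/
def At (ρ : Env) (x y : Var) (z : ℤ × ℤ) : Prop := ρ.val x = z.1 ∧ ρ.val y = z.2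

/-- The environments differ at most in the given variables. -/
def Frame (V : List Var) (ρ ρ' : Env) : Prop :=
  ρ'.out = ρ.out ∧ ∀ x, x ∉ V → ρ'.val x = ρ.val x

theorem Frame.refl (V : List Var) (ρ : Env) : Frame V ρ ρ := ⟨rfl, fun _ _ => rfl⟩

theorem Frame.upd {V : List Var} {ρ ρ' : Env} (h : Frame V ρ ρ') {x : Var} {r : ℝ} (hx : x ∈ V) :
    Frame V ρ (ρ'.upd x r) := by
  refine ⟨h.1, fun y hy => ?_⟩
  rw [Env.upd_val, if_neg (by rintro rfl; exact hy hx)]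
  exact h.2 y hy

theorem Frame.at {V : List Var} {ρ ρ' : Env} (h : Frame V ρ ρ') {x y : Var} {z : ℤ × ℤ}
    (hz : At ρ x y z) (hx : x ∉ V) (hy : y ∉ V) : At ρ' x y z :=
  ⟨(h.2 x hx).trans hz.1, (h.2 y hy).trans hz.2⟩

/-! ### The search program -/

/-- The convex body, its oracle, and a bound for the size of the body. -/
structure IsBody (C : Set Plane) (O : Oracle) (L : ℕ) : Prop where
  oracle : IsLineOracle C O
  convex : Convex ℝ (coords C)
  near : ∀ z ∈ coords C, ∀ z' ∈ coords C, |z.1 - z'.1| ≤ 2 ^ L - 2 ∧ |z.2 - z'.2| ≤ 2 ^ L - 2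

/-- The body seen from the lattice point `v`. -/
def shift (C : Set Plane) (v : ℤ × ℤ) : Set (ℝ × ℝ) := {z | toR v + z ∈ coords C}

theorem mem_shift {C : Set Plane} {v a b : ℤ × ℤ} {t : ℝ} :
    toR a + t • toR b ∈ shift C v ↔
      ((v.1 : ℝ) + a.1 + t * b.1, (v.2 : ℝ) + a.2 + t * b.2) ∈ coords C := by
  simp [shift, toR, add_assoc]

theorem mem_shift' {C : Set Plane} {v b : ℤ × ℤ} {t : ℝ} :
    t • toR b ∈ shift C v ↔
      ((v.1 : ℝ) + t * b.1, (v.2 : ℝ) + t * b.2) ∈ coords C := by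
  simp [shift, toR]

theorem toR_mem_shift {C : Set Plane} {v b : ℤ × ℤ} :
    toR b ∈ shift C v ↔ toR (v + b) ∈ coords C := by
  rw [toR_add]; rfl

section
variable {C : Set Plane} {O : Oracle} {L : ℕ} {v d e : ℤ × ℤ}

theorem convex_shift (hB : IsBody C O L) (v : ℤ × ℤ) : Convex ℝ (shift C v) :=
  hB.convex.translate_preimage_right (toR v)

theorem zero_mem_shift (hv : toR v ∈ coords C) : (0 : ℝ × ℝ) ∈ shift C v := by
  simpa [shift] using hv

theorem abs_le_of_mem_shift (hB : IsBody C O L) (hv : toR v ∈ coords C) {z : ℝ × ℝ}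
    (hz : z ∈ shift C v) : |z.1| ≤ 2 ^ L - 2 ∧ |z.2| ≤ 2 ^ L - 2 := by
  have := hB.near _ hz _ hv
  simpa using this

end

def firstStep : Program :=
  chord (Var.v0 + Var.a0) (Var.v1 + Var.a1) Var.b0 Var.b1 ;;
  ite Var.hi 0 (assign .go 0)
    (assign .m (Ex.ceil Var.lo) ;;
     assign .a0 (Var.a0 + (Var.m - 1) * Var.b0) ;; assign .a1 (Var.a1 + (Var.m - 1) * Var.b1) ;;
     assign .b0 (Var.a0 + Var.b0) ;; assign .b1 (Var.a1 + Var.b1) ;;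
     ite Var.hi Var.m (.instr .nop)
       (assign .u0 Var.b0 ;; assign .u1 Var.b1 ;; assign .w0 Var.a0 ;; assign .w1 Var.a1))

def secondStep : Program :=
  chord (Var.v0 + Var.b0) (Var.v1 + Var.b1) Var.a0 Var.a1 ;;
  ite Var.hi 0 (assign .go 0)
    (assign .m (Ex.floor Var.hi) ;;
     assign .b0 (Var.b0 + Var.m * Var.a0) ;; assign .b1 (Var.b1 + Var.m * Var.a1) ;;
     assign .a0 (Var.b0 + Var.a0) ;; assign .a1 (Var.b1 + Var.a1) ;;
     ite Var.m Var.lo (.instr .nop)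
       (assign .u0 Var.b0 ;; assign .u1 Var.b1 ;; assign .w0 Var.a0 ;; assign .w1 Var.a1))

/-- The variables that the search changes. -/
def searchVars : List Var :=
  [.a0, .a1, .b0, .b1, .u0, .u1, .w0, .w1, .k, .m, .go, .lo, .hi]

/-- The search state stored in the variables satisfies the invariant and a size bound `B`. -/
def Searching (C : Set Plane) (v d : ℤ × ℤ) (B : ℤ × ℤ → ℤ × ℤ → Prop) (ρ : Env) : Prop :=
  ∃ a b u w, At ρ .a0 .a1 a ∧ At ρ .b0 .b1 b ∧ At ρ .u0 .u1 u ∧ At ρ .w0 .w1 w ∧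
    ConeInv (shift C v) d a b u w ∧
    ((ρ.val .go = 1 ∧ B a b) ∨ (ρ.val .go = 0 ∧ IsFirst (shift C v) d u))

theorem ne_zero_of_cr {a b : ℤ × ℤ} (h : cr a b = 1) :
    ((a.1 : ℝ) ≠ 0 ∨ (a.2 : ℝ) ≠ 0) ∧ ((b.1 : ℝ) ≠ 0 ∨ (b.2 : ℝ) ≠ 0) := by
  constructor <;> by_contra hc <;> push Not at hc <;>
    simp only [Int.cast_eq_zero] at hc <;> simp [cr, hc.1, hc.2] at h

section Search
variable {C : Set Plane} {O : Oracle} {L : ℕ} {v d : ℤ × ℤ} (hB : IsBody C O L)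
  (hv : toR v ∈ coords C) {ρ₀ ρ : Env} (hF : Frame searchVars ρ₀ ρ) (hvr : At ρ .v0 .v1 v)
include hB hv hF hvr

theorem ev_firstStep {N : ℝ} (h : Searching C v d (fun a b => SumBound (shift C v) a b N) ρ)
    (hgo : ρ.val .go = 1) :
    Ev O firstStep ρ (fun ρ' => Frame searchVars ρ₀ ρ' ∧
      Searching C v d (fun a b => 1 ≤ N ∧ SideBound (shift C v) a b (N / 2)) ρ') := by
  obtain ⟨a, b, u, w, ha, hb, hu, hw, hI, hg | hg⟩ := h
  swap
  · rw [hg.1] at hgo; norm_num at hgo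
  have hne := (ne_zero_of_cr hI.det).2
  have hD := convex_shift hB v
  have h0 := zero_mem_shift hv
  refine Ev.seq (Ev.chord hB.oracle (by simpa [hb.1, hb.2] using hne) ?_)
  intro l h hc hlh
  replace hc : ∀ t : ℝ, toR a + t • toR b ∈ shift C v ↔ l ≤ t ∧ t ≤ h := fun t => by
    rw [mem_shift, ← hc]; simp [hvr.1, hvr.2, ha.1, ha.2, hb.1, hb.2]
  refine Ev.ite ?_ ?_
  · intro hh
    replace hh : h < 0 := by simpa using hh
    refine Ev.assign ⟨?_, a, b, u, w, ?_⟩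
    · repeat' first | exact hF | refine Frame.upd ?_ (by decide)
    · simp only [At] at ha hb hu hw ⊢
      simp [-zsmul_eq_mul, ha, hb, hu, hw, hI, hI.exit_first hD h0 hc hh]
  · intro hh
    replace hh : 0 ≤ h := by simpa using hh
    -- The chord end `a + h b` lies in `D` and has cone coordinates `(1, h)`, so the bound cannot be
    -- below one.
    have hN : 1 ≤ N := by
      have hle : l ≤ h := not_lt.1 fun hcon => by linarith [hlh hcon]
      have := hg.2 _ ((hc h).2 ⟨hle, le_rfl⟩)
      rw [cr_add_left, cr_smul_left, cr_self, cr_add_right, cr_smul_right, cr_self, cr_toR,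
        hI.det] at this
      norm_num at this
      linarith [this hh]
    have hS := hI.sideBound hc hh hg.2
    refine Ev.seq (Ev.assign ?_)
    refine Ev.seq (Ev.assign ?_)
    refine Ev.seq (Ev.assign ?_)
    refine Ev.seq (Ev.assign ?_)
    refine Ev.seq (Ev.assign ?_)
    refine Ev.ite ?_ ?_
    · intro hm
      replace hm : h < ⌈l⌉ := by simpa using hm
      refine Ev.nop ⟨?_, a + (⌈l⌉ - 1) • b, a + (⌈l⌉ - 1) • b + b, u, w, ?_⟩
      · repeat' first | exact hF | refine Frame.upd ?_ (by decide)
      · simp only [At] at ha hb hu hw ⊢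
        simp [-zsmul_eq_mul, ha, hb, hu, hw, hI.step_first hD h0 hc hh hm, hS, hg.1, hN]
    · intro hm
      replace hm : ⌈l⌉ ≤ h := by simpa using hm
      refine Ev.seq (Ev.assign ?_)
      refine Ev.seq (Ev.assign ?_)
      refine Ev.seq (Ev.assign ?_)
      refine Ev.assign ⟨?_, a + (⌈l⌉ - 1) • b, a + (⌈l⌉ - 1) • b + b,
        a + (⌈l⌉ - 1) • b + b, a + (⌈l⌉ - 1) • b, ?_⟩
      · repeat' first | exact hF | refine Frame.upd ?_ (by decide)
      · simp only [At] at ha hb hu hw ⊢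
        simp [-zsmul_eq_mul, ha, hb, hI.step_first_found hD h0 hc hh hm, hS, hg.1, hN]

theorem ev_secondStep {N : ℝ} (h : Searching C v d (fun a b => 1 ≤ 2 * N ∧
      SideBound (shift C v) a b N) ρ) (hgo : ρ.val .go = 1) :
    Ev O secondStep ρ (fun ρ' => Frame searchVars ρ₀ ρ' ∧
      Searching C v d (fun a b => 1 ≤ 2 * N ∧ SumBound (shift C v) a b N) ρ') := by
  obtain ⟨a, b, u, w, ha, hb, hu, hw, hI, hg | hg⟩ := h
  swap
  · rw [hg.1] at hgo; norm_num at hgo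
  have hne := (ne_zero_of_cr hI.det).1
  have hD := convex_shift hB v
  have h0 := zero_mem_shift hv
  refine Ev.seq (Ev.chord hB.oracle (by simpa [ha.1, ha.2] using hne) ?_)
  intro l h hc hlh
  replace hc : ∀ t : ℝ, toR b + t • toR a ∈ shift C v ↔ l ≤ t ∧ t ≤ h := fun t => by
    rw [mem_shift, ← hc]; simp [hvr.1, hvr.2, ha.1, ha.2, hb.1, hb.2]
  refine Ev.ite ?_ ?_
  · intro hh
    replace hh : h < 0 := by simpa using hh
    refine Ev.assign ⟨?_, a, b, u, w, ?_⟩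
    · repeat' first | exact hF | refine Frame.upd ?_ (by decide)
    · simp only [At] at ha hb hu hw ⊢
      simp [-zsmul_eq_mul, ha, hb, hu, hw, hI, hI.exit_second hD h0 hc hh]
  · intro hh
    replace hh : 0 ≤ h := by simpa using hh
    have hS := ConeInv.sumBound hh hg.2.2
    refine Ev.seq (Ev.assign ?_)
    refine Ev.seq (Ev.assign ?_)
    refine Ev.seq (Ev.assign ?_)
    refine Ev.seq (Ev.assign ?_)
    refine Ev.seq (Ev.assign ?_)
    refine Ev.ite ?_ ?_
    · intro hm
      replace hm : ⌊h⌋ < l := by simpa using hm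
      refine Ev.nop ⟨?_, b + ⌊h⌋ • a + a, b + ⌊h⌋ • a, u, w, ?_⟩
      · repeat' first | exact hF | refine Frame.upd ?_ (by decide)
      · simp only [At] at ha hb hu hw ⊢
        simp [-zsmul_eq_mul, ha, hb, hu, hw, hI.step_second hD h0 hc hh hm, hS, hg.1, hg.2.1]
    · intro hm
      replace hm : l ≤ ⌊h⌋ := by simpa using hm
      refine Ev.seq (Ev.assign ?_)
      refine Ev.seq (Ev.assign ?_)
      refine Ev.seq (Ev.assign ?_)
      refine Ev.assign ⟨?_, b + ⌊h⌋ • a + a, b + ⌊h⌋ • a, b + ⌊h⌋ • a, b + ⌊h⌋ • a + a, ?_⟩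
      · repeat' first | exact hF | refine Frame.upd ?_ (by decide)
      · simp only [At] at ha hb hu hw ⊢
        simp [-zsmul_eq_mul, ha, hb, hI.step_second_found hD h0 hc hh hm, hS, hg.1, hg.2.1]

end Search

/-- One round of the search. -/
def searchBody : Program := firstStep ;; ite Var.zero Var.go secondStep (.instr .nop)

/-- The invariant of the search loop: `n` bounds the number of remaining rounds. -/
def SearchInv (C : Set Plane) (v d : ℤ × ℤ) (ρ₀ : Env) (n : ℕ) (ρ : Env) : Prop :=
  Frame searchVars ρ₀ ρ ∧
    Searching C v d (fun a b => 1 ≤ n ∧ SumBound (shift C v) a b (2 ^ n / 4)) ρ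

/-- A full round halves the bound on `x + y`. If the search stops within the round, the invariant
holds with index `0`, because only an active search needs `1 ≤ n`. -/
theorem ev_searchBody {C : Set Plane} {O : Oracle} {L : ℕ} {v d : ℤ × ℤ} (hB : IsBody C O L)
    (hv : toR v ∈ coords C) {ρ₀ ρ : Env} (hvr : At ρ₀ .v0 .v1 v) (hz : ρ₀.val .zero = 0) {n : ℕ}
    (h : SearchInv C v d ρ₀ n ρ) (hgo : ρ.val .zero < ρ.val .go) :
    Ev O searchBody ρ (fun ρ' => ∃ n' < n, SearchInv C v d ρ₀ n' ρ') := by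
  obtain ⟨hF, hS⟩ := h
  have hzr : ρ.val .zero = 0 := (hF.2 _ (by decide)).trans hz
  obtain ⟨a, b, u, w, ha, hb, hu, hw, hI, hg | hg⟩ := hS
  swap
  · rw [hg.1, hzr] at hgo; norm_num at hgo
  obtain ⟨hg, hn, hN⟩ := hg
  refine Ev.seq ((ev_firstStep hB hv hF (hF.at hvr (by decide) (by decide))
    ⟨a, b, u, w, ha, hb, hu, hw, hI, .inl ⟨hg, hN⟩⟩ hg).mono ?_)
  rintro ρ₁ ⟨hF₁, a₁, b₁, u₁, w₁, ha₁, hb₁, hu₁, hw₁, hI₁, hg₁⟩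
  have hz₁ : ρ₁.val .zero = 0 := (hF₁.2 _ (by decide)).trans hz
  refine Ev.ite ?_ ?_
  · intro hlt
    rcases hg₁ with ⟨hg₁, hn₁, hN₁⟩ | hg₁
    swap
    · simp [hz₁, hg₁.1] at hlt
    refine (ev_secondStep hB hv hF₁ (hF₁.at hvr (by decide) (by decide)) (N := 2 ^ n / 4 / 2)
      ⟨a₁, b₁, u₁, w₁, ha₁, hb₁, hu₁, hw₁, hI₁, .inl ⟨hg₁, by linarith, hN₁⟩⟩ hg₁).mono ?_
    rintro ρ₂ ⟨hF₂, a₂, b₂, u₂, w₂, ha₂, hb₂, hu₂, hw₂, hI₂, hg₂⟩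
    refine ⟨n - 1, by omega, hF₂, a₂, b₂, u₂, w₂, ha₂, hb₂, hu₂, hw₂, hI₂, ?_⟩
    rcases hg₂ with ⟨hg₂, hn₂, hN₂⟩ | hg₂
    · obtain ⟨k, rfl⟩ : ∃ k, n = k + 1 := ⟨n - 1, by omega⟩
      refine .inl ⟨hg₂, ?_, ?_⟩
      -- For `n = 1` the bound `2 ^ n / 4` would be less than one, contradicting `hn₁`.
      · rcases k with _ | k
        · norm_num at hn₁
        · omega
      · rw [pow_succ] at hN₂
        convert hN₂ using 1
        simp; ring
    · exact .inr hg₂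
  · intro hle
    rcases hg₁ with ⟨hg₁, hn₁, hN₁⟩ | hg₁
    · simp [hz₁, hg₁] at hle; norm_num at hle
    · exact Ev.nop ⟨0, by omega, hF₁, a₁, b₁, u₁, w₁, ha₁, hb₁, hu₁, hw₁, hI₁, .inr hg₁⟩

/-- In the basis `d`, `e`, a point left of `d` has `cr z e / cr d z ≤ h < ⌊h⌋ + 1`, so it lies in
the cone from `e + (⌊h⌋ + 1) d` to `-d`. The initial candidate `-d` means that nothing has been
found. -/
theorem coneInv_init {D : Set (ℝ × ℝ)} (hD : Convex ℝ D) (h0 : (0 : ℝ × ℝ) ∈ D) {d e : ℤ × ℤ}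
    (hde : cr d e = 1) {l h : ℝ} (hc : ∀ t : ℝ, toR e + t • toR d ∈ D ↔ l ≤ t ∧ t ≤ h) :
    ConeInv D d (e + (⌊h⌋ + 1) • d) (-d) (-d) (e + (⌊h⌋ + 1) • d) := by
  have hed : cr e d = -1 := by rw [cr_swap, hde]
  have hdet : cr (e + (⌊h⌋ + 1) • d) (-d) = 1 := by
    simp [-zsmul_eq_mul, cr_add_left, cr_smul_left, cr_neg_right, cr_self, hed]
  have hlt := Int.lt_floor_add_one h
  refine ⟨hdet, ?_, ?_, .inr rfl, by rw [hdet]; norm_num, by rw [cr_self], hdet, .inr rfl, ?_⟩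
  · rw [toR_add, toR_smul, hc]
    intro hcon
    push_cast at hcon
    linarith [hcon.2]
  · simp [-zsmul_eq_mul, cr_add_right, cr_smul_right, cr_self, hde]
  · intro z hz hdz
    right
    have h1 : (1 : ℝ) ≤ cr (toR d) (toR z) := by rw [cr_toR]; exact_mod_cast hdz
    have := (ConeInv.ratio_second hD h0 hde hc hz h1).2
    rw [cr_toR, cr_toR] at this
    have hx : (1 : ℝ) ≤ (cr d z : ℤ) := by exact_mod_cast hdz
    have g : cr z e < (⌊h⌋ + 1) * cr d z := by
      have : ((cr z e : ℤ) : ℝ) < (⌊h⌋ + 1) * (cr d z : ℤ) := by nlinarith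
      exact_mod_cast this
    constructor
    · rw [cr_neg_right, cr_swap, neg_neg]; exact hdz
    · rw [cr_add_left, cr_smul_left, cr_swap e z]; linarith

theorem abs_cr_le {a b : ℝ × ℝ} {M N : ℝ} (ha : |a.1| ≤ M ∧ |a.2| ≤ M)
    (hb : |b.1| ≤ N ∧ |b.2| ≤ N) : cr a b ≤ 2 * (M * N) := by
  have h1 : |a.1 * b.2| ≤ M * N := by
    rw [abs_mul]; exact mul_le_mul ha.1 hb.2 (abs_nonneg _) ((abs_nonneg _).trans ha.1)
  have h2 : |a.2 * b.1| ≤ M * N := by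
    rw [abs_mul]; exact mul_le_mul ha.2 hb.1 (abs_nonneg _) ((abs_nonneg _).trans ha.1)
  have h3 := (abs_le.1 h1).2
  have h4 := (abs_le.1 h2).1
  simp only [cr]; linarith

/-- The vector `e` may be huge, but the chord end `e + h d` lies in `D`. Writing `a` as this point
plus at most one `d` bounds both coordinates by cross products of vectors of size `M`. -/
theorem sumBound_init {D : Set (ℝ × ℝ)} (hD : Convex ℝ D) (h0 : (0 : ℝ × ℝ) ∈ D) {d e : ℤ × ℤ}
    (hde : cr d e = 1) {l h M : ℝ} (hc : ∀ t : ℝ, toR e + t • toR d ∈ D ↔ l ≤ t ∧ t ≤ h)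
    (hM : ∀ z ∈ D, |z.1| ≤ M ∧ |z.2| ≤ M) (hd : |(d.1 : ℝ)| ≤ M ∧ |(d.2 : ℝ)| ≤ M) :
    SumBound D (e + (⌊h⌋ + 1) • d) (-d) (8 * (M * M)) := by
  intro z hz hx hy
  rw [toR_neg, cr_neg_right, cr_swap, neg_neg] at hx ⊢
  have h1 := (hc _).1 (by
    have := mem_of_one_le hD h0 (A := toR e) (B := toR (-d)) (z := z)
      (by rw [cr_toR, cr_neg_right, cr_swap, hde]; simp) hz
      (by rw [toR_neg, cr_neg_right, cr_swap, neg_neg]; exact hx)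
    rw [toR_neg, smul_neg, ← neg_smul] at this; exact this)
  have hmem := (hc h).2 ⟨h1.1.trans h1.2, le_rfl⟩
  have b1 : cr (toR e + h • toR d) z ≤ 2 * (M * M) := abs_cr_le (hM _ hmem) (hM z hz)
  have b2 : cr (toR d) z ≤ 2 * (M * M) := abs_cr_le hd (hM z hz)
  have e1 : cr (toR (e + (⌊h⌋ + 1) • d)) z =
      cr (toR e + h • toR d) z + (⌊h⌋ + 1 - h) * cr (toR d) z := by
    rw [toR_add, toR_smul]; simp only [cr_add_left, cr_smul_left]; push_cast; ring
  rw [e1]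
  have := Int.floor_le h
  have := mul_self_nonneg M
  nlinarith

/-- Find the first lattice direction `u` from `v`, counterclockwise from `d`, and the largest
multiple `k u` that stays in the body. -/
def next : Program :=
  (chord (Var.v0 + Var.e0) (Var.v1 + Var.e1) Var.d0 Var.d1 ;;
    assign .k (Ex.floor Var.hi) ;;
    assign .a0 (Var.e0 + (Var.k + 1) * Var.d0) ;; assign .a1 (Var.e1 + (Var.k + 1) * Var.d1) ;;
    assign .b0 (-Var.d0) ;; assign .b1 (-Var.d1) ;; assign .u0 Var.b0 ;; assign .u1 Var.b1 ;;
    assign .w0 Var.a0 ;; assign .w1 Var.a1 ;; assign .go 1) ;;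
  .loop Var.zero.addr Var.go.addr searchBody ;;
  chord Var.v0 Var.v1 Var.u0 Var.u1 ;; assign .k (Ex.floor Var.hi)

/-- The result of `next`. -/
structure IsNext (C : Set Plane) (v d u w : ℤ × ℤ) (k : ℤ) : Prop where
  wu : cr w u = 1
  hu : (toR u ∈ shift C v ∧ 1 ≤ cr d u) ∨ u = -d
  first : IsFirst (shift C v) d u
  mult : ∀ j : ℤ, 0 ≤ j → (toR (j • u) ∈ shift C v ↔ j ≤ k)

/-- A bound for the running time of `next`. -/
def nextTime (L : ℕ) : ℕ :=
  (chord (Var.v0 + Var.e0) (Var.v1 + Var.e1) Var.d0 Var.d1 ;;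
    assign .k (Ex.floor Var.hi) ;;
    assign .a0 (Var.e0 + (Var.k + 1) * Var.d0) ;; assign .a1 (Var.e1 + (Var.k + 1) * Var.d1) ;;
    assign .b0 (-Var.d0) ;; assign .b1 (-Var.d1) ;; assign .u0 Var.b0 ;; assign .u1 Var.b1 ;;
    assign .w0 Var.a0 ;; assign .w1 Var.a1 ;; assign .go 1).cost +
  ((2 * L + 5) * (searchBody.cost + 1) + 1 +
    (chord Var.v0 Var.v1 Var.u0 Var.u1 ;; assign .k (Ex.floor Var.hi)).cost)

theorem wp_next {C : Set Plane} {O : Oracle} {L : ℕ} {v d e : ℤ × ℤ} (hB : IsBody C O L)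
    (hv : toR v ∈ coords C) {ρ : Env} (hvr : At ρ .v0 .v1 v) (hdr : At ρ .d0 .d1 d)
    (her : At ρ .e0 .e1 e) (hz : ρ.val .zero = 0) (hde : cr d e = 1)
    (hd : |(d.1 : ℝ)| ≤ 2 ^ L ∧ |(d.2 : ℝ)| ≤ 2 ^ L) :
    Wp O next ρ (nextTime L) (fun ρ' => Frame searchVars ρ ρ' ∧
      ∃ u w k, At ρ' .u0 .u1 u ∧ At ρ' .w0 .w1 w ∧ ρ'.val .k = (k : ℤ) ∧ IsNext C v d u w k) := by
  have hD := convex_shift hB v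
  have h0 := zero_mem_shift hv
  refine Ev.wp_seq rfl (Ev.seq (Ev.chord hB.oracle
    (by simpa [hdr.1, hdr.2] using (ne_zero_of_cr hde).1) ?_))
  intro l h hc hlh
  replace hc : ∀ t : ℝ, toR e + t • toR d ∈ shift C v ↔ l ≤ t ∧ t ≤ h := fun t => by
    rw [mem_shift, ← hc]; simp [hvr.1, hvr.2, hdr.1, hdr.2, her.1, her.2]
  iterate 9 refine Ev.seq (Ev.assign ?_)
  refine Ev.assign ?_
  have hinit := coneInv_init hD h0 hde hc
  -- The exponent `2 L + 5` is chosen so that `2 ^ (2 L + 5) / 4 = 8 (2 ^ L) ^ 2`.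
  have hsum : SumBound (shift C v) (e + (⌊h⌋ + 1) • d) (-d) (2 ^ (2 * L + 5) / 4) := by
    have := sumBound_init (M := 2 ^ L) hD h0 hde hc (fun z hz => by
      have := abs_le_of_mem_shift hB hv hz
      constructor <;> linarith [this.1, this.2]) hd
    convert this using 1
    rw [pow_add, two_mul, pow_add]; ring
  refine Wp.seq ((Wp.loop (SearchInv C v d ρ) (T := searchBody.cost) ?_ (2 * L + 5) _ ?_).mono
    le_rfl ?_)
  · intro n ρ₁ h1 h2
    exact (ev_searchBody hB hv hvr hz h1 h2).wp rfl
  · refine ⟨?_, e + (⌊h⌋ + 1) • d, -d, -d, e + (⌊h⌋ + 1) • d, ?_⟩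
    · repeat' first | exact Frame.refl _ _ | refine Frame.upd ?_ (by decide)
    · simp only [At] at hdr her ⊢
      simp [-zsmul_eq_mul, hdr, her, hinit, hsum]
  · rintro ρ₁ ⟨⟨n, hF, a, b, u, w, ha, hb, hu, hw, hI, hg⟩, hgo⟩
    have hz₁ : ρ₁.val .zero = 0 := (hF.2 _ (by decide)).trans hz
    have hvr₁ := hF.at hvr (by decide) (by decide)
    have hg' : IsFirst (shift C v) d u := by
      rcases hg with ⟨hg, -⟩ | hg
      · rw [hz₁, hg] at hgo; norm_num at hgo
      · exact hg.2
    refine Ev.wp (Ev.seq (Ev.chord hB.oracle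
      (by simpa [hu.1, hu.2] using (ne_zero_of_cr hI.wu).2) ?_)) rfl
    intro l' h' hc' hlh'
    replace hc' : ∀ t : ℝ, t • toR u ∈ shift C v ↔ l' ≤ t ∧ t ≤ h' := fun t => by
      rw [mem_shift', ← hc']; simp [hvr₁.1, hvr₁.2, hu.1, hu.2]
    refine Ev.assign ⟨?_, u, w, ⌊h'⌋, ?_, ?_, ?_, hI.wu, hI.hu, hg', ?_⟩
    · repeat' first | exact hF | refine Frame.upd ?_ (by decide)
    · simpa [At] using hu
    · simpa [At] using hw
    · simp
    · intro j hj
      have hl := ((hc' 0).1 (by simpa using h0)).1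
      have hj' : (0 : ℝ) ≤ j := by exact_mod_cast hj
      rw [toR_smul, hc', Int.le_floor]
      exact ⟨fun h => h.2, fun h => ⟨hl.trans hj', h⟩⟩

/-! ### Edges of the discrete hull -/

/-- The lattice points of `C`, as pairs of integers. -/
def latticePts (C : Set Plane) : Set (ℤ × ℤ) := {z | toR z ∈ coords C}

theorem smul_mem_one {D : Set (ℝ × ℝ)} (hD : Convex ℝ D) (h0 : (0 : ℝ × ℝ) ∈ D) {j : ℤ} (hj : 1 ≤ j)
    {x : ℤ × ℤ} (hx : toR (j • x) ∈ D) : toR x ∈ D := by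
  have hj' : (1 : ℝ) ≤ j := by exact_mod_cast hj
  have hpos : (0 : ℝ) < j := by linarith
  have := hD.smul_mem_of_zero_mem h0 hx (t := 1 / (j : ℝ))
    ⟨by positivity, (div_le_one hpos).2 hj'⟩
  rwa [toR_smul, smul_smul, one_div_mul_cancel hpos.ne', one_smul] at this

theorem cr_eq_zero_imp {d e z : ℤ × ℤ} (hde : cr d e = 1) (h : cr d z = 0) :
    z = cr z e • d := by
  conv_lhs => rw [cr_decomp z hde]
  rw [h, zero_smul, add_zero]

/-- All lattice points of `A` lie weakly to the left of the directed edge from `v` to `v + k u`, and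
those on its line lie on the edge. -/
structure IsEdge (A : Set (ℤ × ℤ)) (v u : ℤ × ℤ) (k : ℤ) : Prop where
  mem : v ∈ A
  left : ∀ z ∈ A, 0 ≤ cr u (z - v)
  on : ∀ z ∈ A, cr u (z - v) = 0 → ∃ j, 0 ≤ j ∧ j ≤ k ∧ z = v + j • u

section Next
variable {C : Set Plane} {O : Oracle} {L : ℕ} {v d e u w : ℤ × ℤ} {k : ℤ}

theorem toR_sub_mem_shift {z : ℤ × ℤ} (hz : z ∈ latticePts C) :
    toR (z - v) ∈ shift C v := by
  rw [toR_mem_shift, add_sub_cancel]; exact hz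

/-- Extends `first` to points on the line of `d`: since `d` leaves the body, such points lie in the
direction `-d`, which is weakly left of `u`. -/
theorem IsNext.left (hN : IsNext C v d u w k) (hB : IsBody C O L) (hv : v ∈ latticePts C)
    (hde : cr d e = 1) (hd : toR d ∉ shift C v) {z : ℤ × ℤ} (hz : z ∈ latticePts C)
    (h : 0 ≤ cr d (z - v)) : 0 ≤ cr u (z - v) := by
  have hzD := toR_sub_mem_shift (v := v) hz
  rcases h.eq_or_lt with h | h
  · have hj := cr_eq_zero_imp hde h.symm
    set j := cr (z - v) e
    rw [hj] at hzD ⊢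
    have hj0 : j ≤ 0 := by
      by_contra hcon
      exact hd (smul_mem_one (convex_shift hB v) (zero_mem_shift hv) (by omega) hzD)
    have hdu : 0 ≤ cr d u := by
      rcases hN.hu with ⟨-, h⟩ | rfl
      · omega
      · rw [cr_neg_right, cr_self, neg_zero]
    rw [cr_smul_right, cr_swap u d]
    nlinarith
  · exact hN.first _ hzD h

theorem IsNext.neg_notMem (hN : IsNext C v d u w k) (hd : toR d ∉ shift C v)
    (h : 0 ≤ cr d (-u)) : toR (-u) ∉ shift C v := by
  intro hmem
  rcases hN.hu with ⟨-, h1⟩ | rfl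
  · rw [cr_neg_right] at h; omega
  · rw [neg_neg] at hmem; exact hd hmem

theorem IsNext.nonneg (hN : IsNext C v d u w k) (hv : v ∈ latticePts C) : 0 ≤ k := by
  rw [← hN.mult 0 le_rfl, zero_smul, toR_zero]; exact zero_mem_shift hv

theorem IsNext.one_le_iff (hN : IsNext C v d u w k) : 1 ≤ k ↔ toR u ∈ shift C v := by
  rw [← hN.mult 1 (by norm_num), one_smul]

theorem IsNext.mem (hN : IsNext C v d u w k) (hv : v ∈ latticePts C) :
    v + k • u ∈ latticePts C :=
  toR_mem_shift.1 ((hN.mult k (hN.nonneg hv)).2 le_rfl)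

theorem IsNext.notMem (hN : IsNext C v d u w k) (hv : v ∈ latticePts C) :
    toR u ∉ shift C (v + k • u) := by
  rw [toR_mem_shift, show v + k • u + u = v + (k + 1) • u by module, ← toR_mem_shift,
    hN.mult _ (by have := hN.nonneg hv; omega)]
  omega

theorem IsNext.det (hN : IsNext C v d u w k) : cr u (-w) = 1 := by
  rw [cr_neg_right, cr_swap, neg_neg, hN.wu]

theorem IsNext.abs_le (hN : IsNext C v d u w k) (hB : IsBody C O L) (hv : v ∈ latticePts C)
    (hd : |(d.1 : ℝ)| ≤ 2 ^ L ∧ |(d.2 : ℝ)| ≤ 2 ^ L) :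
    |(u.1 : ℝ)| ≤ 2 ^ L ∧ |(u.2 : ℝ)| ≤ 2 ^ L := by
  rcases hN.hu with ⟨h, -⟩ | rfl
  · have := abs_le_of_mem_shift hB hv h
    simp only [toR] at this
    constructor <;> linarith [this.1, this.2]
  · simpa using hd

theorem IsNext.ne_zero (hN : IsNext C v d u w k) : u ≠ 0 := by
  rintro rfl
  have := hN.wu
  simp [cr] at this

/-- If `d` supports the lattice points at `v`, so does `u`. A lattice point behind `v` on the line
of `u` would put `v - u` in the body: then `u` is not strictly left of `d`, so `u = -d` and `v + d`
would be in the body. -/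
theorem IsNext.isEdge (hN : IsNext C v d u w k) (hB : IsBody C O L) (hv : v ∈ latticePts C)
    (hde : cr d e = 1) (hd : toR d ∉ shift C v) (hs : ∀ z ∈ latticePts C, 0 ≤ cr d (z - v)) :
    IsEdge (latticePts C) v u k := by
  refine ⟨hv, fun z hz => hN.left hB hv hde hd hz (hs z hz), fun z hz h => ?_⟩
  have hzD := toR_sub_mem_shift (v := v) hz
  have hj := cr_eq_zero_imp hN.det h
  set j := cr (z - v) (-w)
  have hz' : z = v + j • u := by rw [← hj]; abel
  have hj0 : 0 ≤ j := by
    by_contra hcon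
    have hmem : toR (-u) ∈ shift C v := by
      apply smul_mem_one (convex_shift hB v) (zero_mem_shift hv) (j := -j) (by omega)
      rw [neg_smul_neg, ← hj]; exact hzD
    refine hN.neg_notMem hd ?_ hmem
    have := hs (v - u) (by
      rw [toR_mem_shift] at hmem; rw [sub_eq_add_neg]; exact hmem)
    rwa [show v - u - v = -u by abel] at this
  refine ⟨j, hj0, ?_, hz'⟩
  rw [← hN.mult j hj0, ← hj]; exact hzD

/-- With no multiple of `u` available, `u = -d`. The half-planes of `d` and `-d` leave only the
line, and the edge on it has length zero. -/
theorem IsNext.subsingleton (hN : IsNext C v d u w k) (hB : IsBody C O L) (hv : v ∈ latticePts C)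
    (hde : cr d e = 1) (hd : toR d ∉ shift C v) (hs : ∀ z ∈ latticePts C, 0 ≤ cr d (z - v))
    (hk : k < 1) : ∀ z ∈ latticePts C, z = v := by
  intro z hz
  have hE := hN.isEdge hB hv hde hd hs
  rcases hN.hu with ⟨h, -⟩ | rfl
  · rw [← hN.one_le_iff] at h; omega
  · have h1 := hE.left z hz
    have h2 := hs z hz
    rw [cr_neg_left] at h1
    obtain ⟨j, hj0, hjk, rfl⟩ := hE.on z hz (by rw [cr_neg_left]; omega)
    rw [show j = 0 by omega, zero_smul, add_zero]

end Next

/-! ### Walks around the discrete hull -/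

/-- The points `v 0, …, v n` are joined by edges of the hull of `A`. -/
def IsWalk (A : Set (ℤ × ℤ)) (v u : ℕ → ℤ × ℤ) (k : ℕ → ℤ) (n : ℕ) : Prop :=
  ∀ i < n, IsEdge A (v i) (u i) (k i) ∧ v (i + 1) = v i + k i • u i ∧ 1 ≤ k i ∧ u i ≠ 0 ∧
    v (i + 1) ∈ A

section Walk
variable {A : Set (ℤ × ℤ)} {v u : ℕ → ℤ × ℤ} {k : ℕ → ℤ} {n : ℕ}

theorem IsWalk.shift (h : IsWalk A v u k n) (i : ℕ) :
    IsWalk A (fun m => v (i + m)) (fun m => u (i + m)) (fun m => k (i + m)) (n - i) :=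
  fun m hm => h (i + m) (by omega)

theorem IsWalk.mem (h : IsWalk A v u k n) (hn : 0 < n) {i : ℕ} (hi : i ≤ n) : v i ∈ A := by
  rcases i with _ | i
  · exact (h 0 hn).1.mem
  · exact (h i hi).2.2.2.2

/-- The start `v 0` is weakly left of the edge from `v m` to `v (m + 1)`. If it were on its line it
would lie strictly between the end points, whereas the first edge allows points of its own line on
one side of `v 0` only. -/
theorem IsWalk.cr_consecutive (h : IsWalk A v u k n) (hne : ∀ m, 0 < m → m ≤ n → v m ≠ v 0)
    {m : ℕ} (hm : 1 ≤ m) (hmn : m + 1 ≤ n) : 0 < cr (v m - v 0) (v (m + 1) - v 0) := by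
  obtain ⟨hE, hv, hk, hu, -⟩ := h m (by omega)
  obtain ⟨hE0, hv0, hk0, hu0, -⟩ := h 0 (by omega)
  have h0A := hE0.mem
  have e1 : cr (v m - v 0) (v (m + 1) - v 0) = k m * cr (u m) (v 0 - v m) := by
    rw [hv, show v m + k m • u m - v 0 = (v m - v 0) + k m • u m by abel, cr_add_right, cr_self,
      cr_smul_right, cr_swap (u m), ← cr_neg_left, neg_sub]; ring
  rw [e1]
  rcases (hE.left _ h0A).eq_or_lt with hz | hz
  · exfalso
    obtain ⟨j, hj0, hjk, hj⟩ := hE.on _ h0A hz.symm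
    have hj1 : j ≠ 0 := by
      rintro rfl; apply hne m (by omega) (by omega); rw [hj]; simp
    have hj2 : j ≠ k m := by
      rintro rfl; exact hne (m + 1) (by omega) hmn (hv.trans hj.symm)
    have w1 : v m - v 0 = (-j) • u m := by rw [hj]; module
    have w2 : v (m + 1) - v 0 = (k m - j) • u m := by rw [hj, hv]; module
    have g1 := hE0.left _ hE.mem
    have g2 := hE0.left _ (h.mem (by omega) hmn)
    rw [w1, cr_smul_right] at g1
    rw [w2, cr_smul_right] at g2
    have hc : cr (u 0) (u m) = 0 := by
      have : 0 < j := by omega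
      have : 0 < k m - j := by omega
      apply le_antisymm <;> nlinarith
    obtain ⟨a, ha0, -, ha⟩ := hE0.on _ hE.mem (by rw [w1, cr_smul_right, hc, mul_zero])
    obtain ⟨b, hb0, -, hb⟩ := hE0.on _ (h.mem (by omega) hmn)
      (by rw [w2, cr_smul_right, hc, mul_zero])
    have wa : v m - v 0 = a • u 0 := by rw [ha]; abel
    have wb : v (m + 1) - v 0 = b • u 0 := by rw [hb]; abel
    have hsum : ((k m - j) * a + j * b) • u 0 = 0 := by
      rw [add_smul, mul_smul, mul_smul, ← wa, ← wb, w1, w2]; module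
    have hs : (k m - j) * a + j * b = 0 := (smul_eq_zero.1 hsum).resolve_right hu0
    have : a = 0 := by
      have h1 : 0 < k m - j := by omega
      have h2 : 0 ≤ j * b := mul_nonneg hj0 hb0
      nlinarith
    apply hne m (by omega) (by omega)
    rw [ha, this, zero_smul, add_zero]
  · positivity

/-- Induction on `m`: consecutive positivity is chained by the Plücker relation with the first edge
direction, against which all points are weakly left. -/
theorem IsWalk.cr_fan (h : IsWalk A v u k n) (hne : ∀ m, 0 < m → m ≤ n → v m ≠ v 0) :
    ∀ m, m ≤ n → ∀ j, 1 ≤ j → j < m → 0 < cr (v j - v 0) (v m - v 0) := by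
  intro m
  induction m with
  | zero => intro _ j _ hj; omega
  | succ m ih =>
    intro hm j hj1 hjm
    have hcons := h.cr_consecutive hne (m := m) (by omega) hm
    rcases Nat.lt_succ_iff_lt_or_eq.1 hjm with hjm | rfl
    swap
    · exact hcons
    obtain ⟨hE0, hv0, hk0, hu0, -⟩ := h 0 (by omega)
    have w1 : v 1 - v 0 = k 0 • u 0 := by rw [hv0]; abel
    have hP := cr_plucker (u 0) (v j - v 0) (v m - v 0) (v (m + 1) - v 0)
    have hm0 : 0 < cr (u 0) (v m - v 0) := by
      have := ih (by omega) 1 le_rfl (by omega)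
      rw [w1, cr_smul_left] at this
      exact pos_of_mul_pos_right this (by omega)
    have hIH := ih (by omega) j hj1 hjm
    have hlast : 0 < cr (u 0) (v (m + 1) - v 0) := by
      refine lt_of_le_of_ne (hE0.left _ (h.mem (by omega) hm)) fun hz => ?_
      obtain ⟨a, ha0, -, ha⟩ := hE0.on _ (h.mem (by omega) hm) hz.symm
      rw [show v (m + 1) - v 0 = a • u 0 by rw [ha]; abel, cr_smul_right, cr_swap] at hcons
      nlinarith
    have hj0 := hE0.left _ (h.mem (by omega) (show j ≤ n by omega))
    have : 0 < cr (u 0) (v m - v 0) * cr (v j - v 0) (v (m + 1) - v 0) := by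
      rw [hP]; positivity
    exact pos_of_mul_pos_right this hm0.le

theorem IsWalk.ne (h : IsWalk A v u k n) (hne : ∀ m, 0 < m → m ≤ n → v m ≠ v 0) {i j : ℕ}
    (hij : i < j) (hj : j ≤ n) : v j ≠ v i := by
  rcases Nat.eq_zero_or_pos i with rfl | hi
  · exact hne j hij hj
  · intro heq
    have := h.cr_fan hne j hj i hi hij
    rw [heq, cr_self] at this
    exact lt_irrefl _ this

/-- The walk restarted at `i` is again a walk that does not return to its start, so its own fan
gives the orientation. -/
theorem IsWalk.ccw (h : IsWalk A v u k n) (hne : ∀ m, 0 < m → m ≤ n → v m ≠ v 0) {i j l : ℕ}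
    (hij : i < j) (hjl : j < l) (hl : l ≤ n) : 0 < cr (v j - v i) (v l - v i) := by
  have := (h.shift i).cr_fan (fun m hm hmn => h.ne hne (j := i + m) (by omega) (by omega))
    (l - i) (by omega) (j - i) (by omega) (by omega)
  simpa [show i + (j - i) = j by omega, show i + (l - i) = l by omega] using this

end Walk

/-- A lattice vector as a point of the plane. -/
def pt (z : ℤ × ℤ) : Plane := !₂[(z.1 : ℝ), (z.2 : ℝ)]

theorem pt_injective : Function.Injective pt := by
  intro a b h
  have h0 := congrArg (fun z : Plane => z 0) h
  have h1 := congrArg (fun z : Plane => z 1) h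
  simp [pt] at h0 h1
  exact Prod.ext h0 h1

theorem orientation_pt (a b c : ℤ × ℤ) :
    orientation (pt a) (pt b) (pt c) = ((cr (b - a) (c - a) : ℤ) : ℝ) := by
  simp [orientation, pt, cr]

theorem inter_lattice (C : Set Plane) : C ∩ lattice = pt '' latticePts C := by
  ext z
  constructor
  · rintro ⟨hz, m, n, rfl⟩
    exact ⟨(m, n), hz, rfl⟩
  · rintro ⟨z, hz, rfl⟩
    exact ⟨hz, z.1, z.2, rfl⟩

theorem discreteHull_eq (C : Set Plane) : discreteHull C = convexHull ℝ (pt '' latticePts C) := by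
  rw [discreteHull, inter_lattice]

theorem combo_mem {S : Set Plane} (hS : Convex ℝ S) {a b c z : ℤ × ℤ} {α β : ℤ} {Δ : ℤ}
    (hΔ : 0 < Δ) (hα : 0 ≤ α) (hβ : 0 ≤ β) (hs : α + β ≤ Δ)
    (ha : pt a ∈ S) (hb : pt b ∈ S) (hc : pt c ∈ S)
    (h : Δ • (z - c) = α • (a - c) + β • (b - c)) : pt z ∈ S := by
  have hΔ' : (0 : ℝ) < Δ := by exact_mod_cast hΔ
  have hα' : (0 : ℝ) ≤ α := by exact_mod_cast hα
  have hβ' : (0 : ℝ) ≤ β := by exact_mod_cast hβ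
  have hs' : (α : ℝ) + β ≤ Δ := by exact_mod_cast hs
  have key := hS.sum_mem (t := Finset.univ) (w := ![(α : ℝ) / Δ, β / Δ, 1 - (α + β) / Δ])
    (z := ![pt a, pt b, pt c]) ?_ ?_ ?_
  · convert key using 1
    have h1 := congrArg (fun x : ℤ × ℤ => (x.1 : ℝ)) h
    have h2 := congrArg (fun x : ℤ × ℤ => (x.2 : ℝ)) h
    simp at h1 h2
    ext i
    fin_cases i
    · simp [Fin.sum_univ_three, pt]; field_simp; linear_combination h1
    · simp [Fin.sum_univ_three, pt]; field_simp; linear_combination h2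
  · intro i _
    fin_cases i
    · simp; positivity
    · simp; positivity
    · simp; rw [div_le_one hΔ']; exact hs'
  · simp [Fin.sum_univ_three]; ring
  · intro i _
    fin_cases i <;> assumption

/-- Triangulation by a fan from `v 0`. The first edge has `z` on its left, and the closing edge has
`z` weakly right of the ray to `v n`, so some consecutive pair of rays encloses `z`. -/
theorem IsWalk.cover {A : Set (ℤ × ℤ)} {v u : ℕ → ℤ × ℤ} {k : ℕ → ℤ} {n : ℕ}
    (h : IsWalk A v u k (n + 1)) (hne : ∀ m, 0 < m → m ≤ n → v m ≠ v 0) (hclosed : v (n + 1) = v 0)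
    {z : ℤ × ℤ} (hz : z ∈ A) : pt z ∈ convexHull ℝ (pt '' (v '' Set.Iic n)) := by
  have hW : IsWalk A v u k n := fun i hi => h i (by omega)
  have hmem : ∀ i ≤ n, pt (v i) ∈ convexHull ℝ (pt '' (v '' Set.Iic n)) := fun i hi =>
    subset_convexHull ℝ _ ⟨v i, ⟨i, hi, rfl⟩, rfl⟩
  have hconv := convex_convexHull ℝ (pt '' (v '' Set.Iic n))
  obtain ⟨hE0, hv0, hk0, hu0, -⟩ := h 0 (by omega)
  have w1 : v 1 - v 0 = k 0 • u 0 := by rw [hv0]; abel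
  have hn : 1 ≤ n := by
    by_contra hcon
    obtain rfl : n = 0 := by omega
    rw [zero_add] at hclosed
    rw [hclosed, sub_self] at w1
    rcases smul_eq_zero.1 w1.symm with h | h
    · omega
    · exact hu0 h
  have hfirst := hE0.left z hz
  have hlast : cr (v n - v 0) (z - v 0) ≤ 0 := by
    obtain ⟨hE, hv, hk, hu, -⟩ := h n (by omega)
    have h1 := hE.left z hz
    have h2 : v n - v 0 = -(k n • u n) := by rw [← hclosed, hv]; abel
    have h3 : z - v 0 = (z - v n) + (v n - v 0) := by abel
    rw [h3, cr_add_right, cr_self, add_zero, h2, cr_neg_left, cr_smul_left]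
    have : 0 ≤ k n * cr (u n) (z - v n) := by positivity
    omega
  have hex : ∃ j, 1 ≤ j ∧ cr (v j - v 0) (z - v 0) ≤ 0 := ⟨n, hn, hlast⟩
  classical
  -- The first ray from `v 0` that has `z` weakly on its right; `z` then lies in the triangle of `v
  -- 0`, `v (j - 1)`, `v j`, or on the first edge if `j = 1`.
  let j := Nat.find hex
  have hj : 1 ≤ j ∧ cr (v j - v 0) (z - v 0) ≤ 0 := Nat.find_spec hex
  have hjn : j ≤ n := Nat.find_min' hex ⟨hn, hlast⟩
  have hmin : ∀ i < j, 1 ≤ i → 0 < cr (v i - v 0) (z - v 0) := fun i hi hi1 => by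
    have := Nat.find_min hex hi
    by_contra hcon
    exact this ⟨hi1, not_lt.1 hcon⟩
  clear_value j
  rcases hj.1.eq_or_lt with rfl | hj1
  · have h0 : cr (u 0) (z - v 0) = 0 := by
      have := hj.2
      rw [w1, cr_smul_left] at this
      nlinarith
    obtain ⟨a, ha0, hak, ha⟩ := hE0.on z hz h0
    refine combo_mem hconv (Δ := k 0) (α := a) (β := 0) (by omega) ha0 le_rfl (by omega)
      (hmem 1 hjn) (hmem 1 hjn) (hmem 0 (by omega)) ?_
    rw [w1, ha]; module
  · obtain ⟨i, rfl⟩ : ∃ i, j = i + 1 := ⟨j - 1, by omega⟩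
    have hi := hmin i (by omega) (by omega)
    have hΔ := hW.cr_consecutive hne (m := i) (by omega) hjn
    obtain ⟨hE, hv, hk, hu, -⟩ := h i (by omega)
    -- Cramer's rule with common denominator `Δ`; that the weights add up to at most `Δ` says that
    -- `z` is left of the edge from `v i` to `v (i + 1)`.
    refine combo_mem hconv (Δ := cr (v i - v 0) (v (i + 1) - v 0))
      (α := - cr (v (i + 1) - v 0) (z - v 0)) (β := cr (v i - v 0) (z - v 0)) hΔ
      (by linarith [hj.2]) hi.le ?_ (hmem i (by omega)) (hmem (i + 1) hjn) (hmem 0 (by omega)) ?_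
    · have h1 : 0 ≤ k i * cr (u i) (z - v i) := mul_nonneg (by omega) (hE.left z hz)
      have h2 : k i * cr (u i) (z - v i) = cr (v (i + 1) - v i) (z - v i) := by
        rw [hv, ← cr_smul_left]; congr 1; abel
      have h3 : cr (v (i + 1) - v i) (z - v i) = cr (v (i + 1) - v 0) (z - v 0) -
          cr (v i - v 0) (z - v 0) + cr (v i - v 0) (v (i + 1) - v 0) := by
        simp [cr]; ring
      linarith
    · ext
      · simp [cr]; ring
      · simp [cr]; ring

/-! ### Vertices -/

/-- The point `v` is the unique lexicographic minimum of `(f, g)`, where `f` measures the distance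
to the supporting line and `g` the position along it. The set of lexicographically nonnegative
points is convex, so it contains the hull. -/
theorem vertex_of_supp {A : Set (ℤ × ℤ)} {v u : ℤ × ℤ} (hv : v ∈ A) (hu : u ≠ 0)
    (hs : ∀ z ∈ A, 0 ≤ cr u (z - v))
    (ho : ∀ z ∈ A, cr u (z - v) = 0 → ∃ j : ℤ, 0 ≤ j ∧ z = v + j • u) :
    pt v ∈ vertices (convexHull ℝ (pt '' A)) := by
  let f : Plane → ℝ := fun z => u.1 * (z 1 - v.2) - u.2 * (z 0 - v.1)
  let g : Plane → ℝ := fun z => u.1 * (z 0 - v.1) + u.2 * (z 1 - v.2)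
  have hcombo : ∀ (x y : Plane) (a b : ℝ), a + b = 1 →
      f (a • x + b • y) = a * f x + b * f y ∧ g (a • x + b • y) = a * g x + b * g y := by
    intro x y a b hab
    obtain rfl : b = 1 - a := by linarith
    constructor <;> simp [f, g] <;> ring
  have hT : Convex ℝ {z | 0 ≤ f z ∧ (f z = 0 → 0 ≤ g z)} := by
    rintro x ⟨hx1, hx2⟩ y ⟨hy1, hy2⟩ a b ha hb hab
    obtain ⟨e1, e2⟩ := hcombo x y a b hab
    simp only [Set.mem_ofPred_eq, e1, e2]
    refine ⟨by positivity, fun h0 => ?_⟩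
    have h1 : a * f x = 0 := by have := mul_nonneg ha hx1; have := mul_nonneg hb hy1; linarith
    have h2 : b * f y = 0 := by linarith
    have h3 : 0 ≤ a * g x := by
      rcases mul_eq_zero.1 h1 with h | h
      · simp [h]
      · exact mul_nonneg ha (hx2 h)
    have h4 : 0 ≤ b * g y := by
      rcases mul_eq_zero.1 h2 with h | h
      · simp [h]
      · exact mul_nonneg hb (hy2 h)
    linarith
  have hupos : (0 : ℝ) < u.1 * u.1 + u.2 * u.2 := by
    have : 0 < u.1 * u.1 + u.2 * u.2 := by
      by_contra hcon
      have h1 : u.1 = 0 := by nlinarith [mul_self_nonneg u.1, mul_self_nonneg u.2]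
      have h2 : u.2 = 0 := by nlinarith [mul_self_nonneg u.1, mul_self_nonneg u.2]
      exact hu (Prod.ext h1 h2)
    exact_mod_cast this
  have hH : convexHull ℝ (pt '' A) ⊆ {z | 0 ≤ f z ∧ (f z = 0 → 0 ≤ g z)} := by
    refine convexHull_min ?_ hT
    rintro _ ⟨z, hz, rfl⟩
    have hf : f (pt z) = ((cr u (z - v) : ℤ) : ℝ) := by simp [f, pt, cr]
    refine ⟨by rw [hf]; exact_mod_cast hs z hz, fun h0 => ?_⟩
    rw [hf] at h0
    obtain ⟨j, hj, rfl⟩ := ho z hz (by exact_mod_cast h0)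
    have hj' : (0 : ℝ) ≤ j := by exact_mod_cast hj
    have : g (pt (v + j • u)) = j * (u.1 * u.1 + u.2 * u.2) := by simp [g, pt]; ring
    rw [this]; positivity
  have hf0 : f (pt v) = 0 := by simp [f, pt]
  have hg0 : g (pt v) = 0 := by simp [g, pt]
  have huniq : ∀ z, f z = 0 → g z = 0 → z = pt v := by
    intro z h1 h2
    have e0 : (z 0 - v.1) * (u.1 * u.1 + u.2 * u.2) = 0 := by
      simp only [f, g] at h1 h2; linear_combination u.1 * h2 - u.2 * h1
    have e1 : (z 1 - v.2) * (u.1 * u.1 + u.2 * u.2) = 0 := by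
      simp only [f, g] at h1 h2; linear_combination u.2 * h2 + u.1 * h1
    have e0' := (mul_eq_zero.1 e0).resolve_right hupos.ne'
    have e1' := (mul_eq_zero.1 e1).resolve_right hupos.ne'
    ext i
    fin_cases i
    · simp [pt]; linarith
    · simp [pt]; linarith
  rw [vertices, mem_extremePoints]
  refine ⟨subset_convexHull ℝ _ ⟨v, hv, rfl⟩, ?_⟩
  rintro x hx y hy ⟨a, b, ha, hb, hab, he⟩
  obtain ⟨hx1, hx2⟩ := hH hx
  obtain ⟨hy1, hy2⟩ := hH hy
  obtain ⟨e1, e2⟩ := hcombo x y a b hab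
  rw [he, hf0] at e1
  rw [he, hg0] at e2
  have fx : f x = 0 := by
    have := mul_nonneg ha.le hx1; have := mul_nonneg hb.le hy1
    exact (mul_eq_zero.1 (by linarith : a * f x = 0)).resolve_left ha.ne'
  have fy : f y = 0 := by
    rw [fx, mul_zero, zero_add] at e1
    exact (mul_eq_zero.1 e1.symm).resolve_left hb.ne'
  have gx : g x = 0 := by
    have := mul_nonneg ha.le (hx2 fx); have := mul_nonneg hb.le (hy2 fy)
    exact (mul_eq_zero.1 (by linarith : a * g x = 0)).resolve_left ha.ne'
  have gy : g y = 0 := by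
    rw [gx, mul_zero, zero_add] at e2
    exact (mul_eq_zero.1 e2.symm).resolve_left hb.ne'
  exact ⟨huniq x fx gx, huniq y fy gy⟩

theorem IsEdge.vertex {C : Set Plane} {v u : ℤ × ℤ} {k : ℤ} (h : IsEdge (latticePts C) v u k)
    (hu : u ≠ 0) : pt v ∈ vertices (discreteHull C) := by
  rw [discreteHull_eq]
  exact vertex_of_supp h.mem hu h.left fun z hz hz0 => by
    obtain ⟨j, h1, -, h2⟩ := h.on z hz hz0
    exact ⟨j, h1, h2⟩

theorem vertices_subset (C : Set Plane) : vertices (discreteHull C) ⊆ pt '' latticePts C := by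
  rw [discreteHull_eq]; exact extremePoints_convexHull_subset

theorem finite_latticePts {C : Set Plane} {O : Oracle} {L : ℕ} (hB : IsBody C O L) :
    (latticePts C).Finite := by
  rcases (latticePts C).eq_empty_or_nonempty with h | ⟨v, hv⟩
  · rw [h]; exact Set.finite_empty
  · refine ((Set.finite_Icc (v.1 - 2 ^ L) (v.1 + 2 ^ L)).prod
      (Set.finite_Icc (v.2 - 2 ^ L) (v.2 + 2 ^ L))).subset fun z hz => ?_
    obtain ⟨h1, h2⟩ := hB.near _ hz _ hv
    simp only [toR] at h1 h2
    rw [abs_le] at h1 h2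
    refine ⟨⟨?_, ?_⟩, ⟨?_, ?_⟩⟩
    · have : (v.1 : ℝ) - 2 ^ L ≤ z.1 := by linarith [h1.1]
      exact_mod_cast this
    · have : (z.1 : ℝ) ≤ v.1 + 2 ^ L := by linarith [h1.2]
      exact_mod_cast this
    · have : (v.2 : ℝ) - 2 ^ L ≤ z.2 := by linarith [h2.1]
      exact_mod_cast this
    · have : (z.2 : ℝ) ≤ v.2 + 2 ^ L := by linarith [h2.2]
      exact_mod_cast this

theorem finite_vertices {C : Set Plane} {O : Oracle} {L : ℕ} (hB : IsBody C O L) :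
    (vertices (discreteHull C)).Finite :=
  ((finite_latticePts hB).image pt).subset (vertices_subset C)

/-- A closed walk lists the vertices of the hull. -/
theorem IsWalk.isVertexListCCW {C : Set Plane} {v u : ℕ → ℤ × ℤ} {k : ℕ → ℤ} {n : ℕ}
    (h : IsWalk (latticePts C) v u k (n + 1)) (hne : ∀ m, 0 < m → m ≤ n → v m ≠ v 0)
    (hclosed : v (n + 1) = v 0) :
    IsVertexListCCW ((List.range (n + 1)).map fun i => pt (v i)) (discreteHull C) := by
  have hW : IsWalk (latticePts C) v u k n := fun i hi => h i (by omega)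
  refine ⟨?_, ?_, ?_⟩
  · refine List.Nodup.map_on ?_ List.nodup_range
    intro i hi j hj hij
    rw [List.mem_range] at hi hj
    replace hij := pt_injective hij
    rcases lt_trichotomy i j with hlt | heq | hlt
    · exact absurd hij.symm (hW.ne hne hlt (by omega))
    · exact heq
    · exact absurd hij (hW.ne hne hlt (by omega))
  · intro z
    simp only [List.mem_map, List.mem_range]
    constructor
    · rintro ⟨i, hi, rfl⟩
      exact (h i hi).1.vertex (h i hi).2.2.2.1
    · intro hz
      have heq : discreteHull C = convexHull ℝ (pt '' (v '' Set.Iic n)) := by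
        rw [discreteHull_eq]
        apply Set.Subset.antisymm
        · refine convexHull_min ?_ (convex_convexHull ℝ _)
          rintro _ ⟨z, hz, rfl⟩
          exact h.cover hne hclosed hz
        · refine convexHull_mono (Set.image_mono ?_)
          rintro _ ⟨i, hi, rfl⟩
          exact h.mem (by omega) (Nat.le_succ_of_le hi)
      rw [heq] at hz
      obtain ⟨_, ⟨i, hi, rfl⟩, rfl⟩ := extremePoints_convexHull_subset hz
      exact ⟨i, Nat.lt_succ_of_le hi, rfl⟩
  · intro i j l hij hjl
    have hl : (l : ℕ) < n + 1 := by simpa using l.2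
    simp only [List.get_eq_getElem, List.getElem_map, List.getElem_range]
    rw [orientation_pt]
    exact_mod_cast hW.ccw hne hij hjl (by omega)

theorem isVertexListCCW_singleton {C : Set Plane} {v : ℤ × ℤ} (hv : v ∈ latticePts C)
    (h : ∀ z ∈ latticePts C, z = v) : IsVertexListCCW [pt v] (discreteHull C) := by
  have hA : latticePts C = {v} := Set.eq_singleton_iff_unique_mem.2 ⟨hv, h⟩
  have hH : vertices (discreteHull C) = {pt v} := by
    rw [discreteHull_eq, hA, Set.image_singleton, convexHull_singleton, vertices,
      extremePoints_singleton]
  refine ⟨List.nodup_singleton _, fun z => by rw [hH]; simp, ?_⟩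
  intro i j k hij hjk
  have := k.2
  simp only [List.length_singleton] at this
  have h1 : (i : ℕ) < j := hij
  have h2 : (j : ℕ) < k := hjk
  omega

theorem isVertexListCCW_nil {C : Set Plane} (h : latticePts C = ∅) :
    IsVertexListCCW [] (discreteHull C) := by
  have hH : vertices (discreteHull C) = ∅ := by
    rw [discreteHull_eq, h, Set.image_empty, convexHull_empty, vertices, extremePoints_empty]
  exact ⟨List.nodup_nil, fun z => by rw [hH]; simp, fun i => i.elim0⟩

/-! ### The walk around the hull -/

section Walk
variable {C : Set Plane} {O : Oracle} {L : ℕ} {v u : ℕ → ℤ × ℤ} {k : ℕ → ℤ} {n : ℕ}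

theorem IsWalk.snoc {A : Set (ℤ × ℤ)} (h : IsWalk A v u k n) {a : ℤ × ℤ} {K : ℤ}
    (hE : IsEdge A (v n) a K) (hK : 1 ≤ K) (ha : a ≠ 0) (hm : v n + K • a ∈ A) :
    ∃ v' u' k', IsWalk A v' u' k' (n + 1) ∧ (∀ i ≤ n, v' i = v i) ∧ v' (n + 1) = v n + K • a := by
  have e1 : ∀ i ≤ n, Function.update v (n + 1) (v n + K • a) i = v i := fun i hi =>
    Function.update_of_ne (by omega) _ _
  refine ⟨Function.update v (n + 1) (v n + K • a), Function.update u n a, Function.update k n K,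
    fun i hi => ?_, e1, Function.update_self _ _ _⟩
  rcases Nat.lt_succ_iff_lt_or_eq.1 hi with hi | rfl
  · rw [e1 i (by omega), e1 (i + 1) (by omega), Function.update_of_ne (by omega),
      Function.update_of_ne (by omega)]
    exact h i hi
  · rw [e1 i le_rfl, Function.update_self, Function.update_self, Function.update_self]
    exact ⟨hE, rfl, hK, ha, hm⟩

/-- Distinct points of the walk are distinct hull vertices, so the walk has to close after at most
as many edges as there are vertices. -/
theorem IsWalk.card_le (hB : IsBody C O L) (h : IsWalk (latticePts C) v u k (n + 1))
    (hne : ∀ m, 0 < m → m ≤ n → v m ≠ v 0) : n + 1 ≤ (vertices (discreteHull C)).ncard := by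
  have hW : IsWalk (latticePts C) v u k n := fun i hi => h i (by omega)
  have hinj : Set.InjOn (fun i => pt (v i)) (Finset.range (n + 1)) := by
    intro i hi j hj hij
    simp only [Finset.coe_range, Set.mem_Iio] at hi hj
    replace hij := pt_injective hij
    rcases lt_trichotomy i j with hlt | heq | hlt
    · exact absurd hij.symm (hW.ne hne hlt (by omega))
    · exact heq
    · exact absurd hij (hW.ne hne hlt (by omega))
  have h1 := hinj.ncard_image
  rw [Set.ncard_coe_finset, Finset.card_range] at h1
  rw [← h1]
  refine Set.ncard_le_ncard ?_ (finite_vertices hB)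
  rintro _ ⟨i, hi, rfl⟩
  simp only [Finset.coe_range, Set.mem_Iio] at hi
  exact (h i hi).1.vertex (h i hi).2.2.2.1

end Walk

/-- Move along the edge that `next` has found, and prepare the next search. -/
def advance : Program :=
  assign .v0 (Var.v0 + Var.k * Var.u0) ;; assign .v1 (Var.v1 + Var.k * Var.u1) ;;
  assign .d0 Var.u0 ;; assign .d1 Var.u1 ;; assign .e0 (-Var.w0) ;; assign .e1 (-Var.w1)

/-- One step of the walk around the hull. -/
def walkBody : Program :=
  .instr (.emit Var.v0.addr Var.v1.addr) ;; next ;; advance ;;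
  assign .run ((Var.v0 - Var.s0) * (Var.v0 - Var.s0) + (Var.v1 - Var.s1) * (Var.v1 - Var.s1))

/-- The variables hold a lattice point `v` of the body and a basis `d`, `e` of the lattice such that
`v + d` is outside of the body. -/
structure Ready (C : Set Plane) (L : ℕ) (ρ : Env) (v d e : ℤ × ℤ) : Prop where
  atv : At ρ .v0 .v1 v
  atd : At ρ .d0 .d1 d
  ate : At ρ .e0 .e1 e
  zero : ρ.val .zero = 0
  mem : v ∈ latticePts C
  det : cr d e = 1
  notMem : toR d ∉ shift C v
  bound : |(d.1 : ℝ)| ≤ 2 ^ L ∧ |(d.2 : ℝ)| ≤ 2 ^ L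

theorem Ready.wp_next {C : Set Plane} {O : Oracle} {L : ℕ} {v d e : ℤ × ℤ} {ρ : Env}
    (h : Ready C L ρ v d e) (hB : IsBody C O L) :
    Wp O next ρ (nextTime L) (fun ρ' => Frame searchVars ρ ρ' ∧
      ∃ u w k, At ρ' .u0 .u1 u ∧ At ρ' .w0 .w1 w ∧ ρ'.val .k = (k : ℤ) ∧ IsNext C v d u w k) :=
  DiscreteHull.wp_next hB h.mem h.atv h.atd h.ate h.zero h.det h.bound

/-- The variables changed by `advance`. -/
def stepVars : List Var := [.v0, .v1, .d0, .d1, .e0, .e1]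

theorem Ready.ev_advance {C : Set Plane} {O : Oracle} {L : ℕ} {v d e u w : ℤ × ℤ} {k : ℤ}
    {ρ₀ ρ : Env} (h : Ready C L ρ₀ v d e) (hB : IsBody C O L) (hF : Frame searchVars ρ₀ ρ)
    (hu : At ρ .u0 .u1 u) (hw : At ρ .w0 .w1 w) (hk : ρ.val .k = (k : ℤ))
    (hN : IsNext C v d u w k) :
    Ev O advance ρ (fun ρ' => Frame stepVars ρ ρ' ∧ Ready C L ρ' (v + k • u) u (-w)) := by
  have hv := hF.at h.atv (by decide) (by decide)
  have hz : ρ.val .zero = 0 := (hF.2 _ (by decide)).trans h.zero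
  iterate 5 refine Ev.seq (Ev.assign ?_)
  refine Ev.assign ⟨?_, ?_⟩
  · repeat' first | exact Frame.refl _ _ | refine Frame.upd ?_ (by decide)
  · simp only [At] at hv hu hw
    refine ⟨?_, ?_, ?_, ?_, hN.mem h.mem, hN.det, hN.notMem h.mem, hN.abs_le hB h.mem h.bound⟩ <;>
      simp [At, hv, hu, hw, hk, hz]

/-- The invariant of the walk: `m` is the number of the remaining vertices. -/
def WalkInv (C : Set Plane) (L : ℕ) (m : ℕ) (ρ : Env) : Prop :=
  (ρ.val .run = 0 ∧ ρ.val .zero = 0 ∧ IsVertexListCCW ρ.out (discreteHull C)) ∨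
  ∃ n v u k d e, n + m = (vertices (discreteHull C)).ncard ∧ IsWalk (latticePts C) v u k n ∧
    (∀ i, 0 < i → i ≤ n → v i ≠ v 0) ∧ At ρ .s0 .s1 (v 0) ∧ Ready C L ρ (v n) d e ∧
    (∀ z ∈ latticePts C, 0 ≤ cr d (z - v n)) ∧ (n = 0 ∨ toR (-d) ∈ shift C (v n)) ∧
    (ρ.out = (List.range n).map fun i => pt (v i)) ∧ 0 < ρ.val .run

def walkTime (L : ℕ) : ℕ :=
  (Program.instr (.emit Var.v0.addr Var.v1.addr)).cost + (nextTime L +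
    (advance ;; assign .run ((Var.v0 - Var.s0) * (Var.v0 - Var.s0) +
      (Var.v1 - Var.s1) * (Var.v1 - Var.s1))).cost)

theorem sq_dist_eq_zero {a b : ℤ × ℤ}
    (h : ((a.1 : ℝ) - b.1) * (a.1 - b.1) + (a.2 - b.2) * (a.2 - b.2) ≤ 0) : a = b := by
  have h' : (a.1 - b.1) * (a.1 - b.1) + (a.2 - b.2) * (a.2 - b.2) ≤ 0 := by exact_mod_cast h
  have h1 : a.1 - b.1 = 0 := by
    nlinarith [mul_self_nonneg (a.1 - b.1), mul_self_nonneg (a.2 - b.2)]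
  have h2 : a.2 - b.2 = 0 := by
    nlinarith [mul_self_nonneg (a.1 - b.1), mul_self_nonneg (a.2 - b.2)]
  exact Prod.ext (by linarith) (by linarith)

theorem wp_walkBody {C : Set Plane} {O : Oracle} {L : ℕ} (hB : IsBody C O L) {m : ℕ} {ρ : Env}
    (h : WalkInv C L m ρ) (hrun : ρ.val .zero < ρ.val .run) :
    Wp O walkBody ρ (walkTime L) (fun ρ' => ∃ m' < m, WalkInv C L m' ρ') := by
  rcases h with ⟨h1, h2, -⟩ | ⟨n, v, u, k, d, e, hcard, hW, hne, hs, hR, hsupp, hback, hout, -⟩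
  · rw [h1, h2] at hrun; exact absurd hrun (lt_irrefl _)
  refine Ev.wp_seq rfl (Ev.emit (Wp.seq ?_))
  generalize hρ₁ : ({ ρ with out := ρ.out ++ [!₂[ρ.val .v0, ρ.val .v1]] } : Env) = ρ₁
  have hval : ρ₁.val = ρ.val := by rw [← hρ₁]
  have hout₁ : ρ₁.out = (List.range (n + 1)).map fun i => pt (v i) := by
    rw [← hρ₁, List.range_succ, List.map_append, ← hout]; simp [pt, hR.atv.1, hR.atv.2]
  have hR₁ : Ready C L ρ₁ (v n) d e := by
    obtain ⟨r1, r2, r3, r4, r5, r6, r7, r8⟩ := hR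
    simp only [At] at r1 r2 r3
    exact ⟨by simpa [At, hval] using r1, by simpa [At, hval] using r2, by simpa [At, hval] using r3,
      by rw [hval, r4], r5, r6, r7, r8⟩
  have hs₁ : At ρ₁ .s0 .s1 (v 0) := by simp only [At] at hs; simpa [At, hval] using hs
  refine (hR₁.wp_next hB).mono le_rfl ?_
  rintro ρ₂ ⟨hF, a, w, K, ha, hw, hK, hN⟩
  refine Ev.wp (Ev.seq ((hR₁.ev_advance hB hF ha hw hK hN).mono ?_)) rfl
  rintro ρ₃ ⟨hF₃, hR₃⟩
  have hs₃ : At ρ₃ .s0 .s1 (v 0) :=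
    hF₃.at (hF.at hs₁ (by decide) (by decide)) (by decide) (by decide)
  have hout₃ : ρ₃.out = (List.range (n + 1)).map fun i => pt (v i) := by
    rw [hF₃.1, hF.1, hout₁]
  refine Ev.assign ?_
  have hE := hN.isEdge hB hR.mem hR.det hR.notMem hsupp
  have hrun' : (ρ₃.val .v0 - ρ₃.val .s0) * (ρ₃.val .v0 - ρ₃.val .s0) +
      (ρ₃.val .v1 - ρ₃.val .s1) * (ρ₃.val .v1 - ρ₃.val .s1) =
      (((v n + K • a).1 : ℝ) - (v 0).1) * ((v n + K • a).1 - (v 0).1) +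
      ((v n + K • a).2 - (v 0).2) * ((v n + K • a).2 - (v 0).2) := by
    rw [hR₃.atv.1, hR₃.atv.2, hs₃.1, hs₃.2]
  simp only [Ex.eval_add, Ex.eval_sub, Ex.eval_mul, Ex.eval_var]
  rw [hrun']
  by_cases hK1 : 1 ≤ K
  · have hmem' := hN.mem hR.mem
    obtain ⟨v', u', k', hW', hv', hv'n⟩ := hW.snoc hE hK1 hN.ne_zero hmem'
    have hne' : ∀ i, 0 < i → i ≤ n → v' i ≠ v' 0 := fun i hi hin => by
      rw [hv' i hin, hv' 0 (by omega)]; exact hne i hi hin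
    have hle := hW'.card_le hB hne'
    have hmap : ((List.range (n + 1)).map fun i => pt (v i)) =
        (List.range (n + 1)).map fun i => pt (v' i) := by
      apply List.map_congr_left
      intro i hi
      rw [hv' i (by rw [List.mem_range] at hi; omega)]
    refine ⟨m - 1, by omega, ?_⟩
    by_cases hcl : v n + K • a = v 0
    · left
      refine ⟨by rw [Env.upd_val, if_pos rfl, hcl]; ring, ?_, ?_⟩
      · rw [Env.upd_val, if_neg (by decide)]; exact hR₃.zero
      · rw [Env.upd_out, hout₃, hmap]
        exact hW'.isVertexListCCW hne' (by rw [hv'n, hcl, hv' 0 (by omega)])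
    · right
      refine ⟨n + 1, v', u', k', a, -w, by omega, hW', ?_, ?_, ?_, ?_, ?_, ?_, ?_⟩
      · intro i hi hin
        rcases hin.eq_or_lt with rfl | hin
        · rw [hv'n, hv' 0 (by omega)]; exact hcl
        · exact hne' i hi (by omega)
      · simp only [At] at hs₃
        simpa [At, hv' 0 (by omega)] using hs₃
      · rw [hv'n]
        obtain ⟨r1, r2, r3, r4, r5, r6, r7, r8⟩ := hR₃
        simp only [At] at r1 r2 r3
        refine ⟨?_, ?_, ?_, ?_, r5, r6, r7, r8⟩ <;> simp [At, r1, r2, r3, r4]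
      · intro z hz
        rw [hv'n, show z - (v n + K • a) = (z - v n) - K • a by abel, cr_sub_right, cr_smul_right,
          cr_self, mul_zero, sub_zero]
        exact hE.left z hz
      · right
        rw [hv'n, toR_mem_shift, show v n + K • a + -a = v n + (K - 1) • a by module,
          ← toR_mem_shift, hN.mult _ (by omega)]
        omega
      · rw [Env.upd_out, hout₃, hmap]
      · rw [Env.upd_val, if_pos rfl]
        exact not_le.1 fun hcon => hcl (sq_dist_eq_zero hcon)
  · have hK0 : K = 0 := by have := hN.nonneg hR.mem; omega
    -- After the first edge `v - d` is in the body, so a search can always return at least that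
    -- point; a zero-length edge occurs only at the start, when the hull is one point.
    have hn : n = 0 := by
      rcases hback with h | h
      · exact h
      · exfalso
        apply hK1
        rw [hN.one_le_iff]
        rcases hN.hu with h' | h'
        · exact h'.1
        · rw [h']; exact h
    subst hn
    have hsub := hN.subsingleton hB hR.mem hR.det hR.notMem hsupp (by omega)
    have hlist := isVertexListCCW_singleton hR.mem hsub
    have hc : 0 < (vertices (discreteHull C)).ncard := by
      rw [Set.ncard_pos (finite_vertices hB)]
      exact ⟨pt (v 0), (hlist.mem_iff _).1 (List.mem_singleton_self _)⟩
    refine ⟨0, by omega, .inl ⟨?_, ?_, ?_⟩⟩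
    · rw [Env.upd_val, if_pos rfl, hK0, zero_smul, add_zero]; ring
    · rw [Env.upd_val, if_neg (by decide)]; exact hR₃.zero
    · rw [Env.upd_out, hout₃]; simpa using hlist

/-- The walk around the hull, from a point in the lowest row. -/
def walk : Program :=
  (chord 0 Var.v1 1 0 ;; assign .v0 (Ex.floor Var.hi) ;; assign .s0 Var.v0 ;; assign .s1 Var.v1 ;;
    assign .d0 1 ;; assign .d1 0 ;; assign .e0 0 ;; assign .e1 1 ;; assign .run 1) ;;
  .loop Var.zero.addr Var.run.addr walkBody

def fullWalkTime (L N : ℕ) : ℕ :=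
  (chord 0 Var.v1 1 0 ;; assign .v0 (Ex.floor Var.hi) ;; assign .s0 Var.v0 ;; assign .s1 Var.v1 ;;
    assign .d0 1 ;; assign .d1 0 ;; assign .e0 0 ;; assign .e1 1 ;; assign .run 1).cost +
  (N * (walkTime L + 1) + 1)

theorem one_le_two_pow (L : ℕ) : (1 : ℝ) ≤ 2 ^ L := one_le_pow₀ (by norm_num)

theorem wp_walk {C : Set Plane} {O : Oracle} {L : ℕ} (hB : IsBody C O L) {ρ : Env} {v : ℤ × ℤ}
    (hv : v ∈ latticePts C) (hvr : At ρ .v0 .v1 v) (hz : ρ.val .zero = 0) (hout : ρ.out = [])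
    (hlow : ∀ z ∈ latticePts C, v.2 ≤ z.2) :
    Wp O walk ρ (fullWalkTime L (vertices (discreteHull C)).ncard)
      (fun ρ' => IsVertexListCCW ρ'.out (discreteHull C)) := by
  refine Ev.wp_seq rfl (Ev.seq (Ev.chord hB.oracle (by simp) ?_))
  intro l h hc hlh
  replace hc : ∀ t : ℝ, (t, (v.2 : ℝ)) ∈ coords C ↔ l ≤ t ∧ t ≤ h := fun t => by
    rw [← hc]; simp [hvr.2]
  have hv1 := (hc v.1).1 hv
  -- The rightmost lattice point of the lowest row: the direction `(1, 0)` leaves the lattice points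
  -- of the body and supports all of them.
  have hmem : (⌊h⌋, v.2) ∈ latticePts C := by
    refine (hc _).2 ⟨hv1.1.trans ?_, Int.floor_le h⟩
    exact_mod_cast Int.le_floor.2 hv1.2
  iterate 7 refine Ev.seq (Ev.assign ?_)
  refine Ev.assign ?_
  refine (Wp.loop (WalkInv C L) (fun n ρ h1 h2 => wp_walkBody hB h1 h2) _ _ (.inr ?_)).mono
    le_rfl ?_
  · refine ⟨0, fun _ => (⌊h⌋, v.2), fun _ => 0, fun _ => 0, (1, 0), (0, 1), zero_add _,
      fun i hi => by omega, fun i hi hi' => by omega, ?_, ⟨?_, ?_, ?_, ?_, hmem, ?_, ?_, ?_⟩, ?_,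
      .inl rfl, by simp [hout], by simp⟩
    · simp [At, hvr.2]
    · simp [At, hvr.2]
    · simp [At]
    · simp [At]
    · simp [hz]
    · simp [cr]
    · rw [toR_mem_shift]
      intro hcon
      have := ((hc (⌊h⌋ + 1)).1 (by simpa [toR] using hcon)).2
      linarith [Int.lt_floor_add_one h]
    · have := one_le_two_pow L
      simp only [Int.cast_one, abs_one, Int.cast_zero, abs_zero]
      constructor <;> linarith
    · intro z hz
      simp [cr, hlow z hz]
  · rintro ρ' ⟨⟨m, ⟨-, -, h⟩ | h⟩, hnot⟩
    · exact h
    · obtain ⟨n, v, u, k, d, e, -, -, -, -, hR, -, -, -, hrun⟩ := h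
      rw [hR.zero] at hnot
      exact absurd hrun hnot

/-! ### Descent to the lowest row -/

theorem combo_mem_of_zero {D : Set (ℝ × ℝ)} (hD : Convex ℝ D) (h0 : (0 : ℝ × ℝ) ∈ D)
    {x y : ℝ × ℝ} (hx : x ∈ D) (hy : y ∈ D) {α β : ℝ} (hα : 0 ≤ α) (hβ : 0 ≤ β) (hs : α + β ≤ 1) :
    α • x + β • y ∈ D := by
  have key := hD.sum_mem (t := Finset.univ) (w := ![α, β, 1 - α - β]) (z := ![x, y, 0]) ?_ ?_ ?_
  · simpa [Fin.sum_univ_three] using key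
  · intro i _
    fin_cases i
    · exact hα
    · exact hβ
    · simp; linarith
  · simp [Fin.sum_univ_three]
  · intro i _
    fin_cases i <;> assumption

/-- If some lattice point lies to the right of the line through the origin in the downward
direction `u`, and another one to its left, both at height at least `G`, then also the
lattice point `-u` belongs to `D`, unless it is higher than `G`. -/
theorem neg_mem_of_above {D : Set (ℝ × ℝ)} (hD : Convex ℝ D) (h0 : (0 : ℝ × ℝ) ∈ D)
    {u w x y : ℤ × ℤ} {G : ℤ} (huw : cr u w = 1) (hu : u.2 < 0) (hG : -u.2 ≤ G)
    (hx : toR x ∈ D) (hy : toR y ∈ D) (hxu : cr u x < 0) (hyu : 0 ≤ cr u y) (hxG : G ≤ x.2)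
    (hyG : G ≤ y.2) : toR (-u) ∈ D := by
  set μ := cr u y
  set ν := -cr u x with hν
  have hc : cr u (μ • x + ν • y) = 0 := by
    rw [cr_add_right, cr_smul_right, cr_smul_right]; simp only [ν, μ]; ring
  have hj := cr_eq_zero_imp huw hc
  set j := cr (μ • x + ν • y) w
  have h2 := congrArg Prod.snd hj
  simp only [Prod.snd_add, Prod.smul_snd, smul_eq_mul] at h2
  have hνpos : 0 < ν := by omega
  have hge : (μ + ν) * (-u.2) ≤ (-j) * (-u.2) := by
    have h3 : μ * (-u.2) ≤ μ * x.2 := mul_le_mul_of_nonneg_left (by omega) hyu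
    have h4 : ν * (-u.2) ≤ ν * y.2 := mul_le_mul_of_nonneg_left (by omega) hνpos.le
    linarith
  -- The combination `μ x + ν y` equals `j u` and has height at least `(μ + ν) G ≥ (μ + ν) (-u.2)`.
  -- Dividing it by `-j` therefore gives weights with sum at most one.
  have hjs : μ + ν ≤ -j := le_of_mul_le_mul_right hge (by omega)
  have hjpos : 0 < -j := by omega
  have hjR : (0 : ℝ) < ((-j : ℤ) : ℝ) := by exact_mod_cast hjpos
  have hμR : (0 : ℝ) ≤ μ := by exact_mod_cast hyu
  have hνR : (0 : ℝ) ≤ ν := by exact_mod_cast hνpos.le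
  have hsR : (μ : ℝ) + ν ≤ ((-j : ℤ) : ℝ) := by exact_mod_cast hjs
  have := combo_mem_of_zero hD h0 hx hy (α := μ / ((-j : ℤ) : ℝ)) (β := ν / ((-j : ℤ) : ℝ))
    (by positivity) (by positivity) (by rw [← add_div, div_le_one hjR]; exact hsR)
  convert this using 1
  have e : (μ / ((-j : ℤ) : ℝ)) • toR x + (ν / ((-j : ℤ) : ℝ)) • toR y =
      (1 / ((-j : ℤ) : ℝ)) • toR (μ • x + ν • y) := by
    rw [toR_add, toR_smul, toR_smul, smul_add, smul_smul, smul_smul, one_div_mul_eq_div,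
      one_div_mul_eq_div]
  rw [e, hj, toR_smul, smul_smul, toR_neg]
  push_cast at hjR ⊢
  rw [one_div_mul_eq_div, div_neg, div_self (by linarith), neg_one_smul]

/-- One step of the descent. -/
def descendBody : Program := next ;; ite Var.u1 0 advance (assign .run 0)

/-- The invariant of the descent that started in the row `c`; `m` bounds the number of the remaining
steps, and `T` consists of hull vertices that have been passed. -/
def DescentInv (C : Set Plane) (L : ℕ) (c : ℤ) (m : ℕ) (ρ : Env) : Prop :=
  ρ.out = [] ∧
  ((ρ.val .run = 0 ∧ ρ.val .zero = 0 ∧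
    ∃ v, At ρ .v0 .v1 v ∧ v ∈ latticePts C ∧ ∀ z ∈ latticePts C, v.2 ≤ z.2) ∨
  (ρ.val .run = 1 ∧ ∃ v d e, Ready C L ρ v d e ∧ v.2 ≤ c ∧ d.2 ≤ 0 ∧
    (∀ z ∈ latticePts C, z.2 ≤ c → 0 ≤ cr d (z - v)) ∧
    (((vertices (discreteHull C)).ncard + L + 2 ≤ m ∧ v.2 = c) ∨
      ∃ (T : Set Plane) (b : ℕ), T ⊆ vertices (discreteHull C) ∧ (∀ x ∈ T, (v.2 : ℝ) < x 1) ∧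
        (2 : ℤ) ^ b ≤ c - v.2 ∧ (vertices (discreteHull C)).ncard + L + 1 ≤ m + T.ncard + b)))

def descendTime (L : ℕ) : ℕ := nextTime L + (ite Var.u1 0 advance (assign .run 0)).cost

section
variable {C : Set Plane} {O : Oracle} {L : ℕ} {c : ℤ} {v d e u w : ℤ × ℤ} {k : ℤ}

/-- If the search finds no descending direction, the lowest row has been reached. -/
theorem lowest_of_next (hB : IsBody C O L) (hv : v ∈ latticePts C) (hde : cr d e = 1)
    (hdn : toR d ∉ shift C v) (hvc : v.2 ≤ c) (hd : d.2 ≤ 0)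
    (hs : ∀ z ∈ latticePts C, z.2 ≤ c → 0 ≤ cr d (z - v)) (hN : IsNext C v d u w k)
    (hu : 0 ≤ u.2) : ∀ z ∈ latticePts C, v.2 ≤ z.2 := by
  intro z hz
  by_contra hlt
  push Not at hlt
  have h1 := hs z hz (by omega)
  have hy : (z - v).2 < 0 := by simp only [Prod.snd_sub]; omega
  have hzD := toR_sub_mem_shift (v := v) hz
  rcases h1.eq_or_lt with h1 | h1
  · have hj := cr_eq_zero_imp hde h1.symm
    set j := cr (z - v) e
    rw [hj] at hzD hy
    simp only [Prod.smul_snd, smul_eq_mul] at hy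
    have hj0 : 0 < j := by by_contra hcon; nlinarith
    exact hdn (smul_mem_one (convex_shift hB v) (zero_mem_shift hv) hj0 hzD)
  · have h2 := hN.first _ hzD h1
    rcases hN.hu with ⟨-, h3⟩ | rfl
    · have hP : d.2 * cr u (z - v) + (z - v).2 * cr d u = u.2 * cr d (z - v) := by
        simp only [cr]; ring
      have := mul_nonneg hu h1.le
      nlinarith
    · rw [cr_neg_left] at h2; omega

/-- Every step of the descent passes a vertex of the hull or doubles the depth. -/
theorem vertex_or_double (hB : IsBody C O L) (hv : v ∈ latticePts C) (hde : cr d e = 1)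
    (hdn : toR d ∉ shift C v) (hs : ∀ z ∈ latticePts C, z.2 ≤ c → 0 ≤ cr d (z - v))
    (hN : IsNext C v d u w k) (hu : u.2 < 0)
    (hstart : ∃ z ∈ latticePts C, z.2 = c) :
    pt v ∈ vertices (discreteHull C) ∨ c < v.2 - u.2 := by
  by_cases hdeep : c < v.2 - u.2
  · exact .inr hdeep
  left
  -- In the shallow case `v - u` is no higher than row `c`, where the half-plane of `d` is known to
  -- contain all lattice points.
  have hneg : toR (-u) ∉ shift C v := by
    intro hmem
    refine hN.neg_notMem hdn ?_ hmem
    have := hs (v - u) (by rw [toR_mem_shift] at hmem; rw [sub_eq_add_neg]; exact hmem)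
      (by simp only [Prod.snd_sub]; omega)
    rwa [show v - u - v = -u by abel] at this
  have hD := convex_shift hB v
  have h0 : (0 : ℝ × ℝ) ∈ shift C v := zero_mem_shift hv
  rw [discreteHull_eq]
  refine vertex_of_supp hv hN.ne_zero ?_ ?_
  · intro z hz
    by_contra hcon
    have hzc : c < z.2 := by
      by_contra hzc
      exact hcon (hN.left hB hv hde hdn hz (hs z hz (by omega)))
    obtain ⟨y, hy, hyc⟩ := hstart
    -- A point on the wrong side must lie above row `c`. Together with a lattice point of row `c` it
    -- would put `v - u` in the body.
    refine hneg (neg_mem_of_above hD h0 (G := c - v.2) hN.det hu (by omega)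
      (toR_sub_mem_shift hz) (toR_sub_mem_shift hy) (by omega)
      (hN.left hB hv hde hdn hy (hs y hy hyc.le)) ?_ ?_)
    · simp only [Prod.snd_sub]; omega
    · simp only [Prod.snd_sub]; omega
  · intro z hz hz0
    have hzD := toR_sub_mem_shift (v := v) hz
    have hj := cr_eq_zero_imp hN.det hz0
    set j := cr (z - v) (-w)
    refine ⟨j, ?_, by rw [← hj]; abel⟩
    by_contra hcon
    apply hneg
    apply smul_mem_one hD h0 (j := -j) (by omega)
    rw [neg_smul_neg, ← hj]; exact hzD

/-- The number of vertices passed plus the exponent `b` of the depth grows with every step after the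
first. The former is at most the vertex count and the latter is less than `L`, so the remaining
budget `m` stays positive. -/
theorem wp_descendBody (hB : IsBody C O L) (hstart : ∃ z ∈ latticePts C, z.2 = c) {m : ℕ} {ρ : Env}
    (h : DescentInv C L c m ρ) (hrun : ρ.val .zero < ρ.val .run) :
    Wp O descendBody ρ (descendTime L) (fun ρ' => ∃ m' < m, DescentInv C L c m' ρ') := by
  obtain ⟨hout, ⟨h1, h2, -⟩ | ⟨hr, v, d, e, hR, hvc, hd, hs, hcount⟩⟩ := h
  · rw [h1, h2] at hrun; exact absurd hrun (lt_irrefl _)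
  have hG : (c : ℝ) - v.2 ≤ 2 ^ L - 2 := by
    obtain ⟨z, hz, hzc⟩ := hstart
    have := (hB.near _ hz _ hR.mem).2
    simp only [toR, hzc] at this
    exact (le_abs_self _).trans this
  have hmpos : 1 ≤ m := by
    rcases hcount with ⟨h, -⟩ | ⟨T, b, hT, -, hb, hcard⟩
    · omega
    · have h1 := Set.ncard_le_ncard hT (finite_vertices hB)
      have h2 : b < L := by
        have : (2 : ℝ) ^ b < 2 ^ L := by
          have : (2 : ℝ) ^ b ≤ c - v.2 := by exact_mod_cast hb
          linarith
        exact (pow_lt_pow_iff_right₀ (by norm_num)).1 this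
      omega
  refine Wp.seq ((hR.wp_next hB).mono le_rfl ?_)
  rintro ρ₂ ⟨hF, u, w, K, hu, hw, hK, hN⟩
  refine Ev.wp (Ev.ite ?_ ?_) rfl
  · intro hneg
    have hu2 : u.2 < 0 := by
      have : (u.2 : ℝ) < 0 := by simpa [hu.2] using hneg
      exact_mod_cast this
    have hK1 : 1 ≤ K := by
      rw [hN.one_le_iff]
      rcases hN.hu with h | rfl
      · exact h.1
      · simp only [Prod.snd_neg] at hu2; omega
    refine (hR.ev_advance hB hF hu hw hK hN).mono ?_
    rintro ρ₃ ⟨hF₃, hR₃⟩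
    have hv2 : (v + K • u).2 = v.2 + K * u.2 := by simp
    have hKu : K * u.2 ≤ u.2 := by nlinarith
    refine ⟨m - 1, by omega, by rw [hF₃.1, hF.1, hout], .inr
      ⟨by rw [hF₃.2 _ (by decide), hF.2 _ (by decide), hr], v + K • u, u, -w, hR₃, by omega,
        hu2.le, ?_, .inr ?_⟩⟩
    · intro z hz hzc
      rw [show z - (v + K • u) = (z - v) - K • u by abel, cr_sub_right, cr_smul_right,
          cr_self, mul_zero, sub_zero]
      exact hN.left hB hR.mem hR.det hR.notMem hz (hs z hz hzc)
    · rcases hcount with ⟨hm, hvc'⟩ | ⟨T, b, hT, hTv, hb, hcard⟩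
      -- The first step may leave from a non-vertex and has no depth to double; it is paid by the
      -- extra unit in `L + 2` and produces depth at least `1 = 2 ^ 0`.
      · refine ⟨∅, 0, Set.empty_subset _, fun x hx => hx.elim, ?_, by simp; omega⟩
        rw [pow_zero]; omega
      · have hlow : ((v + K • u).2 : ℝ) < v.2 := by
          have : (v + K • u).2 < v.2 := by omega
          exact_mod_cast this
        rcases vertex_or_double hB hR.mem hR.det hR.notMem hs hN hu2 hstart with hvert | hdeep
        · refine ⟨insert (pt v) T, b, Set.insert_subset hvert hT, ?_, by omega, ?_⟩
          · rintro x (rfl | hx)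
            · simpa [pt] using hlow
            · exact hlow.trans (hTv x hx)
          · have hnot : pt v ∉ T := fun hmem => by
              have := hTv _ hmem
              simp [pt] at this
            rw [Set.ncard_insert_of_notMem hnot ((finite_vertices hB).subset hT)]
            omega
        · refine ⟨T, b + 1, hT, fun x hx => hlow.trans (hTv x hx), ?_, by omega⟩
          rw [pow_succ]; omega
  · intro hneg
    have hu2 : 0 ≤ u.2 := by
      have : (0 : ℝ) ≤ u.2 := by simpa [hu.2] using hneg
      exact_mod_cast this
    refine Ev.assign ⟨m - 1, by omega, hF.1.trans hout, .inl ⟨?_, ?_, v, ?_, hR.mem,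
      lowest_of_next hB hR.mem hR.det hR.notMem hvc hd hs hN hu2⟩⟩
    · simp
    · simpa using (hF.2 .zero (by decide)).trans hR.zero
    · have := hF.at hR.atv (by decide) (by decide)
      simp only [At] at this
      simpa [At] using this

/-- From a lattice point of the body, descend to the lowest row that contains one. -/
def descend : Program :=
  (chord 0 Var.v1 1 0 ;; assign .v0 (Ex.ceil Var.lo) ;;
    assign .d0 (-1) ;; assign .d1 0 ;; assign .e0 0 ;; assign .e1 (-1) ;; assign .run 1) ;;
  .loop Var.zero.addr Var.run.addr descendBody

def fullDescendTime (L N : ℕ) : ℕ :=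
  (chord 0 Var.v1 1 0 ;; assign .v0 (Ex.ceil Var.lo) ;;
    assign .d0 (-1) ;; assign .d1 0 ;; assign .e0 0 ;; assign .e1 (-1) ;; assign .run 1).cost +
  ((N + L + 2) * (descendTime L + 1) + 1)

theorem wp_descend (hB : IsBody C O L) {ρ : Env}
    (hv : v ∈ latticePts C) (hvr : At ρ .v0 .v1 v) (hz : ρ.val .zero = 0) (hout : ρ.out = []) :
    Wp O descend ρ (fullDescendTime L (vertices (discreteHull C)).ncard) (fun ρ' =>
      ρ'.out = [] ∧ ρ'.val .zero = 0 ∧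
        ∃ v, At ρ' .v0 .v1 v ∧ v ∈ latticePts C ∧ ∀ z ∈ latticePts C, v.2 ≤ z.2) := by
  refine Ev.wp_seq rfl (Ev.seq (Ev.chord hB.oracle (by simp) ?_))
  intro l h hc hlh
  replace hc : ∀ t : ℝ, (t, (v.2 : ℝ)) ∈ coords C ↔ l ≤ t ∧ t ≤ h := fun t => by
    rw [← hc]; simp [hvr.2]
  have hv1 := (hc v.1).1 hv
  -- The leftmost lattice point of the starting row, so that `(-1, 0)` leaves the body.
  have hmem : (⌈l⌉, v.2) ∈ latticePts C := by
    refine (hc _).2 ⟨Int.le_ceil l, le_trans ?_ hv1.2⟩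
    exact_mod_cast Int.ceil_le.2 hv1.1
  iterate 5 refine Ev.seq (Ev.assign ?_)
  refine Ev.assign ?_
  refine (Wp.loop (DescentInv C L v.2)
    (fun n ρ h1 h2 => wp_descendBody hB ⟨v, hv, rfl⟩ h1 h2) _ _ ⟨?_, .inr ?_⟩).mono
    le_rfl ?_
  · simp [hout]
  · refine ⟨by simp, (⌈l⌉, v.2), (-1, 0), (0, -1), ⟨?_, ?_, ?_, ?_, hmem, ?_, ?_, ?_⟩,
      le_rfl, le_rfl, ?_, .inl ⟨le_rfl, rfl⟩⟩
    · simp [At, hvr.2]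
    · simp [At]
    · simp [At]
    · simp [hz]
    · simp [cr]
    · rw [toR_mem_shift]
      intro hcon
      have := ((hc (⌈l⌉ - 1)).1 (by simpa [toR, sub_eq_add_neg] using hcon)).1
      linarith [Int.ceil_lt_add_one l]
    · have := one_le_two_pow L
      simp only [Int.cast_neg, Int.cast_one, abs_neg, abs_one, Int.cast_zero, abs_zero]
      constructor <;> linarith
    · intro z hz hzc
      simp [cr, hzc]
  · rintro ρ' ⟨⟨m, hout', ⟨-, hz', h⟩ | ⟨hr, v, d, e, hR, -⟩⟩, hnot⟩
    · exact ⟨hout', hz', h⟩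
    · rw [hR.zero, hr] at hnot
      exact absurd zero_lt_one hnot

end

@[simp] theorem Ex.eval_const (ρ : Var → ℝ) (n : ℤ) : (Ex.const n).eval ρ = (n : ℝ) := rfl

/-! ### The vertical extent of the body -/

theorem exists_row {S : Set (ℝ × ℝ)} (hS : Convex ℝ S) {p z : ℝ × ℝ} (hp : p ∈ S) (hz : z ∈ S)
    {σ r : ℝ} (h1 : σ * p.2 ≤ σ * r) (h2 : σ * r ≤ σ * z.2) (h3 : σ * p.2 < σ * z.2) :
    ∃ x, (x, r) ∈ S := by
  set θ := (σ * r - σ * p.2) / (σ * z.2 - σ * p.2) with hθ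
  have hpos : 0 < σ * z.2 - σ * p.2 := by linarith
  have hσ : σ ≠ 0 := by rintro rfl; simp at h3
  have h := hS.add_smul_sub_mem hp hz (t := θ)
    ⟨div_nonneg (by linarith) hpos.le, (div_le_one hpos).2 (by linarith)⟩
  refine ⟨(p + θ • (z - p)).1, ?_⟩
  convert h using 1
  refine Prod.ext rfl ?_
  have : θ * (σ * z.2 - σ * p.2) = σ * r - σ * p.2 := div_mul_cancel₀ _ hpos.ne'
  simp only [Prod.snd_add, Prod.smul_snd, Prod.snd_sub, smul_eq_mul]
  apply mul_left_cancel₀ hσ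
  linear_combination -this

def extentBody (sg : ℤ) : Program :=
  chord 0 (Var.cc + Ex.const sg * Var.s) 1 0 ;;
  ite Var.hi Var.lo (assign .g Var.half ;; assign .s (Var.s * Var.half))
    (assign .u0 Var.lo ;; assign .cc (Var.cc + Ex.const sg * Var.s) ;; assign .u1 Var.cc ;;
      assign .s (Var.s * Var.g))

/-- Find a point of the body whose distance to the highest (for `sg = 1`) or lowest (for
`sg = -1`) row is less than one. -/
def extent (sg : ℤ) : Program :=
  (assign .u0 Var.p0 ;; assign .u1 Var.p1 ;;
    assign .cc (Ex.const sg * Ex.floor (Ex.const sg * Var.p1)) ;;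
    assign .s 1 ;; assign .g (Ex.const 2)) ;;
  .loop Var.half.addr Var.s.addr (extentBody sg)

def extentVars : List Var := [.lo, .hi, .u0, .u1, .cc, .s, .g]

def extentTime (sg : ℤ) (L : ℕ) : ℕ :=
  (assign .u0 Var.p0 ;; assign .u1 Var.p1 ;;
    assign .cc (Ex.const sg * Ex.floor (Ex.const sg * Var.p1)) ;;
    assign .s 1 ;; assign .g (Ex.const 2)).cost +
  ((2 * L + 2) * ((extentBody sg).cost + 1) + 1)

/-- While `g = 2`, the step doubles and row `cc` has moved `2 ^ j - 1` from its start. Once a row is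
missed, `g = 1 / 2` and the row `2 ^ j` beyond `cc` is known to miss the body; the next row tried is
half as far. The start row itself need not meet the body, whence `u1` is only compared with `cc`. -/
structure ExtentInv (C : Set Plane) (L : ℕ) (sg : ℤ) (p : ℝ × ℝ) (ρ₀ : Env) (m : ℕ)
    (ρ : Env) : Prop where
  frame : Frame extentVars ρ₀ ρ
  mem : (ρ.val .u0, ρ.val .u1) ∈ coords C
  le : sg * ρ.val .cc ≤ sg * ρ.val .u1
  ge : sg * p.2 ≤ sg * ρ.val .cc + 1
  phase : (∃ j : ℕ, ρ.val .g = 2 ∧ ρ.val .s = 2 ^ j ∧ j ≤ L ∧ 2 * L + 2 ≤ m + j ∧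
      sg * p.2 ≤ sg * ρ.val .cc + 2 - 2 ^ j) ∨
    (∃ j : ℕ, ρ.val .g = 1 / 2 ∧ ρ.val .s = 2 ^ j / 2 ∧ j ≤ m ∧
      ∀ x, (x, ρ.val .cc + sg * 2 ^ j) ∉ coords C)

theorem ev_extentBody {C : Set Plane} {O : Oracle} {L : ℕ} (hB : IsBody C O L) {sg : ℤ}
    (hsg : (sg : ℝ) * sg = 1) {p : ℝ × ℝ} (hp : p ∈ coords C) {ρ₀ ρ : Env} {m : ℕ}
    (hhalf : ρ₀.val .half = 1 / 2) (h : ExtentInv C L sg p ρ₀ m ρ)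
    (hlt : ρ.val .half < ρ.val .s) :
    Ev O (extentBody sg) ρ (fun ρ' => ∃ m' < m, ExtentInv C L sg p ρ₀ m' ρ') := by
  obtain ⟨hF, hmem, hle, hge, hph⟩ := h
  have hh : ρ.val .half = 1 / 2 := (hF.2 _ (by decide)).trans hhalf
  refine Ev.seq (Ev.chord hB.oracle (by simp) ?_)
  intro l h hc hlh
  generalize hs : ρ.val .s = s at *
  generalize hcc : ρ.val .cc = c at *
  replace hc : ∀ t : ℝ, (t, c + sg * s) ∈ coords C ↔ l ≤ t ∧ t ≤ h := fun t => by
    rw [← hc]; simp [hs, hcc]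
  have hspos : 1 / 2 < s := by rw [← hh]; exact hlt
  have hsc : (sg : ℝ) * (c + sg * s) = sg * c + s := by
    rw [mul_add, ← mul_assoc, hsg, one_mul]
  refine Ev.ite ?_ ?_
  · intro hlo
    replace hlo : h < l := by simpa using hlo
    have hemp : ∀ x, (x, c + sg * s) ∉ coords C := fun x hx => by
      have := (hc x).1 hx; linarith [this.1, this.2]
    refine Ev.seq (Ev.assign (Ev.assign ?_))
    rcases hph with ⟨j, hg, hsj, hj, hm, -⟩ | ⟨j, hg, hsj, hj, -⟩
    · refine ⟨j, by omega, ?_, ?_, ?_, ?_, .inr ⟨j, ?_, ?_, le_rfl, ?_⟩⟩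
      · repeat' first | exact hF | refine Frame.upd ?_ (by decide)
      · simpa using hmem
      · simpa [hcc] using hle
      · simpa [hcc] using hge
      · simp [hh]
      · simp [hh, hs, hsj]; ring
      · intro x hx
        apply hemp x
        simpa [hcc, hsj] using hx
    · have hj0 : j ≠ 0 := by
        rintro rfl; rw [hsj] at hspos; norm_num at hspos
      obtain ⟨i, rfl⟩ : ∃ i, j = i + 1 := ⟨j - 1, by omega⟩
      have hsi : s = 2 ^ i := by rw [hsj, pow_succ]; ring
      refine ⟨i, by omega, ?_, ?_, ?_, ?_, .inr ⟨i, ?_, ?_, le_rfl, ?_⟩⟩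
      · repeat' first | exact hF | refine Frame.upd ?_ (by decide)
      · simpa using hmem
      · simpa [hcc] using hle
      · simpa [hcc] using hge
      · simp [hh]
      · simp [hh, hs, hsi]; ring
      · intro x hx
        apply hemp x
        simpa [hcc, hsi] using hx
  · intro hlo
    replace hlo : l ≤ h := by simpa using hlo
    have hnew : (l, c + sg * s) ∈ coords C := (hc l).2 ⟨le_rfl, hlo⟩
    refine Ev.seq (Ev.assign (Ev.seq (Ev.assign (Ev.seq (Ev.assign (Ev.assign ?_))))))
    rcases hph with ⟨j, hg, hsj, hj, hm, hpc⟩ | ⟨j, hg, hsj, hj, hemp⟩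
    · have hjL : j + 1 ≤ L := by
        have h1 := (hB.near _ hnew _ hp).2
        have h2 : (sg : ℝ) * (c + sg * s - p.2) ≤ |c + sg * s - p.2| := by
          refine (le_abs_self _).trans ?_
          rw [abs_mul]
          have : |(sg : ℝ)| = 1 := by
            have := abs_mul_abs_self (sg : ℝ)
            rw [hsg] at this
            nlinarith [abs_nonneg (sg : ℝ)]
          rw [this, one_mul]
        -- The row just hit is at least `2 ^ (j + 1) - 2` beyond `p`, while heights in the body
        -- differ by at most `2 ^ L - 2`.
        have h3 : (2 : ℝ) ^ (j + 1) ≤ 2 ^ L := by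
          rw [mul_sub, hsc, hsj] at h2
          rw [pow_succ]
          simp only at h1
          rw [hsj] at h1
          linarith
        exact (pow_le_pow_iff_right₀ (by norm_num)).1 h3
      refine ⟨m - 1, by omega, ?_, ?_, ?_, ?_, .inl ⟨j + 1, ?_, ?_, hjL, by omega, ?_⟩⟩
      · repeat' first | exact hF | refine Frame.upd ?_ (by decide)
      · simpa [hcc, hs] using hnew
      · simp
      · simp [hcc, hs, hsc]; linarith
      · simp [hg]
      · simp [hg, hs, hsj, pow_succ]
      · simp [hcc, hs, hsc, pow_succ]; rw [hsj]; linarith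
    · have hj0 : j ≠ 0 := by
        rintro rfl; rw [hsj] at hspos; norm_num at hspos
      obtain ⟨i, rfl⟩ : ∃ i, j = i + 1 := ⟨j - 1, by omega⟩
      have hsi : s = 2 ^ i := by rw [hsj, pow_succ]; ring
      refine ⟨i, by omega, ?_, ?_, ?_, ?_, .inr ⟨i, ?_, ?_, le_rfl, ?_⟩⟩
      · repeat' first | exact hF | refine Frame.upd ?_ (by decide)
      · simpa [hcc, hs] using hnew
      · simp
      · simp [hcc, hs, hsc]; linarith
      · simp [hg]
      · simp [hg, hs, hsi]; ring
      · intro x hx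
        apply hemp x
        convert hx using 2
        simp [hcc, hs, hsi, pow_succ]; ring

theorem wp_extent {C : Set Plane} {O : Oracle} {L : ℕ} (hB : IsBody C O L) {sg : ℤ}
    (hsg : (sg : ℝ) * sg = 1) {ρ : Env} (hp : (ρ.val .p0, ρ.val .p1) ∈ coords C)
    (hhalf : ρ.val .half = 1 / 2) :
    Wp O (extent sg) ρ (extentTime sg L) (fun ρ' => Frame extentVars ρ ρ' ∧
      (ρ'.val .u0, ρ'.val .u1) ∈ coords C ∧
      ∀ z ∈ coords C, sg * z.2 ≤ sg * ρ'.val .u1 + 1) := by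
  refine Ev.wp_seq (by rfl) ?_
  iterate 4 refine Ev.seq (Ev.assign ?_)
  refine Ev.assign ?_
  refine (Wp.loop (ExtentInv C L sg (ρ.val .p0, ρ.val .p1) ρ)
    (fun n ρ' h1 h2 => (ev_extentBody hB hsg hp hhalf h1 h2).wp (by rfl)) _ _ ?_).mono le_rfl ?_
  · have h1 := Int.floor_le ((sg : ℝ) * ρ.val .p1)
    have h2 := Int.lt_floor_add_one ((sg : ℝ) * ρ.val .p1)
    refine ⟨?_, ?_, ?_, ?_, .inl ⟨0, ?_, ?_, by omega, by omega, ?_⟩⟩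
    · repeat' first | exact Frame.refl _ _ | refine Frame.upd ?_ (by decide)
    · simpa using hp
    · simp [← mul_assoc, hsg, h1]
    · simp [← mul_assoc, hsg]; linarith
    · simp
    · simp
    · simp [← mul_assoc, hsg]; linarith
  · rintro ρ' ⟨⟨m, hF, hmem, hle, hge, hph⟩, hnot⟩
    refine ⟨hF, hmem, fun z hz => ?_⟩
    have hh : ρ'.val .half = 1 / 2 := (hF.2 _ (by decide)).trans hhalf
    rw [hh] at hnot
    rcases hph with ⟨j, -, hs, -⟩ | ⟨j, -, hs, -, hemp⟩
    · exfalso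
      apply hnot
      rw [hs]
      have := one_le_two_pow j
      linarith
    · have hj : j = 0 := by
        by_contra hj
        obtain ⟨i, rfl⟩ : ∃ i, j = i + 1 := ⟨j - 1, by omega⟩
        apply hnot
        rw [hs, pow_succ]
        have := one_le_two_pow i
        linarith
      subst hj
      rw [pow_zero, mul_one] at hemp
      by_contra hcon
      push Not at hcon
      have e : (sg : ℝ) * (ρ'.val .cc + sg) = sg * ρ'.val .cc + 1 := by rw [mul_add, hsg]
      -- A point more than one beyond `u1` would, with `p`, force the body to meet the row next to
      -- `cc`, which is known to be missed.
      obtain ⟨x, hx⟩ := exists_row hB.convex hp hz (σ := sg) (r := ρ'.val .cc + sg)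
        (by rw [e]; exact hge) (by rw [e]; linarith) (by simp only at hge ⊢; linarith)
      exact hemp x hx

/-! ### Reduction of the basis -/

theorem mem_row {S : Set (ℝ × ℝ)} {A B P : ℝ × ℝ} (hab : cr A B = 1) {c l h : ℝ}
    (hc : ∀ t : ℝ, c • B + t • A ∈ S ↔ l ≤ t ∧ t ≤ h) (hP : P ∈ S) (hr : cr A P = c) :
    l ≤ cr P B ∧ cr P B ≤ h := by
  rw [← hc, ← hr, add_comm, ← cr_decomp P hab]; exact hP

/-- If the middle row of a body is short, then the body is close to the segment from its lowest to
its highest point. -/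
theorem abs_deviation_le {S : Set (ℝ × ℝ)} (hS : Convex ℝ S) {A B q₁ q₂ z : ℝ × ℝ}
    (hab : cr A B = 1) (h₁ : q₁ ∈ S) (h₂ : q₂ ∈ S) (hz : z ∈ S) {n c l h : ℝ}
    (hn : n = cr A (q₂ - q₁)) (hn16 : 16 < n)
    (hlow : -16 ≤ cr A (z - q₁)) (hhigh : cr A (z - q₁) ≤ n + 16)
    (hc₁ : n / 2 - 1 < c - cr A q₁) (hc₂ : c - cr A q₁ ≤ n / 2)
    (hc : ∀ t : ℝ, c • B + t • A ∈ S ↔ l ≤ t ∧ t ≤ h) (hlh : h < l + 1) :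
    |cr (z - q₁) B - cr A (z - q₁) / n * cr (q₂ - q₁) B| ≤ 8 := by
  have hnpos : 0 < n := by linarith
  obtain ⟨τ, hτ⟩ : ∃ τ, τ = (c - cr A q₁) / n := ⟨_, rfl⟩
  obtain ⟨lam, hlam⟩ : ∃ lam, lam = cr A (z - q₁) / n := ⟨_, rfl⟩
  rw [← hlam]
  have hτn : τ * n = c - cr A q₁ := by rw [hτ, div_mul_cancel₀ _ hnpos.ne']
  have hln : lam * n = cr A (z - q₁) := by rw [hlam, div_mul_cancel₀ _ hnpos.ne']
  -- The rounded middle row is less than one below `n / 2`, and `1 / n < 1 / 16`.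
  have t1 : 7 / 16 < τ := by
    by_contra hcon
    nlinarith
  have t2 : τ ≤ 1 / 2 := by
    by_contra hcon
    nlinarith
  have l1 : -1 ≤ lam := by
    by_contra hcon
    nlinarith
  have l2 : lam ≤ 2 := by
    by_contra hcon
    nlinarith
  have m0 := hS.add_smul_sub_mem h₁ h₂ (t := τ) ⟨by linarith, by linarith⟩
  have r0 := mem_row hab hc m0 (by rw [cr_add_right, cr_smul_right, ← hn, hτn]; ring)
  rw [cr_add_left, cr_smul_left] at r0
  generalize hX : cr (z - q₁) B = X at *
  generalize hdx : cr (q₂ - q₁) B = dx at *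
  rcases le_or_gt τ lam with hcase | hcase
  · have hlpos : 0 < lam := by linarith
    -- Slide `z` towards `q₁` into the row `c`. Its distance there to the point of the segment `q₁
    -- q₂` is at most one, so the deviation is at most `lam / τ ≤ 32 / 7 < 8`.
    have m1 := hS.add_smul_sub_mem h₁ hz (t := τ / lam)
      ⟨by positivity, (div_le_one hlpos).2 hcase⟩
    have r1 := mem_row hab hc m1 (by
      rw [cr_add_right, cr_smul_right, ← hln, ← mul_assoc, div_mul_cancel₀ _ hlpos.ne', hτn]; ring)
    rw [cr_add_left, cr_smul_left, hX] at r1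
    have e : τ / lam * X - τ * dx = τ / lam * (X - lam * dx) := by field_simp
    have hb : |τ / lam * (X - lam * dx)| ≤ 1 := by
      rw [← e, abs_le]; constructor <;> linarith [r0.1, r0.2, r1.1, r1.2]
    rw [abs_mul, abs_of_pos (by positivity), div_mul_eq_mul_div, div_le_one hlpos] at hb
    nlinarith [abs_nonneg (X - lam * dx)]
  · have hpos : 0 < 1 - lam := by linarith
    -- Likewise towards `q₂`, where the factor is `(1 - lam) / (1 - τ) ≤ 4`.
    have m1 := hS.add_smul_sub_mem h₂ hz (t := (1 - τ) / (1 - lam))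
      ⟨div_nonneg (by linarith) hpos.le, (div_le_one hpos).2 (by linarith)⟩
    have ez : z - q₂ = (z - q₁) - (q₂ - q₁) := by abel
    have hθ : (1 - τ) / (1 - lam) * (1 - lam) = 1 - τ := div_mul_cancel₀ _ hpos.ne'
    have r1 := mem_row hab hc m1 (by
      rw [cr_add_right, cr_smul_right, ez, cr_sub_right A (z - q₁), ← hln, ← hn]
      have : cr A q₂ = cr A q₁ + n := by rw [hn, cr_sub_right]; ring
      rw [this]
      linear_combination (-n) * hθ + hτn)
    rw [cr_add_left, cr_smul_left, ez, cr_sub_left (z - q₁), hX, hdx] at r1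
    have eqB : cr q₂ B = cr q₁ B + dx := by rw [← hdx, cr_sub_left]; ring
    rw [eqB] at r1
    have e : dx + (1 - τ) / (1 - lam) * (X - dx) - τ * dx =
        (1 - τ) / (1 - lam) * (X - lam * dx) := by linear_combination (-dx) * hθ
    have hb : |(1 - τ) / (1 - lam) * (X - lam * dx)| ≤ 1 := by
      rw [← e, abs_le]; constructor <;> linarith [r0.1, r0.2, r1.1, r1.2]
    rw [abs_mul, abs_of_nonneg (div_nonneg (by linarith) hpos.le), div_mul_eq_mul_div,
      div_le_one hpos] at hb
    nlinarith [abs_nonneg (X - lam * dx)]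

/-- All points of `S` lie in the rows between those of `q₁` and `q₂`, up to a constant. -/
def Spread (S : Set (ℝ × ℝ)) (A q₁ q₂ : ℝ × ℝ) : Prop :=
  ∀ z ∈ S, -16 ≤ cr A (z - q₁) ∧ cr A (z - q₁) ≤ cr A (q₂ - q₁) + 16

/-- The margin 16 reproduces itself: shearing by `k` at least halves the row distance, so the old
margin contributes at most 8, and the deviation from the segment at most another 8. The two
conclusions cover the two signs of `n'`. -/
theorem Spread.step {S : Set (ℝ × ℝ)} (hS : Convex ℝ S) {A B q₁ q₂ : ℝ × ℝ}
    (hab : cr A B = 1) (h₁ : q₁ ∈ S) (h₂ : q₂ ∈ S) (hsp : Spread S A q₁ q₂) {n c l h : ℝ}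
    (hn : n = cr A (q₂ - q₁)) (hn16 : 16 < n)
    (hc₁ : n / 2 - 1 < c - cr A q₁) (hc₂ : c - cr A q₁ ≤ n / 2)
    (hc : ∀ t : ℝ, c • B + t • A ∈ S ↔ l ≤ t ∧ t ≤ h) (hlh : h < l + 1) {k n' : ℝ}
    (hn' : n' = cr (q₂ - q₁) B - k * n) (hle : |n'| ≤ n / 2) :
    (0 ≤ n' → Spread S (-(B + k • A)) q₁ q₂) ∧ (n' ≤ 0 → Spread S (B + k • A) q₁ q₂) := by
  have hnpos : 0 < n := by linarith
  have key : ∀ z ∈ S, ∃ lam μ : ℝ, cr (B + k • A) (z - q₁) = -(lam * n' + μ) ∧ |μ| ≤ 8 ∧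
      -16 ≤ lam * n ∧ lam * n ≤ n + 16 := by
    intro z hz
    have hz' := hsp z hz
    rw [← hn] at hz'
    refine ⟨cr A (z - q₁) / n, _, ?_, abs_deviation_le hS hab h₁ h₂ hz hn hn16 hz'.1 hz'.2
      hc₁ hc₂ hc hlh, ?_⟩
    · have : cr A (z - q₁) / n * n = cr A (z - q₁) := div_mul_cancel₀ _ hnpos.ne'
      rw [cr_add_left, cr_smul_left, cr_swap B, hn']
      linear_combination (-k) * this
    · rw [div_mul_cancel₀ _ hnpos.ne']; exact hz'
  have hnew : cr (B + k • A) (q₂ - q₁) = -n' := by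
    rw [cr_add_left, cr_smul_left, ← hn, cr_swap, hn']; ring
  rw [abs_le] at hle
  constructor
  · intro h0 z hz
    obtain ⟨lam, μ, e1, e2, e3, e4⟩ := key z hz
    rw [cr_neg_left, cr_neg_left, e1, hnew, neg_neg, neg_neg]
    rw [abs_le] at e2
    have f1 : -8 ≤ lam * n' := by
      rcases le_or_gt 0 lam with hl | hl
      · have := mul_nonneg hl h0; linarith
      · nlinarith
    have f2 : lam * n' ≤ n' + 8 := by
      rcases le_or_gt lam 1 with hl | hl
      · nlinarith
      · nlinarith
    constructor <;> linarith [e2.1, e2.2]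
  · intro h0 z hz
    obtain ⟨lam, μ, e1, e2, e3, e4⟩ := key z hz
    rw [e1, hnew]
    rw [abs_le] at e2
    have f1 : -8 ≤ lam * (-n') := by
      rcases le_or_gt 0 lam with hl | hl
      · have := mul_nonneg hl (neg_nonneg.2 h0); linarith
      · nlinarith
    have f2 : lam * (-n') ≤ -n' + 8 := by
      rcases le_or_gt lam 1 with hl | hl
      · nlinarith
      · nlinarith
    constructor <;> linarith [e2.1, e2.2]

/-! ### Finding a lattice point -/

/-- One step of the basis reduction: either the middle row contains a lattice point, or the basis is
sheared so that the segment from `q₁` to `q₂` meets at most half as many rows. -/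
def reduceBody : Program :=
  assign .cc (Ex.floor ((Var.a0 * Var.q11 - Var.a1 * Var.q10 +
    (Var.a0 * Var.q21 - Var.a1 * Var.q20)) / Ex.const 2)) ;;
  chord (Var.cc * Var.b0) (Var.cc * Var.b1) Var.a0 Var.a1 ;;
  assign .m (Ex.ceil Var.lo) ;;
  ite Var.hi Var.m
    (assign .s ((Var.q20 - Var.q10) * Var.b1 - (Var.q21 - Var.q11) * Var.b0) ;;
      assign .k (Ex.floor (Var.s / Var.n + Var.half)) ;;
      assign .w0 (Var.b0 + Var.k * Var.a0) ;; assign .w1 (Var.b1 + Var.k * Var.a1) ;;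
      assign .b0 Var.a0 ;; assign .b1 Var.a1 ;; assign .a0 (-Var.w0) ;; assign .a1 (-Var.w1) ;;
      assign .n (Var.s - Var.k * Var.n) ;;
      ite Var.n 0
        (assign .a0 Var.w0 ;; assign .a1 Var.w1 ;; assign .b0 (-Var.b0) ;; assign .b1 (-Var.b1) ;;
          assign .n (-Var.n))
        (.instr .nop))
    (assign .found 1 ;; assign .v0 (Var.m * Var.a0 + Var.cc * Var.b0) ;;
      assign .v1 (Var.m * Var.a1 + Var.cc * Var.b1) ;; assign .n 0)

def reduceVars : List Var :=
  [.cc, .lo, .hi, .m, .s, .k, .w0, .w1, .a0, .a1, .b0, .b1, .n, .found, .v0, .v1]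

/-- A lattice point has been found and is stored in the variables. -/
def Found (C : Set Plane) (ρ : Env) : Prop :=
  ρ.val .found = 1 ∧ ∃ v, At ρ .v0 .v1 v ∧ v ∈ latticePts C

/-- Success is signalled by `n = 0`, which also ends the loop; otherwise `n ≤ 2 ^ m` makes `m` a
variant under halving. -/
def ReduceInv (C : Set Plane) (Q₁ Q₂ : ℝ × ℝ) (ρ₀ : Env) (m : ℕ) (ρ : Env) : Prop :=
  Frame reduceVars ρ₀ ρ ∧ ∃ a b, At ρ .a0 .a1 a ∧ At ρ .b0 .b1 b ∧ cr a b = 1 ∧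
    ((Found C ρ ∧ ρ.val .n = 0) ∨
      (ρ.val .found = 0 ∧ 0 ≤ ρ.val .n ∧ ρ.val .n ≤ 2 ^ m ∧
        ρ.val .n = cr (toR a) (Q₂ - Q₁) ∧ Spread (coords C) (toR a) Q₁ Q₂))

section
variable {C : Set Plane} {O : Oracle} {L : ℕ}

theorem ev_reduceBody (hB : IsBody C O L) {Q₁ Q₂ : ℝ × ℝ} {ρ₀ ρ : Env} {m : ℕ}
    (h₁ : Q₁ ∈ coords C) (h₂ : Q₂ ∈ coords C) (hQ₁ : (ρ₀.val .q10, ρ₀.val .q11) = Q₁)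
    (hQ₂ : (ρ₀.val .q20, ρ₀.val .q21) = Q₂) (hhalf : ρ₀.val .half = 1 / 2)
    (hb : ρ₀.val .bound = 16) (h : ReduceInv C Q₁ Q₂ ρ₀ m ρ)
    (hlt : ρ.val .bound < ρ.val .n) :
    Ev O reduceBody ρ (fun ρ' => ∃ m' < m, ReduceInv C Q₁ Q₂ ρ₀ m' ρ') := by
  obtain ⟨hF, a, b, ha, hbr, hdet, ⟨-, hn0⟩ | ⟨hfd, hn0, hnm, hn, hsp⟩⟩ := h
  · rw [hn0, hF.2 _ (by decide), hb] at hlt; norm_num at hlt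
  rw [hF.2 _ (by decide), hb] at hlt
  have hm0 : m ≠ 0 := by
    rintro rfl; norm_num at hnm; linarith
  obtain ⟨i, rfl⟩ : ∃ i, m = i + 1 := ⟨m - 1, by omega⟩
  have q10 : ρ.val .q10 = Q₁.1 := (hF.2 _ (by decide)).trans (congrArg Prod.fst hQ₁)
  have q11 : ρ.val .q11 = Q₁.2 := (hF.2 _ (by decide)).trans (congrArg Prod.snd hQ₁)
  have q20 : ρ.val .q20 = Q₂.1 := (hF.2 _ (by decide)).trans (congrArg Prod.fst hQ₂)
  have q21 : ρ.val .q21 = Q₂.2 := (hF.2 _ (by decide)).trans (congrArg Prod.snd hQ₂)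
  have hh : ρ.val .half = 1 / 2 := (hF.2 _ (by decide)).trans hhalf
  generalize hnv : ρ.val .n = n at *
  have hab : cr (toR a) (toR b) = 1 := by rw [cr_toR, hdet]; simp
  simp only [At] at ha hbr
  refine Ev.seq (Ev.assign ?_)
  obtain ⟨c, hcdef⟩ : ∃ c : ℤ, c = ⌊(cr (toR a) Q₁ + cr (toR a) Q₂) / 2⌋ := ⟨_, rfl⟩
  have hceval : (Ex.floor ((Var.a0 * Var.q11 - Var.a1 * Var.q10 +
    (Var.a0 * Var.q21 - Var.a1 * Var.q20)) / Ex.const 2)).eval ρ.val = (c : ℝ) := by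
    rw [hcdef]; simp [ha, q10, q11, q20, q21, cr, toR]
  rw [hceval]
  have hc₁ : n / 2 - 1 < c - cr (toR a) Q₁ := by
    have := Int.lt_floor_add_one ((cr (toR a) Q₁ + cr (toR a) Q₂) / 2)
    rw [← hcdef] at this
    rw [hn, cr_sub_right]; linarith
  have hc₂ : c - cr (toR a) Q₁ ≤ n / 2 := by
    have := Int.floor_le ((cr (toR a) Q₁ + cr (toR a) Q₂) / 2)
    rw [← hcdef] at this
    rw [hn, cr_sub_right]; linarith
  refine Ev.seq (Ev.chord hB.oracle (by simpa [ha] using (ne_zero_of_cr hdet).1) ?_)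
  intro l h hc hlh
  replace hc : ∀ t : ℝ, (c : ℝ) • toR b + t • toR a ∈ coords C ↔ l ≤ t ∧ t ≤ h := fun t => by
    rw [← hc]; simp [ha, hbr, toR]
  refine Ev.seq (Ev.assign (Ev.ite ?_ ?_))
  · intro hlt'
    replace hlt' : h < ⌈l⌉ := by simpa using hlt'
    have hlh' : h < l + 1 := hlt'.trans (Int.ceil_lt_add_one l)
    iterate 9 refine Ev.seq (Ev.assign ?_)
    obtain ⟨dx, hdx⟩ : ∃ dx, dx = cr (Q₂ - Q₁) (toR b) := ⟨_, rfl⟩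
    have hdx' : (Q₂.1 - Q₁.1) * b.2 - (Q₂.2 - Q₁.2) * b.1 = dx := by rw [hdx]; simp [cr, toR]
    obtain ⟨k, hk⟩ : ∃ k : ℤ, k = ⌊dx / n + 1 / 2⌋ := ⟨_, rfl⟩
    have hnpos : 0 < n := by linarith
    have hdn : dx / n * n = dx := div_mul_cancel₀ _ hnpos.ne'
    -- The integer `k` is `dx / n` rounded to the nearest integer.
    have hle : |dx - k * n| ≤ n / 2 := by
      have k1 := Int.floor_le (dx / n + 1 / 2)
      have k2 := Int.lt_floor_add_one (dx / n + 1 / 2)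
      rw [← hk] at k1 k2
      rw [abs_le]
      constructor <;> nlinarith
    obtain ⟨s1, s2⟩ := hsp.step hB.convex hab h₁ h₂ hn hlt hc₁ hc₂ hc hlh'
      (k := k) (n' := dx - k * n) (by rw [hdx]) hle
    have hnew : cr (toR (b + k • a)) (Q₂ - Q₁) = -(dx - k * n) := by
      rw [toR_add, toR_smul, cr_add_left, cr_smul_left, ← hn, cr_swap, hdx]; ring
    have hdet' : cr (b + k • a) a = -1 := by
      rw [cr_add_left, cr_smul_left, cr_self, cr_swap, hdet]; simp
    rw [← toR_smul, ← toR_add] at s1 s2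
    rw [← toR_neg] at s1
    rw [abs_le] at hle
    have hpow : n / 2 ≤ 2 ^ i := by rw [pow_succ] at hnm; linarith
    refine Ev.ite ?_ ?_
    · intro hneg
      replace hneg : dx - k * n < 0 := by
        simpa [ha, hbr, q10, q11, q20, q21, hdx', hnv, hh, hk] using hneg
      iterate 4 refine Ev.seq (Ev.assign ?_)
      refine Ev.assign ⟨i, by omega, ?_, b + k • a, -a, ?_, ?_, ?_, .inr ⟨?_, ?_, ?_, ?_, s2 hneg.le⟩⟩
      · repeat' first | exact hF | refine Frame.upd ?_ (by decide)
      · simp [At, ha, hbr, q10, q11, q20, q21, hdx', hnv, hh, hk]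
      · simp [At, ha]
      · rw [cr_neg_right, hdet', neg_neg]
      · simp [hfd]
      · simp [ha, hbr, q10, q11, q20, q21, hdx', hnv, hh, -one_div, ← hk]; linarith
      · simp [ha, hbr, q10, q11, q20, q21, hdx', hnv, hh, -one_div, ← hk]; linarith
      · rw [hnew]
        simp [ha, hbr, q10, q11, q20, q21, hdx', hnv, hh, hk]
    · intro hneg
      replace hneg : 0 ≤ dx - k * n := by
        simpa [ha, hbr, q10, q11, q20, q21, hdx', hnv, hh, hk] using hneg
      refine Ev.nop ⟨i, by omega, ?_, -(b + k • a), a, ?_, ?_, ?_, .inr ⟨?_, ?_, ?_, ?_, s1 hneg⟩⟩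
      · repeat' first | exact hF | refine Frame.upd ?_ (by decide)
      · simp [At, ha, hbr, q10, q11, q20, q21, hdx', hnv, hh, hk]
      · simp [At, ha]
      · rw [cr_neg_left, hdet', neg_neg]
      · simp [hfd]
      · simp [ha, hbr, q10, q11, q20, q21, hdx', hnv, hh, -one_div, ← hk]; linarith
      · simp [ha, hbr, q10, q11, q20, q21, hdx', hnv, hh, -one_div, ← hk]; linarith
      · rw [toR_neg, cr_neg_left, hnew, neg_neg]
        simp [ha, hbr, q10, q11, q20, q21, hdx', hnv, hh, hk]
  · intro hle
    replace hle : ⌈l⌉ ≤ h := by simpa using hle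
    have hmem : ⌈l⌉ • a + c • b ∈ latticePts C := by
      have := (hc ⌈l⌉).2 ⟨Int.le_ceil l, hle⟩
      change toR _ ∈ coords C
      rwa [toR_add, toR_smul, toR_smul, add_comm]
    refine Ev.seq (Ev.assign (Ev.seq (Ev.assign (Ev.seq (Ev.assign (Ev.assign ?_))))))
    refine ⟨i, by omega, ?_, a, b, ?_, ?_, hdet, .inl ⟨⟨?_, ⌈l⌉ • a + c • b, ?_, hmem⟩, ?_⟩⟩
    · repeat' first | exact hF | refine Frame.upd ?_ (by decide)
    · simp [At, ha]
    · simp [At, hbr]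
    · simp
    · simp [At, ha, hbr]
    · simp

/-! ### Inspection of the remaining rows, and the complete search for a lattice point -/

/-- Look for a lattice point in one row. -/
def rowBody : Program :=
  chord (Var.cc * Var.b0) (Var.cc * Var.b1) Var.a0 Var.a1 ;;
  assign .m (Ex.ceil Var.lo) ;;
  ite Var.hi Var.m (.instr .nop)
    (assign .found 1 ;; assign .v0 (Var.m * Var.a0 + Var.cc * Var.b0) ;;
      assign .v1 (Var.m * Var.a1 + Var.cc * Var.b1)) ;;
  assign .cc (Var.cc + 1)

def rowVars : List Var := [.cc, .lo, .hi, .m, .found, .v0, .v1]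

/-- The invariant of the search through the rows; if no lattice point has been found, then all
lattice points are in the rows that have not been searched. -/
def RowInv (C : Set Plane) (a b : ℤ × ℤ) (ρ₀ : Env) (m : ℕ) (ρ : Env) : Prop :=
  Frame rowVars ρ₀ ρ ∧ At ρ .a0 .a1 a ∧ At ρ .b0 .b1 b ∧
    ∃ c : ℤ, ρ.val .cc = c ∧ ρ.val .ce - c ≤ m ∧
      (Found C ρ ∨
        (ρ₀.val .found = 0 ∧ ρ.val .found = 0 ∧ ∀ z ∈ latticePts C, c ≤ cr a z))

theorem ev_rowBody (hB : IsBody C O L) {a b : ℤ × ℤ} (hdet : cr a b = 1) {ρ₀ ρ : Env} {m : ℕ}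
    (h : RowInv C a b ρ₀ m ρ) (hlt : ρ.val .cc < ρ.val .ce) :
    Ev O rowBody ρ (fun ρ' => ∃ m' < m, RowInv C a b ρ₀ m' ρ') := by
  obtain ⟨hF, ha, hb, c, hcc, hcm, hcase⟩ := h
  have hm0 : m ≠ 0 := by
    rintro rfl; rw [hcc] at hlt; norm_num at hcm; linarith
  obtain ⟨i, rfl⟩ : ∃ i, m = i + 1 := ⟨m - 1, by omega⟩
  have hci : ρ.val .ce - ((c + 1 : ℤ) : ℝ) ≤ i := by push_cast at hcm ⊢; linarith
  have hab : cr (toR a) (toR b) = 1 := by rw [cr_toR, hdet]; simp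
  simp only [At] at ha hb
  refine Ev.seq (Ev.chord hB.oracle (by simpa [ha] using (ne_zero_of_cr hdet).1) ?_)
  intro l h hc hlh
  replace hc : ∀ t : ℝ, (c : ℝ) • toR b + t • toR a ∈ coords C ↔ l ≤ t ∧ t ≤ h := fun t => by
    rw [← hc]; simp [ha, hb, toR, hcc]
  refine Ev.seq (Ev.assign (Ev.seq (Ev.ite ?_ ?_)))
  · intro hlt'
    replace hlt' : h < ⌈l⌉ := by simpa using hlt'
    refine Ev.nop (Ev.assign ⟨i, by omega, ?_, ?_, ?_, c + 1, ?_, ?_, ?_⟩)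
    · repeat' first | exact hF | refine Frame.upd ?_ (by decide)
    · simp [At, ha]
    · simp [At, hb]
    · simp [hcc]
    · simpa using hci
    · rcases hcase with ⟨hf, v, hv, hvm⟩ | ⟨hf₀, hf, hall⟩
      · simp only [At] at hv
        exact .inl ⟨by simp [hf], v, by simp [At, hv], hvm⟩
      · refine .inr ⟨hf₀, by simp [hf], fun z hz => ?_⟩
        refine lt_of_le_of_ne (hall z hz) fun heq => ?_
        have := mem_row hab hc hz (by rw [cr_toR, ← heq])
        rw [cr_toR] at this
        have h1 := Int.ceil_le.2 this.1
        have h2 : ((⌈l⌉ : ℤ) : ℝ) ≤ (cr z b : ℤ) := by exact_mod_cast h1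
        linarith [this.2]
  · intro hle
    replace hle : ⌈l⌉ ≤ h := by simpa using hle
    have hmem : ⌈l⌉ • a + c • b ∈ latticePts C := by
      have := (hc ⌈l⌉).2 ⟨Int.le_ceil l, hle⟩
      change toR _ ∈ coords C
      rwa [toR_add, toR_smul, toR_smul, add_comm]
    refine Ev.seq (Ev.assign (Ev.seq (Ev.assign (Ev.assign (Ev.assign ?_)))))
    refine ⟨i, by omega, ?_, ?_, ?_, c + 1, ?_, ?_, .inl ⟨?_, ⌈l⌉ • a + c • b, ?_, hmem⟩⟩
    · repeat' first | exact hF | refine Frame.upd ?_ (by decide)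
    · simp [At, ha]
    · simp [At, hb]
    · simp [hcc]
    · simpa using hci
    · simp
    · simp [At, ha, hb, hcc]

/-- Find a lattice point of the body, if there is one. -/
def locate : Program :=
  (assign .half (1 / Ex.const 2)) ;; extent (-1) ;;
  (assign .q10 Var.u0 ;; assign .q11 Var.u1) ;; extent 1 ;;
  (assign .q20 Var.u0 ;; assign .q21 Var.u1 ;; assign .a0 1 ;; assign .a1 0 ;; assign .b0 0 ;;
    assign .b1 1 ;; assign .n (Var.q21 - Var.q11) ;; assign .bound (Ex.const 16) ;;
    ite Var.n 0 (assign .n 0 ;; assign .q20 Var.q10 ;; assign .q21 Var.q11) (.instr .nop)) ;;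
  .loop Var.bound.addr Var.n.addr reduceBody ;;
  (assign .cc (Ex.floor (Var.a0 * Var.q11 - Var.a1 * Var.q10) - Ex.const 16) ;;
    assign .ce (Var.a0 * Var.q11 - Var.a1 * Var.q10 + Var.n + Ex.const 17)) ;;
  .loop Var.cc.addr Var.ce.addr rowBody

def locateTime (L : ℕ) : ℕ :=
  (assign .half (1 / Ex.const 2)).cost + (extentTime (-1) L +
  ((assign .q10 Var.u0 ;; assign .q11 Var.u1).cost + (extentTime 1 L +
  ((assign .q20 Var.u0 ;; assign .q21 Var.u1 ;; assign .a0 1 ;; assign .a1 0 ;; assign .b0 0 ;;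
    assign .b1 1 ;; assign .n (Var.q21 - Var.q11) ;; assign .bound (Ex.const 16) ;;
    ite Var.n 0 (assign .n 0 ;; assign .q20 Var.q10 ;; assign .q21 Var.q11) (.instr .nop)).cost +
  ((L * (reduceBody.cost + 1) + 1) +
  ((assign .cc (Ex.floor (Var.a0 * Var.q11 - Var.a1 * Var.q10) - Ex.const 16) ;;
    assign .ce (Var.a0 * Var.q11 - Var.a1 * Var.q10 + Var.n + Ex.const 17)).cost +
  (50 * (rowBody.cost + 1) + 1)))))))

theorem wp_locate (hB : IsBody C O L) {ρ : Env} (hp : (ρ.val .p0, ρ.val .p1) ∈ coords C)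
    (hz : ρ.val .zero = 0) (hf : ρ.val .found = 0) (hout : ρ.out = []) :
    Wp O locate ρ (locateTime L) (fun ρ' => ρ'.out = [] ∧ ρ'.val .zero = 0 ∧
      (Found C ρ' ∨ (ρ'.val .found = 0 ∧ latticePts C = ∅))) := by
  refine Ev.wp_seq rfl (Ev.assign ?_)
  refine Wp.seq ((wp_extent hB (sg := -1) (by norm_num) (by simpa using hp)
    (by simp)).mono le_rfl ?_)
  rintro ρ₁ ⟨hF₁, hm₁, he₁⟩
  have p0₁ : ρ₁.val .p0 = ρ.val .p0 := by rw [hF₁.2 _ (by decide)]; simp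
  have p1₁ : ρ₁.val .p1 = ρ.val .p1 := by rw [hF₁.2 _ (by decide)]; simp
  have z₁ : ρ₁.val .zero = 0 := by rw [hF₁.2 _ (by decide)]; simp [hz]
  have f₁ : ρ₁.val .found = 0 := by rw [hF₁.2 _ (by decide)]; simp [hf]
  have h₁ : ρ₁.val .half = 1 / 2 := by rw [hF₁.2 _ (by decide)]; simp
  have o₁ : ρ₁.out = [] := by rw [hF₁.1]; simp [hout]
  refine Ev.wp_seq rfl (Ev.seq (Ev.assign (Ev.assign ?_)))
  refine Wp.seq ((wp_extent hB (sg := 1) (by norm_num) (by simpa [p0₁, p1₁] using hp)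
    (by simp [h₁])).mono le_rfl ?_)
  rintro ρ₂ ⟨hF₂, hm₂, he₂⟩
  have q10 : ρ₂.val .q10 = ρ₁.val .u0 := by rw [hF₂.2 _ (by decide)]; simp
  have q11 : ρ₂.val .q11 = ρ₁.val .u1 := by rw [hF₂.2 _ (by decide)]; simp
  have z₂ : ρ₂.val .zero = 0 := by rw [hF₂.2 _ (by decide)]; simp [z₁]
  have f₂ : ρ₂.val .found = 0 := by rw [hF₂.2 _ (by decide)]; simp [f₁]
  have h₂ : ρ₂.val .half = 1 / 2 := by rw [hF₂.2 _ (by decide)]; simp [h₁]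
  have o₂ : ρ₂.out = [] := by rw [hF₂.1]; simp [o₁]
  -- The approximate top may be below the approximate bottom. Then the body is so flat that `Q₂ =
  -- Q₁` serves with row distance zero.
  have key : ∃ Q₁ Q₂ : ℝ × ℝ, Q₁ ∈ coords C ∧ Q₂ ∈ coords C ∧ Q₁ = (ρ₁.val .u0, ρ₁.val .u1) ∧
      0 ≤ Q₂.2 - Q₁.2 ∧ Q₂.2 - Q₁.2 ≤ 2 ^ L ∧ Spread (coords C) (toR (1, 0)) Q₁ Q₂ ∧
      ((ρ₂.val .u1 - ρ₁.val .u1 < 0 → Q₂ = Q₁) ∧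
        (0 ≤ ρ₂.val .u1 - ρ₁.val .u1 → Q₂ = (ρ₂.val .u0, ρ₂.val .u1))) := by
    simp only [Int.cast_neg, Int.cast_one, neg_mul, one_mul] at he₁ he₂
    have cr1 : ∀ z : ℝ × ℝ, cr (toR (1, 0)) z = z.2 := fun z => by simp [cr, toR]
    rcases lt_or_ge (ρ₂.val .u1 - ρ₁.val .u1) 0 with hneg | hpos
    · refine ⟨_, _, hm₁, hm₁, rfl, by simp, by simp, fun z hz => ?_, fun _ => rfl,
        fun h => absurd h (by linarith)⟩
      have := he₁ z hz
      have := he₂ z hz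
      rw [cr1, cr1]
      simp only [Prod.snd_sub]
      constructor <;> linarith
    · refine ⟨_, _, hm₁, hm₂, rfl, hpos, ?_, fun z hz => ?_,
        fun h => absurd h (by linarith), fun _ => rfl⟩
      · have := (abs_le.1 (hB.near _ hm₂ _ hm₁).2).2
        simp only at this ⊢
        linarith
      · have := he₁ z hz
        have := he₂ z hz
        rw [cr1, cr1]
        simp only [Prod.snd_sub]
        constructor <;> linarith
  obtain ⟨Q₁, Q₂, hQ₁, hQ₂, eQ₁, hn0, hnL, hsp, hQneg, hQpos⟩ := key
  have q10' : ρ₁.val .u0 = Q₁.1 := by rw [eQ₁]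
  have q11' : ρ₁.val .u1 = Q₁.2 := by rw [eQ₁]
  rw [q10'] at q10
  rw [q11'] at q11
  rw [q11'] at hQneg hQpos
  refine Ev.wp_seq (by rfl) (Ev.mono (Q := fun ρ₃ => ρ₃.out = [] ∧ ρ₃.val .zero = 0 ∧
    ρ₃.val .found = 0 ∧ ρ₃.val .half = 1 / 2 ∧ (ρ₃.val .q10, ρ₃.val .q11) = Q₁ ∧
    (ρ₃.val .q20, ρ₃.val .q21) = Q₂ ∧ At ρ₃ .a0 .a1 (1, 0) ∧ At ρ₃ .b0 .b1 (0, 1) ∧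
    ρ₃.val .n = Q₂.2 - Q₁.2 ∧ ρ₃.val .bound = 16) ?_ ?_)
  · iterate 8 refine Ev.seq (Ev.assign ?_)
    refine Ev.ite ?_ ?_
    · intro hneg
      replace hneg : ρ₂.val .u1 - Q₁.2 < 0 := by simpa [q11] using hneg
      have := hQneg hneg
      subst this
      refine Ev.seq (Ev.assign (Ev.seq (Ev.assign (Ev.assign ?_))))
      simp [At, o₂, z₂, f₂, h₂, q10, q11]
    · intro hpos
      replace hpos : 0 ≤ ρ₂.val .u1 - Q₁.2 := by simpa [q11] using hpos
      have := hQpos hpos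
      refine Ev.nop ?_
      simp [At, o₂, z₂, f₂, h₂, q10, q11, this]
  rintro ρ₃ ⟨o₃, z₃, f₃, h₃, e₁, e₂, ha₃, hb₃, hn₃, hbd₃⟩
  refine Wp.seq ((Wp.loop (ReduceInv C Q₁ Q₂ ρ₃) (fun n ρ' i1 i2 =>
    (ev_reduceBody hB hQ₁ hQ₂ e₁ e₂ h₃ hbd₃ i1 i2).wp (by rfl)) L _
    ⟨Frame.refl _ _, (1, 0), (0, 1), ha₃, hb₃, by simp [cr], .inr ⟨f₃, ?_, ?_, ?_, hsp⟩⟩).mono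
    le_rfl ?_)
  · rw [hn₃]; exact hn0
  · rw [hn₃]; exact hnL
  · rw [hn₃]; simp [cr, toR]
  rintro ρ₄ ⟨⟨m, hF₄, a, b, ha, hb, hdet, hcase⟩, hnot⟩
  have o₄ : ρ₄.out = [] := by rw [hF₄.1, o₃]
  have z₄ : ρ₄.val .zero = 0 := (hF₄.2 _ (by decide)).trans z₃
  have q10₄ : ρ₄.val .q10 = Q₁.1 := (hF₄.2 _ (by decide)).trans (congrArg Prod.fst e₁)
  have q11₄ : ρ₄.val .q11 = Q₁.2 := (hF₄.2 _ (by decide)).trans (congrArg Prod.snd e₁)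
  rw [hF₄.2 .bound (by decide), hbd₃, not_lt] at hnot
  simp only [At] at ha hb
  have hy : ρ₄.val .a0 * ρ₄.val .q11 - ρ₄.val .a1 * ρ₄.val .q10 = cr (toR a) Q₁ := by
    simp [cr, toR, ha, q10₄, q11₄]
  have hfl := Int.floor_le (cr (toR a) Q₁)
  have hlt := Int.lt_floor_add_one (cr (toR a) Q₁)
  refine Ev.wp_seq (by rfl) (Ev.seq (Ev.assign (Ev.assign ?_)))
  -- The rows to be scanned span less than `16 + n + 17 + 1 ≤ 50`, the margin being 16 on both sides
  -- and `n ≤ 16`.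
  refine (Wp.loop (RowInv C a b _) (fun n ρ' i1 i2 =>
    (ev_rowBody hB hdet i1 i2).wp (by rfl)) 50 _
    ⟨Frame.refl _ _, ?_, ?_, ⌊cr (toR a) Q₁⌋ - 16, ?_, ?_, ?_⟩).mono le_rfl ?_
  · simpa [At] using ha
  · simpa [At] using hb
  · simp [hy]
  · simp [hy]; linarith
  · rcases hcase with ⟨⟨hf, v, hv, hvm⟩, -⟩ | ⟨hf, -, -, hn, hs⟩
    · simp only [At] at hv
      exact .inl ⟨by simp [hf], v, by simp [At, hv], hvm⟩
    · refine .inr ⟨by simp [hf], by simp [hf], fun z hz => ?_⟩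
      have := (hs _ hz).1
      rw [cr_sub_right, cr_toR] at this
      have h1 : ((⌊cr (toR a) Q₁⌋ : ℤ) : ℝ) ≤ ((cr a z + 16 : ℤ) : ℝ) := by push_cast; linarith
      have h2 : ⌊cr (toR a) Q₁⌋ ≤ cr a z + 16 := by exact_mod_cast h1
      linarith
  · rintro ρ₅ ⟨⟨m', hF₅, -, -, c, hcc, -, hfin⟩, hdone⟩
    refine ⟨?_, ?_, ?_⟩
    · rw [hF₅.1]; simp [o₄]
    · rw [hF₅.2 _ (by decide)]; simp [z₄]
    · rcases hfin with hfin | ⟨hf₀, hf, hall⟩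
      · exact .inl hfin
      · rcases hcase with ⟨⟨hf', -⟩, -⟩ | ⟨-, -, -, hn, hs⟩
        · simp [hf'] at hf₀
        · refine .inr ⟨hf, Set.eq_empty_of_forall_notMem fun z hz => ?_⟩
          have ce₅ : ρ₅.val .ce = cr (toR a) Q₁ + ρ₄.val .n + 17 := by
            rw [hF₅.2 _ (by decide)]; simp [hy]
          rw [hcc, ce₅, not_lt] at hdone
          have h1 := (hs _ hz).2
          rw [cr_sub_right, cr_toR, ← hn] at h1
          have h2 : (c : ℝ) ≤ (cr a z : ℤ) := by exact_mod_cast hall z hz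
          linarith

end

/-! ### The algorithm -/

/-- The algorithm. -/
def main : Program :=
  locate ;; ite Var.zero Var.found (descend ;; walk) (.instr .nop)

def mainTime (L N : ℕ) : ℕ :=
  locateTime L + (((Ex.var .zero).code 64).cost + (((Ex.var .found).code 65).cost +
    (1 + (fullDescendTime L N + fullWalkTime L N))))

theorem wp_main {C : Set Plane} {O : Oracle} {L : ℕ} (hB : IsBody C O L) {ρ : Env}
    (hp : (ρ.val .p0, ρ.val .p1) ∈ coords C) (hz : ρ.val .zero = 0) (hf : ρ.val .found = 0)
    (hout : ρ.out = []) :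
    Wp O main ρ (mainTime L (vertices (discreteHull C)).ncard)
      (fun ρ' => IsVertexListCCW ρ'.out (discreteHull C)) := by
  refine Wp.seq ((wp_locate hB hp hz hf hout).mono le_rfl ?_)
  rintro ρ₁ ⟨o₁, z₁, hcase⟩
  refine Wp.ite ?_ ?_ (by rfl) (by rfl)
  · intro hlt
    rcases hcase with ⟨-, v, hv, hvm⟩ | ⟨hf₁, -⟩
    · refine Wp.seq ((wp_descend hB hvm hv z₁ o₁).mono le_rfl ?_)
      rintro ρ₂ ⟨o₂, z₂, w, hw, hwm, hlow⟩
      exact wp_walk hB hwm hw z₂ o₂ hlow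
    · simp [z₁, hf₁] at hlt
  · intro hle
    rcases hcase with ⟨hf₁, -⟩ | ⟨-, hemp⟩
    · simp [z₁, hf₁] at hle
      norm_num at hle
    · refine (Ev.wp (Ev.nop ?_) (by rfl)).mono (T := 1) ?_ fun _ h => h
      · rw [o₁]; exact isVertexListCCW_nil hemp
      · rw [fullWalkTime]; omega

/-! ### Total running time -/

/-- The function grows at most linearly. -/
def LinearBound (f : ℕ → ℕ) : Prop := ∃ c, ∀ L, f L ≤ c * (L + 1)

namespace LinearBound
variable {f g : ℕ → ℕ}

theorem const (c : ℕ) : LinearBound fun _ => c := ⟨c, fun L => Nat.le_mul_of_pos_right c L.succ_pos⟩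

theorem id : LinearBound fun L => L := ⟨1, fun L => by rw [one_mul]; exact L.le_succ⟩

theorem add (hf : LinearBound f) (hg : LinearBound g) : LinearBound fun L => f L + g L := by
  obtain ⟨c, hc⟩ := hf
  obtain ⟨d, hd⟩ := hg
  exact ⟨c + d, fun L => by rw [add_mul]; exact add_le_add (hc L) (hd L)⟩

theorem const_mul (hf : LinearBound f) (k : ℕ) : LinearBound fun L => k * f L := by
  obtain ⟨c, hc⟩ := hf
  exact ⟨k * c, fun L => by rw [mul_assoc]; exact Nat.mul_le_mul_left k (hc L)⟩

theorem mul_const (hf : LinearBound f) (k : ℕ) : LinearBound fun L => f L * k := by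
  simpa only [mul_comm] using hf.const_mul k

end LinearBound

theorem linearBound_extentTime (sg : ℤ) : LinearBound (extentTime sg) :=
  .add (.const _) (.add (.mul_const (.add (.const_mul .id 2) (.const 2)) _) (.const 1))

theorem linearBound_locateTime : LinearBound locateTime :=
  .add (.const _) (.add (linearBound_extentTime _) (.add (.const _) (.add (linearBound_extentTime _)
    (.add (.const _) (.add (.add (.mul_const .id _) (.const 1)) (.const _))))))

theorem linearBound_nextTime : LinearBound nextTime :=
  .add (.const _) (.add (.add (.mul_const (.add (.const_mul .id 2) (.const 5)) _) (.const 1))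
    (.const _))

theorem linearBound_walkTime : LinearBound walkTime :=
  .add (.const _) (.add linearBound_nextTime (.const _))

theorem linearBound_descendTime : LinearBound descendTime :=
  .add linearBound_nextTime (.const _)

theorem mainTime_le : ∃ c, ∀ L N, mainTime L N ≤ c * ((L + 1) * (N + L + 1)) := by
  obtain ⟨c₁, h₁⟩ := linearBound_locateTime
  obtain ⟨c₂, h₂⟩ := linearBound_descendTime
  obtain ⟨c₃, h₃⟩ := linearBound_walkTime
  unfold mainTime fullDescendTime fullWalkTime
  generalize ((Ex.var .zero).code 64).cost = x₁
  generalize ((Ex.var .found).code 65).cost = x₂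
  generalize Program.cost _ = x₃
  generalize Program.cost _ = x₄
  refine ⟨c₁ + x₁ + x₂ + x₃ + x₄ + 2 * (c₂ + 1) + (c₃ + 1) + 3, fun L N => ?_⟩
  have k₁ := h₁ L
  have k₂ : (N + L + 2) * (descendTime L + 1) ≤ (N + L + 2) * ((c₂ + 1) * (L + 1)) :=
    Nat.mul_le_mul_left _ (by have := h₂ L; rw [add_mul]; omega)
  have k₃ : N * (walkTime L + 1) ≤ N * ((c₃ + 1) * (L + 1)) :=
    Nat.mul_le_mul_left _ (by have := h₃ L; rw [add_mul]; omega)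
  generalize locateTime L = y₁ at *
  generalize (N + L + 2) * (descendTime L + 1) = y₂ at *
  generalize N * (walkTime L + 1) = y₃ at *
  refine le_trans (add_le_add k₁ (add_le_add_right (add_le_add_right (add_le_add_right (add_le_add
    (add_le_add_right (add_le_add_left k₂ 1) _) (add_le_add_right (add_le_add_left k₃ 1) _)) _) _)
      _)) ?_
  have e : 1 ≤ (L + 1) * (N + L + 1) := Nat.mul_pos L.succ_pos (by omega)
  have f : ∀ x, x ≤ x * ((L + 1) * (N + L + 1)) := fun x => Nat.le_mul_of_pos_right x e
  have g₁ : c₁ * (L + 1) ≤ c₁ * ((L + 1) * (N + L + 1)) :=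
    Nat.mul_le_mul_left _ (Nat.le_mul_of_pos_right _ (by omega))
  have g₂ : (N + L + 2) * ((c₂ + 1) * (L + 1)) ≤ 2 * (c₂ + 1) * ((L + 1) * (N + L + 1)) :=
    calc (N + L + 2) * ((c₂ + 1) * (L + 1)) ≤ (2 * (N + L + 1)) * ((c₂ + 1) * (L + 1)) :=
          Nat.mul_le_mul_right _ (by omega)
      _ = 2 * (c₂ + 1) * ((L + 1) * (N + L + 1)) := by ring
  have g₃ : N * ((c₃ + 1) * (L + 1)) ≤ (c₃ + 1) * ((L + 1) * (N + L + 1)) :=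
    calc N * ((c₃ + 1) * (L + 1)) ≤ (N + L + 1) * ((c₃ + 1) * (L + 1)) :=
          Nat.mul_le_mul_right _ (by omega)
      _ = (c₃ + 1) * ((L + 1) * (N + L + 1)) := by ring
  have := f x₁
  have := f x₂
  have := f x₃
  have := f x₄
  have := f 3
  simp only [add_mul _ _ ((L + 1) * (N + L + 1))] at *
  omega

/-! ### From the diameter to the exponent `L` -/

theorem two_add_le_two_pow {x : ℝ} (hx : 0 ≤ x) : 2 + x ≤ 2 ^ ⌈Real.logb 2 (2 + x)⌉₊ := by
  rw [← Real.rpow_natCast, ← Real.logb_le_iff_le_rpow (by norm_num) (by linarith)]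
  exact Nat.le_ceil _

/-- The left side is less than `logb 2 (2 + x) + 2`, and `2 ≤ 2 * logb 2 (2 + x)`. So three times
`logb` suffices, and `3 / log 2 < 5`. -/
theorem ceil_logb_add_one_le {x : ℝ} (hx : 0 ≤ x) :
    (⌈Real.logb 2 (2 + x)⌉₊ : ℝ) + 1 ≤ 5 * Real.log (2 + x) := by
  have h2 := Real.log_two_gt_d9
  have h1 : Real.log 2 ≤ Real.log (2 + x) := Real.log_le_log (by norm_num) (by linarith)
  have h3 : 0 ≤ Real.logb 2 (2 + x) := Real.logb_nonneg (by norm_num) (by linarith)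
  have h4 := Nat.ceil_lt_add_one h3
  have h5 : Real.logb 2 (2 + x) * Real.log 2 = Real.log (2 + x) :=
    div_mul_cancel₀ _ (by linarith)
  nlinarith

theorem isBody {C : Set Plane} (hC : IsCompact C) (hconv : Convex ℝ C) {O : Oracle}
    (hO : IsLineOracle C O) : IsBody C O ⌈Real.logb 2 (2 + Metric.diam C)⌉₊ where
  oracle := hO
  convex := by
    intro z hz w hw a b ha hb hab
    have := hconv hz hw ha hb hab
    change !₂[_, _] ∈ C
    convert this using 1
    ext i
    fin_cases i <;> simp
  near z hz w hw := by
    have h1 := two_add_le_two_pow (Metric.diam_nonneg (s := C))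
    have h2 := Metric.dist_le_diam_of_mem hC.isBounded hz hw
    rw [dist_eq_norm] at h2
    have h3 := PiLp.norm_apply_le (!₂[z.1, z.2] - !₂[w.1, w.2] : Plane)
    have h4 := h3 0
    have h5 := h3 1
    simp only [Real.norm_eq_abs, PiLp.sub_apply, Matrix.cons_val_zero, Matrix.cons_val_one,
      Matrix.cons_val_fin_one] at h4 h5
    constructor <;> linarith

theorem direct_main : main.direct = true := by decide +kernel

end DiscreteHull

theorem mainTheorem4 :
    ∃ (A : DiscreteHull.Program) (K : ℝ) (S : ℕ),
      ∀ C : Set DiscreteHull.Plane, IsCompact C → Convex ℝ C →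
      ∀ p ∈ C, ∀ O : DiscreteHull.Oracle, DiscreteHull.IsLineOracle C O →
      ∃ (σ : DiscreteHull.State) (t : ℕ) (s : Finset ℕ),
        DiscreteHull.Run O A (DiscreteHull.initialState p) σ t s ∧
        DiscreteHull.IsVertexListCCW σ.out (DiscreteHull.discreteHull C) ∧
        (t : ℝ) ≤ K * (Real.log (2 + Metric.diam C) ^ 2 +
          ((DiscreteHull.vertices (DiscreteHull.discreteHull C)).ncard : ℝ) *
            Real.log (2 + Metric.diam C)) ∧
        s.card ≤ S := by
  obtain ⟨c, hc⟩ := DiscreteHull.mainTime_le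
  refine ⟨DiscreteHull.main, 25 * c, DiscreteHull.main.support.card, fun C hC hconv p hp O hO => ?_⟩
  have hag : DiscreteHull.Agrees (DiscreteHull.initialState p)
      ⟨fun x => (DiscreteHull.initialState p).mem x.addr, []⟩ := ⟨rfl, fun _ => rfl⟩
  obtain ⟨σ, t, s, ρ', hrun, hag', ht, hlist⟩ := DiscreteHull.wp_main
    (DiscreteHull.isBody hC hconv hO)
    (ρ := ⟨fun x => (DiscreteHull.initialState p).mem x.addr, []⟩)
    (by
      change !₂[p 0, p 1] ∈ C
      convert hp using 1
      ext i
      fin_cases i <;> rfl) rfl rfl rfl _ hag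
  refine ⟨σ, t, s, hrun, hag'.1 ▸ hlist, ?_,
    Finset.card_le_card (hrun.cells_subset DiscreteHull.direct_main)⟩
  have hL := DiscreteHull.ceil_logb_add_one_le (Metric.diam_nonneg (s := C))
  generalize ⌈Real.logb 2 (2 + Metric.diam C)⌉₊ = L at *
  generalize (DiscreteHull.vertices (DiscreteHull.discreteHull C)).ncard = N at *
  generalize Real.log (2 + Metric.diam C) = X at *
  have h1 : (t : ℝ) ≤ c * ((L + 1) * (N + L + 1)) := by exact_mod_cast ht.trans (hc L N)
  have hL0 : (0 : ℝ) ≤ L := L.cast_nonneg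
  have hN0 : (0 : ℝ) ≤ N := N.cast_nonneg
  -- Both factors are estimated by `L + 1 ≤ 5 X`; the product is at most `25 (X ^ 2 + N X)`, whence
  -- the constant 25.
  have h2 : ((L : ℝ) + 1) * (N + L + 1) ≤ 5 * X * (N + 5 * X) :=
    mul_le_mul hL (by linarith) (by linarith) (by linarith)
  calc (t : ℝ) ≤ c * ((L + 1) * (N + L + 1)) := h1
    _ ≤ c * (25 * (X ^ 2 + N * X)) := by
      refine mul_le_mul_of_nonneg_left (h2.trans ?_) c.cast_nonneg
      nlinarith
    _ = 25 * c * (X ^ 2 + N * X) := by ring
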